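/- Throughout, "periodic" means $1$-periodic in both variables $x_1,x_2$ of $\mathbb{R}^2$, functions are real-valued, and $\|F\|=\sup_{x\in\mathbb{R}^2}|F(x)|$. Notation. Let $d(x,y)=|x_1-y_1|+|x_2-y_2|^{2/3}$ for $x,y\in\mathbb{R}^2$. For $\alpha\in(0,\tfrac32)$ and a periodic function $g$ let $$[g]_\alpha=\sup_{x\ne y}\frac{|g(y)-g(x)|}{d^\alpha(y,x)}\ \ (\alpha\le 1),\qquad [g]_\alpha=\sup_{x\neq y}\frac{|g(y)-g(x)-\partial_1g(x)(y_1-x_1)|}{d^\alpha(y,x)}\ \ (\alpha>1),$$ the suprema being over $x\ne y$ in $\mathbb{R}^2$ (and $[g]_\alpha=\infty$ if $\alpha>1$ and $\partial_1 g$ does not exist everywhere). A periodic distribution is a continuous linear functional on the space of smooth periodic functions $u$ with the seminorms $\|\partial_1^j\partial_2^lu\|$, $j,l\ge0$; its average is its value at the constant function $1$. For a periodic distribution $f$ and $\beta\in(-\tfrac32,0)$ let $$[f]_\beta=\inf\{|c|+[g]_{\beta+1}+[h]_{\beta+\frac32}:\ f=c+\partial_1g+\partial_2h\}\quad\text{if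 }\beta\in(-1,0),$$ $$[f]_\beta=\inf\{|c|+[g]_{\beta+2}+[h]_{\beta+\frac32}:\ f=c+\partial_1^2g+\partial_2h\}\quad\text{if }\beta\in(-\tfrac32,-1],$$ where $c\in\mathbb{R}$, $g,h$ are periodic functions, and $\inf\emptyset=\infty$. For a smooth function $\eta$ on $\mathbb{R}^2$ with integrable derivatives, $(\eta*f)(x)$ is the value of $f$ at the smooth periodic function $y\mapsto\sum_{z\in\mathbb{Z}^2}\eta(x-y+z)$. For $T>0$ let $\psi_T$ be the function on $\mathbb{R}^2$ with Fourier transform $\int e^{-ik\cdot x}\psi_T(x)\,dx=\exp(-T(|k_1|^3+k_2^2))$, and $f_T=\psi_T*f$. For a Schwartz function $\phi$ on $\mathbb{R}^2$ and $\ell>0$ let $\phi_\ell(x)=\ell^{-5/2}\phi(\ell^{-1}x_1,\ell^{-3/2}x_2)$ and $f_\ell=\phi_\ell*f$. Lemma. i) For every $\beta\in(-\tfrac32,0)\setminus\{-1,-\tfrac12\}$ there is a constant $C<\infty$ depending only on $\beta$ such that for every periodic distribution $f$ $$[f]_\beta\le C\sup_{T\in(0,1]}(T^{1/3})^{-\beta}\|f_T\|\quad\text{and}\quad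 \sup_{T\in(0,1]}(T^{1/3})^{-\beta}\|f_T\|\le C[f]_\beta$$ (as inequalities in $[0,\infty]$). If $f$ has vanishing average, both inequalities also hold with the supremum over all $T>0$. ii) For every $\beta\in(-\tfrac32,0)$ and every Schwartz function $\phi$ on $\mathbb{R}^2$ there is a constant $C<\infty$ depending only on $\beta$ and $\phi$ such that for every periodic distribution $f$ $$\sup_{\ell\in(0,1]}\ell^{-\beta}\|f_\ell\|\le C[f]_\beta .$$ If $f$ has vanishing average, this also holds with the supremum over all $\ell>0$. -/

import Mathlib

noncomputable section

namespace AnisotropicHolder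

open scoped ContDiff ENNReal

/-- `1`-periodicity in both variables. -/
def IsPeriodic (u : ℝ × ℝ → ℝ) : Prop :=
  ∀ x : ℝ × ℝ, u (x.1 + 1, x.2) = u x ∧ u (x.1, x.2 + 1) = u x

/-- The partial derivative `∂₁`. -/
def partial₁ (u : ℝ × ℝ → ℝ) (x : ℝ × ℝ) : ℝ := deriv (fun s => u (s, x.2)) x.1

/-- The partial derivative `∂₂`. -/
def partial₂ (u : ℝ × ℝ → ℝ) (x : ℝ × ℝ) : ℝ := deriv (fun s => u (x.1, s)) x.2

/-- The vector space of smooth functions on the torus, seen as smooth periodic functions on the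
plane. -/
def smoothPeriodic : Submodule ℝ (ℝ × ℝ → ℝ) where
  carrier := {u | ContDiff ℝ ∞ u ∧ IsPeriodic u}
  add_mem' := by
    rintro u v ⟨hu, pu⟩ ⟨hv, pv⟩
    refine ⟨hu.add hv, fun x => ?_⟩
    simp [(pu x).1, (pu x).2, (pv x).1, (pv x).2]
  zero_mem' := ⟨contDiff_const, fun _ => ⟨rfl, rfl⟩⟩
  smul_mem' := by
    rintro a u ⟨hu, pu⟩
    refine ⟨contDiff_const.smul hu, fun x => ?_⟩
    simp [(pu x).1, (pu x).2]

/-- Test functions on the torus. This is a type of its own, so that it does not inherit the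
topology of pointwise convergence. -/
def TorusTest : Type := smoothPeriodic

instance : AddCommGroup TorusTest := inferInstanceAs (AddCommGroup smoothPeriodic)

instance : Module ℝ TorusTest := inferInstanceAs (Module ℝ smoothPeriodic)

/-- The underlying function of a test function. -/
def TorusTest.toFun (u : TorusTest) : ℝ × ℝ → ℝ := Subtype.val u

instance : CoeFun TorusTest (fun _ => ℝ × ℝ → ℝ) := ⟨TorusTest.toFun⟩

/-- The topology of the seminorms `sup |∂₁ʲ ∂₂ˡ u|`, that is, of uniform convergence of all partial
derivatives. -/
instance : TopologicalSpace TorusTest :=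
  ⨅ (j : ℕ) (l : ℕ), TopologicalSpace.induced
    (fun u : TorusTest => UniformFun.ofFun (partial₁^[j] (partial₂^[l] u))) inferInstance

/-- Periodic distributions: the topological dual of the smooth functions on the torus. -/
abbrev PeriodicDistribution : Type := TorusTest →L[ℝ] ℝ

/-- The test function that is constant equal to `1`. -/
def TorusTest.one : TorusTest :=
  (⟨fun _ => 1, contDiff_const, fun _ => ⟨rfl, rfl⟩⟩ : smoothPeriodic)

/-- The spatial average of a periodic distribution. -/
def average (f : PeriodicDistribution) : ℝ := f TorusTest.one

/-- The cell of periodicity `[0,1)²`. -/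
def cell : Set (ℝ × ℝ) := Set.Ico 0 1 ×ˢ Set.Ico 0 1

open Classical in
/-- Evaluation of a periodic distribution at a function on the plane that is smooth and periodic
(and `0` at all other functions). -/
def evalAt (f : PeriodicDistribution) (u : ℝ × ℝ → ℝ) : ℝ :=
  if hu : u ∈ smoothPeriodic then f (⟨u, hu⟩ : smoothPeriodic) else 0

/-- The periodization `∑_{z ∈ ℤ²} η(· - z)` of a function on the plane. -/
def periodize (η : ℝ × ℝ → ℝ) (y : ℝ × ℝ) : ℝ :=
  ∑' z : ℤ × ℤ, η (y.1 - z.1, y.2 - z.2)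

/-- The convolution on the plane `(η * f)(x) = ∫_{ℝ²} f(y) η(x - y) dy` of a periodic distribution
`f` with a smooth kernel `η` whose derivatives are integrable: `f` is evaluated at the periodization
of `y ↦ η(x - y)`. The periodization is smooth for the kernels used below (rapidly decreasing
ones and `heatKernel T`, `T > 0`). -/
def conv (η : ℝ × ℝ → ℝ) (f : PeriodicDistribution) (x : ℝ × ℝ) : ℝ :=
  evalAt f (periodize fun y => η (x.1 - y.1, x.2 - y.2))

/-- The kernel `ψ_T` with Fourier transform `∫ e^{-ik·x} ψ_T(x) dx = exp(-T(|k₁|³ + k₂²))`, through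
the inverse Fourier transform. The integral is real since the symbol is even. -/
def heatKernel (T : ℝ) (x : ℝ × ℝ) : ℝ :=
  (((2 * Real.pi) ^ 2 : ℝ)⁻¹ • ∫ k : ℝ × ℝ,
    Complex.exp (Complex.I * ((k.1 * x.1 + k.2 * x.2 : ℝ) : ℂ)) *
      ((Real.exp (-T * (|k.1| ^ 3 + k.2 ^ 2)) : ℝ) : ℂ)).re

/-- The anisotropic rescaling `φ_ℓ(x) = ℓ^{-5/2} φ(x₁/ℓ, x₂/ℓ^{3/2})`. -/
def rescale (φ : ℝ × ℝ → ℝ) (l : ℝ) (x : ℝ × ℝ) : ℝ :=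
  (l ^ (5 / 2 : ℝ))⁻¹ * φ (x.1 / l, x.2 / l ^ (3 / 2 : ℝ))

/-- The supremum norm, with values in `[0,∞]`. -/
def supNorm (F : ℝ × ℝ → ℝ) : ℝ≥0∞ := ⨆ x, ‖F x‖ₑ

/-- The anisotropic metric `d(x,y) = |x₁ - y₁| + |x₂ - y₂|^{2/3}`. -/
def aniDist (x y : ℝ × ℝ) : ℝ := |x.1 - y.1| + |x.2 - y.2| ^ (2 / 3 : ℝ)

/-- The Hölder seminorm `[g]_α` for `α ∈ (0,3/2)`, with values in `[0,∞]`. For `α > 1` it is `∞` if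
`∂₁g(x)` fails to exist at some `x`, whatever value `partial₁ g x` then has: a finite value forces
`g` to have the derivative `partial₁ g x` in the first variable at `x`. -/
def holderNorm (α : ℝ) (g : ℝ × ℝ → ℝ) : ℝ≥0∞ :=
  ⨆ (x : ℝ × ℝ) (y : ℝ × ℝ) (_ : x ≠ y),
    (if α ≤ 1 then ‖g y - g x‖ₑ else ‖g y - g x - partial₁ g x * (y.1 - x.1)‖ₑ) /
      ENNReal.ofReal (aniDist y x ^ α)

/-- `f = c + ∂₁g + ∂₂h` in the sense of periodic distributions. -/
def IsDecomp₁ (f : PeriodicDistribution) (c : ℝ) (g h : ℝ × ℝ → ℝ) : Prop :=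
  ∀ u : TorusTest, f u =
    (∫ x in cell, c * u x) - (∫ x in cell, g x * partial₁ u x) - ∫ x in cell, h x * partial₂ u x

/-- `f = c + ∂₁²g + ∂₂h` in the sense of periodic distributions. -/
def IsDecomp₂ (f : PeriodicDistribution) (c : ℝ) (g h : ℝ × ℝ → ℝ) : Prop :=
  ∀ u : TorusTest, f u =
    (∫ x in cell, c * u x) + (∫ x in cell, g x * partial₁ (partial₁ u) x)
      - ∫ x in cell, h x * partial₂ u x

/-- The Hölder norm `[f]_β` of a negative exponent `β ∈ (-3/2,0)`, with values in `[0,∞]`; it is `∞`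
if there is no decomposition. (Functions `g`, `h` with finite Hölder seminorms are continuous; all
others contribute the value `∞` to the infimum.) -/
def negHolderNorm (β : ℝ) (f : PeriodicDistribution) : ℝ≥0∞ :=
  if -1 < β then
    ⨅ (c : ℝ) (g : ℝ × ℝ → ℝ) (h : ℝ × ℝ → ℝ) (_ : IsPeriodic g) (_ : IsPeriodic h)
      (_ : IsDecomp₁ f c g h), ‖c‖ₑ + holderNorm (β + 1) g + holderNorm (β + 3 / 2) h
  else
    ⨅ (c : ℝ) (g : ℝ × ℝ → ℝ) (h : ℝ × ℝ → ℝ) (_ : IsPeriodic g) (_ : IsPeriodic h)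
      (_ : IsDecomp₂ f c g h), ‖c‖ₑ + holderNorm (β + 2) g + holderNorm (β + 3 / 2) h

/-- `sup_{T ∈ I} (T^{1/3})^{-β} ‖ψ_T * f‖`. -/
def heatSup (I : Set ℝ) (β : ℝ) (f : PeriodicDistribution) : ℝ≥0∞ :=
  ⨆ T ∈ I, ENNReal.ofReal ((T ^ (1 / 3 : ℝ)) ^ (-β)) * supNorm (conv (heatKernel T) f)

/-- `sup_{ℓ ∈ I} ℓ^{-β} ‖φ_ℓ * f‖`. -/
def maskSup (φ : ℝ × ℝ → ℝ) (I : Set ℝ) (β : ℝ) (f : PeriodicDistribution) : ℝ≥0∞ :=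
  ⨆ l ∈ I, ENNReal.ofReal (l ^ (-β)) * supNorm (conv (rescale φ l) f)

end AnisotropicHolder

end

open AnisotropicHolder
open scoped SchwartzMap

namespace AnisotropicHolder

open MeasureTheory Filter Topology
open scoped ContDiff ENNReal

/-! ### Partial derivatives -/

/-! The scaling gives length 1 to the first variable and 3/2 to the second, so `∂₁` costs one power
of `ℓ`, `∂₂` costs `ℓ^{3/2}`, and `d` is homogeneous of degree one.

Upper bounds for masks. Given `f = c + ∂₁g + ∂₂h` (or with `∂₁²g`), the derivatives are moved onto
the kernel. A differentiated kernel has mean zero, so the value of `g` or `h` at the base point may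
be subtracted; where the exponent `β + 3/2` of `h` exceeds one, the linear Taylor term may be
subtracted as well, because `∂₂φ` has vanishing first moment in `x₁`. The Hölder bound then yields
`ℓ^α` against a derivative factor `ℓ^{-1}`, `ℓ^{-2}` or `ℓ^{-3/2}`, which is `ℓ^β` in every case
(`exists_mask_bound`). The constant `c` is the average of `f`: it is harmless for `ℓ ≤ 1` and absent
for vanishing average. The argument needs only smoothness and cubic decay in each variable, so it
also covers `ψ_1`, which is not Schwartz because `|k₁|³` is not smooth at 0. Since `ψ_T` is `ψ_1`
rescaled by `ℓ = T^{1/3}`, this gives one half of i) as well as ii).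

Lower bound. Suppose `‖f_T‖ ≤ N (T^{1/3})^β` for `T ≤ 1`. At `T = 64^{-n}` the symbol depends only
on `k₁/4ⁿ` and `k₂/8ⁿ`. On a compact set of these variables it can be inverted by a fixed compactly
supported `C²` multiplier, whose periodic kernel has `L¹` norm bounded uniformly in `n` by summation
by parts. Hence every frequency block of `f` at level `n` is at most of order `N 4^{-nβ}`
(`exists_block_bound`). The difference of two consecutive low-frequency parts splits into a piece
with `k₁` bounded away from zero on the scale `4ⁿ` and one with `k₂` bounded away from zero on the
scale `8ⁿ`. The former is divided by `∂₁` or `∂₁²`, the latter by `∂₂`; the quotients satisfy dyadic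
bounds of order `β + 1`, `β + 2`, `β + 3/2`, and their sums are `g` and `h`. A function with dyadic
bounds of order `α` has finite `[·]_α` if `0 < α < 3/2` and `α ≠ 1` (`exists_holderNorm_tsum_le`);
the condition `α ≠ 1` excludes `β = -1` and `β = -1/2`. The telescoping sum starts at the average
and converges to `f`, because low-pass projections converge to the identity in the topology of test
functions (`tendsto_lowPass`). -/

theorem hasDerivAt_slice₁ {u : ℝ × ℝ → ℝ} {x : ℝ × ℝ} (hu : DifferentiableAt ℝ u x) :
    HasDerivAt (fun s => u (s, x.2)) (fderiv ℝ u x (1, 0)) x.1 := by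
  have h : HasFDerivAt u (fderiv ℝ u x) ((fun s : ℝ => (s, x.2)) x.1) := hu.hasFDerivAt
  exact h.comp_hasDerivAt x.1 ((hasDerivAt_id x.1).prodMk (hasDerivAt_const x.1 x.2))

theorem hasDerivAt_slice₂ {u : ℝ × ℝ → ℝ} {x : ℝ × ℝ} (hu : DifferentiableAt ℝ u x) :
    HasDerivAt (fun s => u (x.1, s)) (fderiv ℝ u x (0, 1)) x.2 := by
  have h : HasFDerivAt u (fderiv ℝ u x) ((fun s : ℝ => (x.1, s)) x.2) := hu.hasFDerivAt
  exact h.comp_hasDerivAt x.2 ((hasDerivAt_const x.2 x.1).prodMk (hasDerivAt_id x.2))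

theorem partial₁_eq_fderiv {u : ℝ × ℝ → ℝ} {x : ℝ × ℝ} (hu : DifferentiableAt ℝ u x) :
    partial₁ u x = fderiv ℝ u x (1, 0) := (hasDerivAt_slice₁ hu).deriv

theorem partial₂_eq_fderiv {u : ℝ × ℝ → ℝ} {x : ℝ × ℝ} (hu : DifferentiableAt ℝ u x) :
    partial₂ u x = fderiv ℝ u x (0, 1) := (hasDerivAt_slice₂ hu).deriv

theorem hasDerivAt_partial₁ {u : ℝ × ℝ → ℝ} {x : ℝ × ℝ} (hu : DifferentiableAt ℝ u x) :
    HasDerivAt (fun s => u (s, x.2)) (partial₁ u x) x.1 := by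
  rw [partial₁_eq_fderiv hu]; exact hasDerivAt_slice₁ hu

theorem hasDerivAt_partial₂ {u : ℝ × ℝ → ℝ} {x : ℝ × ℝ} (hu : DifferentiableAt ℝ u x) :
    HasDerivAt (fun s => u (x.1, s)) (partial₂ u x) x.2 := by
  rw [partial₂_eq_fderiv hu]; exact hasDerivAt_slice₂ hu

theorem partial₁_eq_fderiv_fun {u : ℝ × ℝ → ℝ} (hu : ContDiff ℝ ∞ u) :
    partial₁ u = fun x => fderiv ℝ u x (1, 0) :=
  funext fun x => partial₁_eq_fderiv (hu.differentiable (by simp) x)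

theorem partial₂_eq_fderiv_fun {u : ℝ × ℝ → ℝ} (hu : ContDiff ℝ ∞ u) :
    partial₂ u = fun x => fderiv ℝ u x (0, 1) :=
  funext fun x => partial₂_eq_fderiv (hu.differentiable (by simp) x)

theorem contDiff_partial₁ {u : ℝ × ℝ → ℝ} (hu : ContDiff ℝ ∞ u) : ContDiff ℝ ∞ (partial₁ u) := by
  rw [partial₁_eq_fderiv_fun hu]
  exact (hu.fderiv_right (m := ∞) (by simp)).clm_apply contDiff_const

theorem contDiff_partial₂ {u : ℝ × ℝ → ℝ} (hu : ContDiff ℝ ∞ u) : ContDiff ℝ ∞ (partial₂ u) := by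
  rw [partial₂_eq_fderiv_fun hu]
  exact (hu.fderiv_right (m := ∞) (by simp)).clm_apply contDiff_const

theorem IsPeriodic.partial₁ {u : ℝ × ℝ → ℝ} (hu : IsPeriodic u) : IsPeriodic (partial₁ u) := by
  intro x
  constructor
  · have h : (fun s => u (s, x.2)) = fun s => u (s + 1, x.2) := funext fun s => ((hu (s, x.2)).1).symm
    simp only [AnisotropicHolder.partial₁]
    conv_rhs => rw [h]
    exact (deriv_comp_add_const (fun s => u (s, x.2)) 1 x.1).symm
  · have h : (fun s => u (s, x.2 + 1)) = fun s => u (s, x.2) := funext fun s => (hu (s, x.2)).2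
    simp only [AnisotropicHolder.partial₁, h]

theorem IsPeriodic.partial₂ {u : ℝ × ℝ → ℝ} (hu : IsPeriodic u) : IsPeriodic (partial₂ u) := by
  intro x
  constructor
  · have h : (fun s => u (x.1 + 1, s)) = fun s => u (x.1, s) := funext fun s => (hu (x.1, s)).1
    simp only [AnisotropicHolder.partial₂, h]
  · have h : (fun s => u (x.1, s)) = fun s => u (x.1, s + 1) := funext fun s => ((hu (x.1, s)).2).symm
    simp only [AnisotropicHolder.partial₂]
    conv_rhs => rw [h]
    exact (deriv_comp_add_const (fun s => u (x.1, s)) 1 x.2).symm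

/-! ### Test functions -/

/-- The test function with a given underlying smooth periodic function. -/
def TorusTest.mk (u : ℝ × ℝ → ℝ) (hu : u ∈ smoothPeriodic) : TorusTest := (⟨u, hu⟩ : smoothPeriodic)

@[simp] theorem TorusTest.mk_apply (u : ℝ × ℝ → ℝ) (hu : u ∈ smoothPeriodic) :
    (TorusTest.mk u hu).toFun = u := rfl

theorem TorusTest.ext {u v : TorusTest} (h : ∀ x, u x = v x) : u = v :=
  Subtype.ext (funext h)

theorem TorusTest.contDiff (u : TorusTest) : ContDiff ℝ ∞ u.toFun := (Subtype.prop u).1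

theorem TorusTest.isPeriodic (u : TorusTest) : IsPeriodic u.toFun := (Subtype.prop u).2

theorem TorusTest.differentiable (u : TorusTest) : Differentiable ℝ u.toFun :=
  u.contDiff.differentiable (by simp)

@[fun_prop]
theorem TorusTest.continuous (u : TorusTest) : Continuous u.toFun := u.contDiff.continuous

theorem TorusTest.coe_add (u v : TorusTest) : (u + v).toFun = u.toFun + v.toFun := rfl

theorem TorusTest.coe_smul (a : ℝ) (u : TorusTest) : (a • u).toFun = a • u.toFun := rfl

/-- Evaluation at a point as a linear map. -/
def TorusTest.eval (x : ℝ × ℝ) : TorusTest →ₗ[ℝ] ℝ where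
  toFun u := u x
  map_add' _ _ := rfl
  map_smul' _ _ := rfl

theorem TorusTest.sum_apply {ι : Type*} (s : Finset ι) (u : ι → TorusTest) (x : ℝ × ℝ) :
    (∑ i ∈ s, u i).toFun x = ∑ i ∈ s, (u i) x :=
  map_sum (TorusTest.eval x) u s

/-- `∂₁` on test functions. -/
noncomputable def TorusTest.D₁ : TorusTest →ₗ[ℝ] TorusTest where
  toFun u := TorusTest.mk (partial₁ u) ⟨contDiff_partial₁ u.contDiff, u.isPeriodic.partial₁⟩
  map_add' u v := TorusTest.ext fun x =>
    ((hasDerivAt_partial₁ (u.differentiable x)).add (hasDerivAt_partial₁ (v.differentiable x))).deriv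
  map_smul' a u := TorusTest.ext fun x =>
    ((hasDerivAt_partial₁ (u.differentiable x)).const_smul a).deriv

/-- `∂₂` on test functions. -/
noncomputable def TorusTest.D₂ : TorusTest →ₗ[ℝ] TorusTest where
  toFun u := TorusTest.mk (partial₂ u) ⟨contDiff_partial₂ u.contDiff, u.isPeriodic.partial₂⟩
  map_add' u v := TorusTest.ext fun x =>
    ((hasDerivAt_partial₂ (u.differentiable x)).add (hasDerivAt_partial₂ (v.differentiable x))).deriv
  map_smul' a u := TorusTest.ext fun x =>
    ((hasDerivAt_partial₂ (u.differentiable x)).const_smul a).deriv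

theorem TorusTest.coe_D₁ (u : TorusTest) : (TorusTest.D₁ u).toFun = partial₁ u.toFun := rfl

theorem TorusTest.coe_D₂ (u : TorusTest) : (TorusTest.D₂ u).toFun = partial₂ u.toFun := rfl

theorem TorusTest.coe_iterate_D₁ (u : TorusTest) (j : ℕ) :
    ((TorusTest.D₁)^[j] u).toFun = (partial₁)^[j] u.toFun := by
  induction j with
  | zero => rfl
  | succ j ih => rw [Function.iterate_succ_apply', Function.iterate_succ_apply', coe_D₁, ih]

theorem TorusTest.coe_iterate_D₂ (u : TorusTest) (j : ℕ) :
    ((TorusTest.D₂)^[j] u).toFun = (partial₂)^[j] u.toFun := by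
  induction j with
  | zero => rfl
  | succ j ih => rw [Function.iterate_succ_apply', Function.iterate_succ_apply', coe_D₂, ih]

/-- The topology is an infimum of topologies induced from uniform convergence, so convergence is
checked separately for each pair of derivative orders. This is the form in which the continuity of a
distribution is exploited. -/
theorem TorusTest.tendsto_iff {ι : Type*} {p : Filter ι} {v : ι → TorusTest} {u : TorusTest} :
    Tendsto v p (𝓝 u) ↔ ∀ j l : ℕ, TendstoUniformly
      (fun i => (TorusTest.D₁^[j] (TorusTest.D₂^[l] (v i))).toFun)
      (TorusTest.D₁^[j] (TorusTest.D₂^[l] u)).toFun p := by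
  simp only [nhds_iInf, nhds_induced, tendsto_iInf, tendsto_comap_iff,
    UniformFun.tendsto_iff_tendstoUniformly, coe_iterate_D₁, coe_iterate_D₂]
  rfl

theorem evalAt_of_mem (f : PeriodicDistribution) {u : ℝ × ℝ → ℝ} (hu : u ∈ smoothPeriodic) :
    evalAt f u = f (TorusTest.mk u hu) := by
  rw [evalAt, dif_pos hu]; rfl

theorem evalAt_coe (f : PeriodicDistribution) (u : TorusTest) : evalAt f u.toFun = f u :=
  evalAt_of_mem f (Subtype.prop u)

end AnisotropicHolder

namespace AnisotropicHolder

open MeasureTheory Filter Topology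
open scoped ContDiff ENNReal

/-! ### Rapidly decreasing kernels and their periodizations -/

/-- The weight `(1 + |x₁|)⁻³ (1 + |x₂|)⁻³`. -/
noncomputable def weight (x : ℝ × ℝ) : ℝ := ((1 + |x.1|) ^ 3 * (1 + |x.2|) ^ 3)⁻¹

theorem weight_pos (x : ℝ × ℝ) : 0 < weight x := by unfold weight; positivity

/-- Peetre's inequality `1 + |b| ≤ (1 + |a|)(1 + |a - b|)` in each variable. It makes lattice sums
of translates converge locally uniformly. -/
theorem weight_sub_le (x z : ℝ × ℝ) :
    weight (x.1 - z.1, x.2 - z.2) ≤ (weight x)⁻¹ * weight z := by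
  have key : ∀ a b : ℝ, (1 + |b|) ^ 3 ≤ (1 + |a|) ^ 3 * (1 + |a - b|) ^ 3 := fun a b => by
    rw [← mul_pow]
    refine pow_le_pow_left₀ (by positivity) ?_ 3
    have : |b| ≤ |a| + |a - b| := by
      have := abs_sub_abs_le_abs_sub b a
      rw [abs_sub_comm] at this; linarith
    nlinarith [mul_nonneg (abs_nonneg a) (abs_nonneg (a - b))]
  have h1 := key x.1 z.1
  have h2 := key x.2 z.2
  simp only [weight, inv_inv]
  rw [← div_eq_mul_inv, inv_eq_one_div, div_le_div_iff₀ (by positivity) (by positivity), one_mul]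
  calc (1 + |z.1|) ^ 3 * (1 + |z.2|) ^ 3
      ≤ ((1 + |x.1|) ^ 3 * (1 + |x.1 - z.1|) ^ 3) * ((1 + |x.2|) ^ 3 * (1 + |x.2 - z.2|) ^ 3) := by
        gcongr
    _ = _ := by ring

theorem summable_one_add_abs_int : Summable fun k : ℤ => ((1 + |(k : ℝ)|) ^ 3)⁻¹ := by
  have h : Summable fun k : ℤ => |(k : ℝ)| ^ (-2 : ℝ) := Real.summable_abs_int_rpow (by norm_num)
  refine Summable.of_norm_bounded_eventually (g := fun k : ℤ => |(k : ℝ)| ^ (-2 : ℝ)) h ?_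
  have h0 : ∀ᶠ k : ℤ in cofinite, k ≠ 0 := (Set.finite_singleton 0).compl_mem_cofinite
  filter_upwards [h0] with k hk
  have hk' : 0 < |(k : ℝ)| := by positivity
  rw [Real.norm_of_nonneg (by positivity), Real.rpow_neg hk'.le]
  refine inv_anti₀ (by positivity) ?_
  rw [show (2 : ℝ) = ((2 : ℕ) : ℝ) by norm_num, Real.rpow_natCast]
  calc |(k : ℝ)| ^ 2 ≤ (1 + |(k : ℝ)|) ^ 2 := by gcongr; linarith
    _ ≤ (1 + |(k : ℝ)|) ^ 3 := pow_le_pow_right₀ (by linarith) (by norm_num)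

theorem summable_weight : Summable fun z : ℤ × ℤ => weight (z.1, z.2) := by
  have h := summable_one_add_abs_int.mul_of_nonneg summable_one_add_abs_int
    (fun k => by positivity) (fun k => by positivity)
  refine h.congr fun z => ?_
  simp [weight, mul_comm]

/-- Smooth kernels all of whose derivatives are bounded by a multiple of the weight. -/
structure RapidKernel {E : Type} [NormedAddCommGroup E] [NormedSpace ℝ E] (F : ℝ × ℝ → E) :
    Prop where
  contDiff : ContDiff ℝ ∞ F
  bound : ∀ n : ℕ, ∃ C, ∀ x, ‖iteratedFDeriv ℝ n F x‖ ≤ C * weight x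

section

variable {E : Type} [NormedAddCommGroup E] [NormedSpace ℝ E]

theorem RapidKernel.norm_le {F : ℝ × ℝ → E} (hF : RapidKernel F) :
    ∃ C, 0 ≤ C ∧ ∀ x, ‖F x‖ ≤ C * weight x := by
  obtain ⟨C, hC⟩ := hF.bound 0
  simp only [norm_iteratedFDeriv_zero] at hC
  refine ⟨C, ?_, hC⟩
  have := (norm_nonneg _).trans (hC 0)
  exact nonneg_of_mul_nonneg_left this (weight_pos 0)

theorem RapidKernel.fderiv {F : ℝ × ℝ → E} (hF : RapidKernel F) : RapidKernel (fderiv ℝ F) := by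
  refine ⟨hF.contDiff.fderiv_right (m := ∞) (by simp), fun n => ?_⟩
  obtain ⟨C, hC⟩ := hF.bound (n + 1)
  exact ⟨C, fun x => by rw [norm_iteratedFDeriv_fderiv]; exact hC x⟩

theorem RapidKernel.fderiv_apply {F : ℝ × ℝ → E} (hF : RapidKernel F) (v : ℝ × ℝ) :
    RapidKernel (fun x => _root_.fderiv ℝ F x v) := by
  have h := hF.fderiv
  refine ⟨h.contDiff.clm_apply contDiff_const, fun n => ?_⟩
  obtain ⟨C, hC⟩ := h.bound n
  refine ⟨‖v‖ * C, fun x => ?_⟩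
  refine (norm_iteratedFDeriv_clm_apply_const (h.contDiff.contDiffAt (n := ∞)) (by exact_mod_cast le_top)).trans ?_
  rw [mul_assoc]
  exact mul_le_mul_of_nonneg_left (hC x) (norm_nonneg v)

theorem RapidKernel.partial₁ {F : ℝ × ℝ → ℝ} (hF : RapidKernel F) : RapidKernel (partial₁ F) := by
  rw [partial₁_eq_fderiv_fun hF.contDiff]; exact hF.fderiv_apply _

theorem RapidKernel.partial₂ {F : ℝ × ℝ → ℝ} (hF : RapidKernel F) : RapidKernel (partial₂ F) := by
  rw [partial₂_eq_fderiv_fun hF.contDiff]; exact hF.fderiv_apply _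

theorem RapidKernel.continuous {F : ℝ × ℝ → E} (hF : RapidKernel F) : Continuous F :=
  hF.contDiff.continuous

/-- The periodization of a vector-valued kernel. -/
noncomputable def periodizeV (F : ℝ × ℝ → E) (y : ℝ × ℝ) : E :=
  ∑' z : ℤ × ℤ, F (y.1 - z.1, y.2 - z.2)

theorem exists_summable_bound {V : Type*} [NormedAddCommGroup V] {F : ℝ × ℝ → V} {C : ℝ} (hC0 : 0 ≤ C)
    (hF : ∀ x, ‖F x‖ ≤ C * weight x) (R : ℝ) :
    ∃ w : ℤ × ℤ → ℝ, Summable w ∧ ∀ z : ℤ × ℤ, ∀ y ∈ Metric.ball (0 : ℝ × ℝ) R,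
      ‖F (y.1 - z.1, y.2 - z.2)‖ ≤ w z := by
  refine ⟨fun z => C * (((1 + R) ^ 3 * (1 + R) ^ 3) * weight (z.1, z.2)),
    (summable_weight.mul_left _).mul_left _, fun z y hy => ?_⟩
  refine (hF _).trans (mul_le_mul_of_nonneg_left ?_ hC0)
  refine (weight_sub_le y (z.1, z.2)).trans (mul_le_mul_of_nonneg_right ?_ (weight_pos _).le)
  have hy' : ‖y‖ < R := by simpa using hy
  have h1 : |y.1| ≤ R := ((norm_fst_le y).trans hy'.le)
  have h2 : |y.2| ≤ R := ((norm_snd_le y).trans hy'.le)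
  have hR : 0 ≤ R := (abs_nonneg _).trans h1
  rw [weight, inv_inv]
  gcongr

theorem summable_periodize {V : Type*} [NormedAddCommGroup V] [CompleteSpace V] {F : ℝ × ℝ → V} {C : ℝ} (hC0 : 0 ≤ C)
    (hF : ∀ x, ‖F x‖ ≤ C * weight x) (y : ℝ × ℝ) :
    Summable fun z : ℤ × ℤ => F (y.1 - z.1, y.2 - z.2) := by
  obtain ⟨w, hw, hb⟩ := exists_summable_bound hC0 hF (‖y‖ + 1)
  exact Summable.of_norm_bounded hw fun z => hb z y (by simp)

theorem RapidKernel.hasFDerivAt_periodizeV [CompleteSpace E] {F : ℝ × ℝ → E} (hF : RapidKernel F)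
    (y : ℝ × ℝ) : HasFDerivAt (periodizeV F) (periodizeV (_root_.fderiv ℝ F) y) y := by
  obtain ⟨C, hC0, hC⟩ := hF.norm_le
  obtain ⟨C', hC0', hC'⟩ := hF.fderiv.norm_le
  obtain ⟨w, hw, hb⟩ := exists_summable_bound hC0' hC' (‖y‖ + 1)
  have hy : y ∈ Metric.ball (0 : ℝ × ℝ) (‖y‖ + 1) := by simp
  refine hasFDerivAt_tsum_of_isPreconnected hw Metric.isOpen_ball
    (convex_ball (0 : ℝ × ℝ) (‖y‖ + 1)).isPreconnected (fun z x _ => ?_) (fun z x hx => hb z x hx)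
    hy (summable_periodize hC0 hC y) hy
  have hd : HasFDerivAt F (_root_.fderiv ℝ F (x - ((z.1 : ℝ), (z.2 : ℝ))))
      (x - ((z.1 : ℝ), (z.2 : ℝ))) := (hF.contDiff.differentiable (by simp) _).hasFDerivAt
  exact (hd.comp x ((hasFDerivAt_id x).sub_const _) :)

/-- The derivative of a periodization is the periodization of the derivative, which is again rapid
but takes values in linear maps. The induction therefore runs over all target spaces at once. -/
theorem RapidKernel.contDiff_periodizeV [CompleteSpace E] {F : ℝ × ℝ → E} (hF : RapidKernel F)
    (n : ℕ) : ContDiff ℝ n (periodizeV F) := by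
  induction n generalizing E with
  | zero =>
    exact contDiff_zero.2 (continuous_iff_continuousAt.2 fun y =>
      (hF.hasFDerivAt_periodizeV y).continuousAt)
  | succ n ih =>
    push_cast
    rw [contDiff_succ_iff_fderiv]
    refine ⟨fun y => (hF.hasFDerivAt_periodizeV y).differentiableAt, by simp, ?_⟩
    have : _root_.fderiv ℝ (periodizeV F) = periodizeV (_root_.fderiv ℝ F) :=
      funext fun y => (hF.hasFDerivAt_periodizeV y).fderiv
    rw [this]
    exact ih hF.fderiv

end

theorem isPeriodic_periodize (F : ℝ × ℝ → ℝ) : IsPeriodic (periodize F) := by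
  intro x
  constructor
  · simp only [periodize]
    rw [← (Equiv.addRight ((1, 0) : ℤ × ℤ)).tsum_eq]
    refine tsum_congr fun z => ?_
    simp
  · simp only [periodize]
    rw [← (Equiv.addRight ((0, 1) : ℤ × ℤ)).tsum_eq]
    refine tsum_congr fun z => ?_
    simp

theorem RapidKernel.periodize_mem {F : ℝ × ℝ → ℝ} (hF : RapidKernel F) :
    periodize F ∈ smoothPeriodic :=
  ⟨contDiff_infty.2 hF.contDiff_periodizeV, isPeriodic_periodize F⟩

theorem RapidKernel.fderiv_periodize_apply {F : ℝ × ℝ → ℝ} (hF : RapidKernel F) (y v : ℝ × ℝ) :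
    _root_.fderiv ℝ (periodize F) y v = periodize (fun x => _root_.fderiv ℝ F x v) y := by
  have h1 : _root_.fderiv ℝ (periodize F) y = periodizeV (_root_.fderiv ℝ F) y :=
    (hF.hasFDerivAt_periodizeV y).fderiv
  obtain ⟨C, hC0, hC⟩ := hF.fderiv.norm_le
  rw [h1, periodizeV, periodize]
  exact (ContinuousLinearMap.apply ℝ ℝ v).map_tsum (summable_periodize hC0 hC y)

theorem RapidKernel.partial₁_periodize {F : ℝ × ℝ → ℝ} (hF : RapidKernel F) :
    AnisotropicHolder.partial₁ (periodize F) = periodize (AnisotropicHolder.partial₁ F) := by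
  rw [partial₁_eq_fderiv_fun hF.periodize_mem.1, partial₁_eq_fderiv_fun hF.contDiff]
  exact funext fun y => hF.fderiv_periodize_apply y _

theorem RapidKernel.partial₂_periodize {F : ℝ × ℝ → ℝ} (hF : RapidKernel F) :
    AnisotropicHolder.partial₂ (periodize F) = periodize (AnisotropicHolder.partial₂ F) := by
  rw [partial₂_eq_fderiv_fun hF.periodize_mem.1, partial₂_eq_fderiv_fun hF.contDiff]
  exact funext fun y => hF.fderiv_periodize_apply y _

/-! ### Periodic functions and unfolding -/

theorem IsPeriodic.add_int {g : ℝ × ℝ → ℝ} (hg : IsPeriodic g) (x : ℝ × ℝ) (z : ℤ × ℤ) :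
    g (x.1 + z.1, x.2 + z.2) = g x := by
  have h1 : ∀ t, Function.Periodic (fun s => g (s, t)) 1 := fun t s => (hg (s, t)).1
  have h2 : ∀ s, Function.Periodic (fun t => g (s, t)) 1 := fun s t => (hg (s, t)).2
  have e1 := (h1 (x.2 + z.2)).int_mul z.1 x.1
  have e2 := (h2 x.1).int_mul z.2 x.2
  simp only [mul_one] at e1 e2
  rw [e1, e2]

theorem IsPeriodic.exists_mem_cell {g : ℝ × ℝ → ℝ} (hg : IsPeriodic g) (x : ℝ × ℝ) :
    ∃ y ∈ cell, g y = g x := by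
  refine ⟨(Int.fract x.1, Int.fract x.2), ⟨⟨Int.fract_nonneg _, Int.fract_lt_one _⟩,
    ⟨Int.fract_nonneg _, Int.fract_lt_one _⟩⟩, ?_⟩
  rw [← hg.add_int _ (⌊x.1⌋, ⌊x.2⌋)]
  simp [Int.fract_add_floor]

theorem cell_subset : cell ⊆ Set.Icc (0 : ℝ) 1 ×ˢ Set.Icc (0 : ℝ) 1 :=
  Set.prod_mono Set.Ico_subset_Icc_self Set.Ico_subset_Icc_self

theorem measurableSet_cell : MeasurableSet cell := measurableSet_Ico.prod measurableSet_Ico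

theorem volume_cell : volume cell = 1 := by
  rw [cell, Measure.volume_eq_prod, Measure.prod_prod]; simp

instance isProbabilityMeasure_cell : IsProbabilityMeasure (volume.restrict cell) :=
  ⟨by rw [Measure.restrict_apply_univ, volume_cell]⟩

theorem IsPeriodic.exists_bound {g : ℝ × ℝ → ℝ} (hg : IsPeriodic g) (hc : Continuous g) :
    ∃ C, 0 ≤ C ∧ ∀ x, |g x| ≤ C := by
  obtain ⟨C, hC⟩ := ((isCompact_Icc (a := (0 : ℝ)) (b := 1)).prod
    (isCompact_Icc (a := (0 : ℝ)) (b := 1))).exists_bound_of_continuousOn hc.continuousOn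
  refine ⟨C, (norm_nonneg _).trans (hC (0, 0) (by simp)), fun x => ?_⟩
  obtain ⟨y, hy, h⟩ := hg.exists_mem_cell x
  rw [← h]; exact hC y (cell_subset hy)

theorem integrableOn_cell {g : ℝ × ℝ → ℝ} (hc : Continuous g) : IntegrableOn g cell :=
  (hc.continuousOn.integrableOn_compact ((isCompact_Icc).prod isCompact_Icc)).mono_set cell_subset

theorem integrable_one_add_abs : Integrable fun x : ℝ => ((1 + |x|) ^ 3)⁻¹ := by
  have h := integrable_one_add_norm (E := ℝ) (μ := volume) (r := 3) (by simp)
  refine h.congr (ae_of_all _ fun x => ?_)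
  simp only [Real.norm_eq_abs]
  rw [Real.rpow_neg (by positivity), show (3 : ℝ) = ((3 : ℕ) : ℝ) by norm_num, Real.rpow_natCast]

theorem integrable_weight : Integrable weight := by
  have h := integrable_one_add_abs.mul_prod integrable_one_add_abs
  refine h.congr (ae_of_all _ fun x => ?_)
  simp [weight, mul_comm]

theorem continuous_weight : Continuous weight := by
  unfold weight
  exact Continuous.inv₀ (by fun_prop) fun x => by positivity

theorem integrable_of_weight_bound {κ : ℝ × ℝ → ℝ} {C : ℝ} (hc : Continuous κ)
    (hC : ∀ x, |κ x| ≤ C * weight x) : Integrable κ :=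
  (integrable_weight.const_mul C).mono' hc.aestronglyMeasurable (ae_of_all _ hC)

/-- The translate by `-z` of the cell. -/
def cellTranslate (z : ℤ × ℤ) : Set (ℝ × ℝ) :=
  (fun x : ℝ × ℝ => x + ((z.1 : ℝ), (z.2 : ℝ))) ⁻¹' cell

theorem iUnion_cellTranslate : (⋃ z, cellTranslate z) = Set.univ := by
  refine Set.eq_univ_of_forall fun x => Set.mem_iUnion.2 ⟨(-⌊x.1⌋, -⌊x.2⌋), ?_⟩
  have h1 := Int.floor_le x.1
  have h2 := Int.lt_floor_add_one x.1
  have h3 := Int.floor_le x.2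
  have h4 := Int.lt_floor_add_one x.2
  simp only [cellTranslate, cell, Set.mem_preimage, Set.mem_prod, Set.mem_Ico, Prod.fst_add,
    Prod.snd_add, Int.cast_neg]
  exact ⟨⟨by linarith, by linarith⟩, ⟨by linarith, by linarith⟩⟩

theorem pairwise_disjoint_cellTranslate : Pairwise (Function.onFun Disjoint cellTranslate) := by
  intro z z' hzz
  refine Set.disjoint_left.2 fun x hx hx' => hzz ?_
  simp only [cellTranslate, cell, Set.mem_preimage, Set.mem_prod, Set.mem_Ico, Prod.fst_add,
    Prod.snd_add] at hx hx'
  have key : ∀ (a : ℝ) (m n : ℤ), 0 ≤ a + m → a + m < 1 → 0 ≤ a + n → a + n < 1 → m = n := by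
    intro a m n h1 h2 h3 h4
    have h5 : (m : ℝ) < n + 1 := by linarith
    have h6 : (n : ℝ) < m + 1 := by linarith
    norm_cast at h5 h6
    omega
  exact Prod.ext (key x.1 _ _ hx.1.1 hx.1.2 hx'.1.1 hx'.1.2)
    (key x.2 _ _ hx.2.1 hx.2.2 hx'.2.1 hx'.2.2)

theorem measurableSet_cellTranslate (z : ℤ × ℤ) : MeasurableSet (cellTranslate z) :=
  (measurable_id.add_const _) measurableSet_cell

theorem setIntegral_cellTranslate (F : ℝ × ℝ → ℝ) (z : ℤ × ℤ) :
    ∫ x in cellTranslate z, F x = ∫ x in cell, F (x.1 - z.1, x.2 - z.2) := by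
  have hmp := measurePreserving_add_right (volume : Measure (ℝ × ℝ)) ((z.1 : ℝ), (z.2 : ℝ))
  have hemb : MeasurableEmbedding (fun x : ℝ × ℝ => x + ((z.1 : ℝ), (z.2 : ℝ))) :=
    measurableEmbedding_addRight _
  have := hmp.setIntegral_preimage_emb hemb (fun x => F (x.1 - z.1, x.2 - z.2)) cell
  rw [← this]
  simp [cellTranslate]

/-- Unfolding: the integral over the plane is split along the translates of the cell, and
periodicity of `g` identifies the resulting series with the termwise integral of the periodization.
-/
theorem integral_cell_mul_periodize {g κ : ℝ × ℝ → ℝ} (hg : IsPeriodic g) (hgc : Continuous g)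
    (hκ : Continuous κ) {C : ℝ} (hC0 : 0 ≤ C) (hC : ∀ x, |κ x| ≤ C * weight x) :
    ∫ x in cell, g x * periodize κ x = ∫ x, g x * κ x := by
  obtain ⟨B, hB0, hB⟩ := hg.exists_bound hgc
  have hint : Integrable fun x => g x * κ x :=
    integrable_of_weight_bound (C := B * C) (hgc.mul hκ) fun x => by
      rw [abs_mul, mul_assoc]
      exact mul_le_mul (hB x) (hC x) (abs_nonneg _) hB0
  have h1 := hasSum_integral_iUnion (f := fun x => g x * κ x) (μ := volume)
    measurableSet_cellTranslate pairwise_disjoint_cellTranslate hint.integrableOn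
  rw [iUnion_cellTranslate, setIntegral_univ] at h1
  simp only [setIntegral_cellTranslate] at h1
  have hgz : ∀ (x : ℝ × ℝ) (z : ℤ × ℤ), g (x.1 - z.1, x.2 - z.2) = g x := fun x z => by
    have := hg.add_int x (-z.1, -z.2)
    simpa [sub_eq_add_neg] using this
  simp only [hgz] at h1
  obtain ⟨w, hw, hb⟩ := exists_summable_bound (F := κ) hC0 hC 2
  have hball : ∀ x ∈ cell, x ∈ Metric.ball (0 : ℝ × ℝ) 2 := fun x hx => by
    have := cell_subset hx
    simp only [Set.mem_prod, Set.mem_Icc] at this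
    rw [mem_ball_zero_iff, Prod.norm_def, max_lt_iff, Real.norm_eq_abs, Real.norm_eq_abs,
      abs_of_nonneg this.1.1, abs_of_nonneg this.2.1]
    constructor <;> linarith
  have h2 : HasSum (fun z : ℤ × ℤ => ∫ x in cell, g x * κ (x.1 - z.1, x.2 - z.2))
      (∫ x in cell, g x * periodize κ x) := by
    refine hasSum_integral_of_dominated_convergence (fun z _ => B * w z) (fun z => ?_) (fun z => ?_)
      (ae_of_all _ fun x => hw.mul_left B) (integrable_const _) (ae_of_all _ fun x => ?_)
    · exact Continuous.aestronglyMeasurable (by fun_prop)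
    · refine (ae_restrict_iff' measurableSet_cell).2 (ae_of_all _ fun x hx => ?_)
      rw [norm_mul]
      exact mul_le_mul (hB x) (hb z x (hball x hx)) (norm_nonneg _) hB0
    · exact (summable_periodize (F := κ) hC0 hC x).hasSum.mul_left (g x)
  exact h2.unique h1

end AnisotropicHolder

namespace AnisotropicHolder

open MeasureTheory Filter Topology
open scoped ContDiff ENNReal

/-! ### Functions with finite Hölder seminorm -/

theorem aniDist_nonneg (x y : ℝ × ℝ) : 0 ≤ aniDist x y := by unfold aniDist; positivity

theorem aniDist_self (x : ℝ × ℝ) : aniDist x x = 0 := by simp [aniDist]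

theorem aniDist_pos {x y : ℝ × ℝ} (h : x ≠ y) : 0 < aniDist x y := by
  by_cases h1 : x.1 = y.1
  · have h2 : x.2 ≠ y.2 := fun h2 => h (Prod.ext h1 h2)
    have : 0 < |x.2 - y.2| := abs_pos.2 (sub_ne_zero.2 h2)
    unfold aniDist; positivity
  · have : 0 < |x.1 - y.1| := abs_pos.2 (sub_ne_zero.2 h1)
    unfold aniDist; positivity

theorem continuous_aniDist (x : ℝ × ℝ) : Continuous fun y => aniDist y x := by
  unfold aniDist
  exact Continuous.add (by fun_prop) (Continuous.rpow_const (by fun_prop) fun _ => Or.inr (by norm_num))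

/-- The first-order coefficient entering the Hölder seminorm. -/
noncomputable def holderSlope (α : ℝ) (g : ℝ × ℝ → ℝ) (x : ℝ × ℝ) : ℝ :=
  if α ≤ 1 then 0 else partial₁ g x

/-- Both cases of the seminorm become one estimate, with slope zero when `α ≤ 1`. The diagonal, left
out of the supremum, is trivial. -/
theorem holder_bound {α : ℝ} (hα : 0 < α) {g : ℝ × ℝ → ℝ} (hg : holderNorm α g ≠ ⊤)
    (x y : ℝ × ℝ) : |g y - g x - holderSlope α g x * (y.1 - x.1)| ≤
      (holderNorm α g).toReal * aniDist y x ^ α := by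
  rcases eq_or_ne x y with rfl | hxy
  · simp [aniDist_self, Real.zero_rpow hα.ne']
  have hd : 0 < aniDist y x ^ α := Real.rpow_pos_of_pos (aniDist_pos hxy.symm) α
  have h1 : ‖g y - g x - holderSlope α g x * (y.1 - x.1)‖ₑ / ENNReal.ofReal (aniDist y x ^ α) ≤
      holderNorm α g := by
    unfold holderNorm
    refine le_iSup_of_le x (le_iSup_of_le y (le_iSup_of_le hxy ?_))
    unfold holderSlope
    split_ifs <;> simp
  have h2 := (ENNReal.div_le_iff (by simpa using hd) ENNReal.ofReal_ne_top).1 h1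
  rw [← ENNReal.ofReal_toReal hg, ← ENNReal.ofReal_mul ENNReal.toReal_nonneg,
    ← ofReal_norm, ENNReal.ofReal_le_ofReal_iff (by positivity)] at h2
  exact h2

theorem continuous_of_holderNorm {α : ℝ} (hα : 0 < α) {g : ℝ × ℝ → ℝ} (hg : holderNorm α g ≠ ⊤) :
    Continuous g := by
  refine continuous_iff_continuousAt.2 fun x => ?_
  have h1 : Tendsto (fun y => (holderNorm α g).toReal * aniDist y x ^ α +
      |holderSlope α g x * (y.1 - x.1)|) (𝓝 x) (𝓝 0) := by
    have hc : Continuous (fun y => (holderNorm α g).toReal * aniDist y x ^ α +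
      |holderSlope α g x * (y.1 - x.1)|) :=
      (((continuous_aniDist x).rpow_const fun _ => Or.inr hα.le).const_mul _).add (by fun_prop)
    have := hc.tendsto x
    simpa [aniDist_self, Real.zero_rpow hα.ne'] using this
  rw [ContinuousAt, tendsto_iff_norm_sub_tendsto_zero]
  refine squeeze_zero (fun _ => norm_nonneg _) (fun y => ?_) h1
  have h2 := holder_bound hα hg x y
  rw [Real.norm_eq_abs]
  calc |g y - g x| = |(g y - g x - holderSlope α g x * (y.1 - x.1)) +
        holderSlope α g x * (y.1 - x.1)| := by ring_nf
    _ ≤ _ := (abs_add_le _ _).trans (by gcongr)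

/-! ### Moments of kernels -/

/-- For `α ≤ 3/2` one has `d(w,0)^α ≤ (1 + |w₁|)^{3/2} (1 + |w₂|)`. Against cubic decay in each
variable the powers `-3/2` and `-2` remain, and both are integrable. -/
theorem integrable_moment_weight {α : ℝ} (hα0 : 0 ≤ α) (hα : α ≤ 3 / 2) :
    Integrable fun w => aniDist w 0 ^ α * weight w := by
  have e1 := integrable_one_add_norm (E := ℝ) (μ := volume) (r := 3 / 2) (by norm_num)
  have e2 := integrable_one_add_norm (E := ℝ) (μ := volume) (r := 2) (by norm_num)
  refine (e1.mul_prod e2).mono' ?_ (ae_of_all _ fun w => ?_)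
  · exact (((continuous_aniDist 0).rpow_const fun _ => Or.inr hα0).mul
      continuous_weight).aestronglyMeasurable
  have hw := weight_pos w
  have hd := aniDist_nonneg w 0
  rw [Real.norm_of_nonneg (by positivity)]
  simp only [Real.norm_eq_abs]
  set a := 1 + |w.1| with ha
  set b := 1 + |w.2| with hb
  have ha1 : 1 ≤ a := by simp [ha]
  have hb1 : 1 ≤ b := by simp [hb]
  have h1 : aniDist w 0 ≤ a * b ^ (2 / 3 : ℝ) := by
    have h3 : |w.2| ^ (2 / 3 : ℝ) ≤ b ^ (2 / 3 : ℝ) :=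
      Real.rpow_le_rpow (abs_nonneg _) (by simp [hb]) (by norm_num)
    have h4 : 1 ≤ b ^ (2 / 3 : ℝ) := Real.one_le_rpow hb1 (by norm_num)
    have : aniDist w 0 = (a - 1) + |w.2| ^ (2 / 3 : ℝ) := by simp [aniDist, ha]
    rw [this]; nlinarith
  have h2 : aniDist w 0 ^ α ≤ a ^ (3 / 2 : ℝ) * b := by
    calc aniDist w 0 ^ α ≤ (a * b ^ (2 / 3 : ℝ)) ^ α := Real.rpow_le_rpow hd h1 hα0
      _ ≤ (a * b ^ (2 / 3 : ℝ)) ^ (3 / 2 : ℝ) :=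
        Real.rpow_le_rpow_of_exponent_le
          (one_le_mul_of_one_le_of_one_le ha1 (Real.one_le_rpow hb1 (by norm_num))) hα
      _ = a ^ (3 / 2 : ℝ) * b := by
        rw [Real.mul_rpow (by positivity) (by positivity), ← Real.rpow_mul (by positivity)]
        norm_num
  have ea : a ^ (3 / 2 : ℝ) * (a ^ 3)⁻¹ = a ^ (-(3 / 2) : ℝ) := by
    rw [← Real.rpow_natCast, ← Real.rpow_neg (by positivity), ← Real.rpow_add (by positivity)]
    norm_num
  have eb : b * (b ^ 3)⁻¹ = b ^ (-2 : ℝ) := by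
    rw [Real.rpow_neg (by positivity), show (2 : ℝ) = ((2 : ℕ) : ℝ) by norm_num, Real.rpow_natCast]
    field_simp
  calc aniDist w 0 ^ α * weight w ≤ a ^ (3 / 2 : ℝ) * b * weight w := by gcongr
    _ = (a ^ (3 / 2 : ℝ) * (a ^ 3)⁻¹) * (b * (b ^ 3)⁻¹) := by
      simp only [weight, ← ha, ← hb, mul_inv]; ring
    _ = _ := by rw [ea, eb]

theorem RapidKernel.integrable {κ : ℝ × ℝ → ℝ} (hκ : RapidKernel κ) : Integrable κ := by
  obtain ⟨C, -, hC⟩ := hκ.norm_le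
  exact integrable_of_weight_bound hκ.continuous hC

theorem RapidKernel.integrable_moment {κ : ℝ × ℝ → ℝ} (hκ : RapidKernel κ) {α : ℝ} (hα0 : 0 ≤ α)
    (hα : α ≤ 3 / 2) : Integrable fun w => aniDist w 0 ^ α * |κ w| := by
  obtain ⟨C, -, hC⟩ := hκ.norm_le
  refine ((integrable_moment_weight hα0 hα).const_mul C).mono' ?_ (ae_of_all _ fun w => ?_)
  · exact (((continuous_aniDist 0).rpow_const fun _ => Or.inr hα0).mul
      hκ.continuous.abs).aestronglyMeasurable
  · have := Real.rpow_nonneg (aniDist_nonneg w 0) α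
    rw [Real.norm_of_nonneg (by positivity)]
    have h := mul_le_mul_of_nonneg_left (hC w) this
    rw [Real.norm_eq_abs] at h
    linarith

theorem RapidKernel.integrable_fst_mul {κ : ℝ × ℝ → ℝ} (hκ : RapidKernel κ) :
    Integrable fun w => w.1 * κ w := by
  refine (hκ.integrable_moment zero_le_one (by norm_num)).mono'
    (continuous_fst.mul hκ.continuous).aestronglyMeasurable (ae_of_all _ fun w => ?_)
  rw [Real.rpow_one, norm_mul, Real.norm_eq_abs, Real.norm_eq_abs]
  gcongr
  simp only [aniDist, Prod.fst_zero, Prod.snd_zero, sub_zero]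
  have := Real.rpow_nonneg (abs_nonneg w.2) (2 / 3)
  linarith

theorem RapidKernel.integrable_slice₁ {κ : ℝ × ℝ → ℝ} (hκ : RapidKernel κ) (t : ℝ) :
    Integrable fun s => κ (s, t) := by
  obtain ⟨C, hC0, hC⟩ := hκ.norm_le
  refine (integrable_one_add_abs.const_mul C).mono'
    (hκ.continuous.comp (by fun_prop)).aestronglyMeasurable (ae_of_all _ fun s => ?_)
  refine (hC _).trans (mul_le_mul_of_nonneg_left ?_ hC0)
  rw [weight, mul_inv]
  exact mul_le_of_le_one_right (by positivity) (inv_le_one_of_one_le₀ (one_le_pow₀ (by simp)))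

theorem RapidKernel.integrable_slice₂ {κ : ℝ × ℝ → ℝ} (hκ : RapidKernel κ) (s : ℝ) :
    Integrable fun t => κ (s, t) := by
  obtain ⟨C, hC0, hC⟩ := hκ.norm_le
  refine (integrable_one_add_abs.const_mul C).mono'
    (hκ.continuous.comp (by fun_prop)).aestronglyMeasurable (ae_of_all _ fun t => ?_)
  refine (hC _).trans (mul_le_mul_of_nonneg_left ?_ hC0)
  rw [weight, mul_inv]
  exact mul_le_of_le_one_left (by positivity) (inv_le_one_of_one_le₀ (one_le_pow₀ (by simp)))

theorem RapidKernel.differentiable {κ : ℝ × ℝ → ℝ} (hκ : RapidKernel κ) : Differentiable ℝ κ :=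
  hκ.contDiff.differentiable (by simp)

theorem RapidKernel.integral_partial₁ {κ : ℝ × ℝ → ℝ} (hκ : RapidKernel κ) :
    ∫ w, AnisotropicHolder.partial₁ κ w = 0 := by
  rw [Measure.volume_eq_prod, integral_prod_symm _ (by
    rw [← Measure.volume_eq_prod]; exact hκ.partial₁.integrable)]
  have : ∀ t : ℝ, ∫ s, AnisotropicHolder.partial₁ κ (s, t) = 0 := fun t =>
    integral_eq_zero_of_hasDerivAt_of_integrable
      (fun s => hasDerivAt_partial₁ (x := (s, t)) (hκ.differentiable _))
      (hκ.partial₁.integrable_slice₁ t) (hκ.integrable_slice₁ t)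
  simp [this]

theorem RapidKernel.integral_slice_partial₂ {κ : ℝ × ℝ → ℝ} (hκ : RapidKernel κ) (s : ℝ) :
    ∫ t, AnisotropicHolder.partial₂ κ (s, t) = 0 :=
  integral_eq_zero_of_hasDerivAt_of_integrable
    (fun t => hasDerivAt_partial₂ (x := (s, t)) (hκ.differentiable _))
    (hκ.partial₂.integrable_slice₂ s) (hκ.integrable_slice₂ s)

theorem RapidKernel.integral_partial₂ {κ : ℝ × ℝ → ℝ} (hκ : RapidKernel κ) :
    ∫ w, AnisotropicHolder.partial₂ κ w = 0 := by
  rw [Measure.volume_eq_prod, integral_prod _ (by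
    rw [← Measure.volume_eq_prod]; exact hκ.partial₂.integrable)]
  simp [hκ.integral_slice_partial₂]

/-- Along lines in direction `x₂` the factor `x₁` is constant, so the inner integral vanishes. This
permits subtracting the linear Taylor term of `h`, whose exponent `β + 3/2` may exceed one. -/
theorem RapidKernel.integral_fst_mul_partial₂ {κ : ℝ × ℝ → ℝ} (hκ : RapidKernel κ) :
    ∫ w, w.1 * AnisotropicHolder.partial₂ κ w = 0 := by
  rw [Measure.volume_eq_prod, integral_prod _ (by
    rw [← Measure.volume_eq_prod]; exact hκ.partial₂.integrable_fst_mul)]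
  simp [integral_const_mul, hκ.integral_slice_partial₂]

/-! ### Rescaled kernels -/

/-- The reflected and rescaled kernel `y ↦ φ_ℓ(x - y)`. -/
noncomputable def reflected (φ : ℝ × ℝ → ℝ) (l : ℝ) (x y : ℝ × ℝ) : ℝ :=
  rescale φ l (x.1 - y.1, x.2 - y.2)

theorem one_add_abs_le {a : ℝ} (ha : 0 < a) (s t : ℝ) :
    1 + |t| ≤ (1 + a) * (1 + |s|) * (1 + |(s - t) / a|) := by
  have h1 : |t| ≤ |s| + a * |(s - t) / a| := by
    rw [abs_div, abs_of_pos ha, mul_div_cancel₀ _ ha.ne']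
    have := abs_sub_abs_le_abs_sub t s
    rw [abs_sub_comm] at this; linarith
  have h2 := abs_nonneg s
  have h3 := abs_nonneg ((s - t) / a)
  nlinarith [mul_nonneg h2 h3, mul_nonneg ha.le h2, mul_nonneg (mul_nonneg ha.le h2) h3]

theorem weight_affine_le {a b : ℝ} (ha : 0 < a) (hb : 0 < b) (x y : ℝ × ℝ) :
    weight ((x.1 - y.1) / a, (x.2 - y.2) / b) ≤
      ((1 + a) * (1 + |x.1|)) ^ 3 * ((1 + b) * (1 + |x.2|)) ^ 3 * weight y := by
  have key : ∀ {c s t : ℝ}, 0 < c →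
      ((1 + |(s - t) / c|) ^ 3)⁻¹ ≤ ((1 + c) * (1 + |s|)) ^ 3 * ((1 + |t|) ^ 3)⁻¹ := by
    intro c s t hc
    rw [inv_le_comm₀ (by positivity) (by positivity), mul_inv, inv_inv, ← div_eq_inv_mul,
      div_le_iff₀' (by positivity), ← mul_pow]
    exact pow_le_pow_left₀ (by positivity) (one_add_abs_le hc s t) 3
  simp only [weight, mul_inv]
  rw [mul_mul_mul_comm]
  exact mul_le_mul (key ha) (key hb) (by positivity) (by positivity)

theorem RapidKernel.affine {φ : ℝ × ℝ → ℝ} (hφ : RapidKernel φ) {a b : ℝ} (ha : 0 < a)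
    (hb : 0 < b) (c : ℝ) (x : ℝ × ℝ) :
    RapidKernel fun y => c * φ ((x.1 - y.1) / a, (x.2 - y.2) / b) := by
  set L : ℝ × ℝ →L[ℝ] ℝ × ℝ :=
    ((-a⁻¹) • ContinuousLinearMap.fst ℝ ℝ ℝ).prod ((-b⁻¹) • ContinuousLinearMap.snd ℝ ℝ ℝ) with hL
  set v : ℝ × ℝ := (x.1 / a, x.2 / b) with hv
  have e : (fun y => c * φ ((x.1 - y.1) / a, (x.2 - y.2) / b)) =
      c • ((fun w => φ (w + v)) ∘ L) := by
    funext y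
    simp only [Pi.smul_apply, Function.comp_apply, smul_eq_mul, hL, hv]
    congr 2
    refine Prod.ext ?_ ?_ <;> simp <;> ring
  have hφv : ContDiff ℝ ∞ (fun w => φ (w + v)) := hφ.contDiff.comp (contDiff_id.add contDiff_const)
  have hcomp : ContDiff ℝ ∞ ((fun w => φ (w + v)) ∘ L) := hφv.comp L.contDiff
  rw [e]
  refine ⟨contDiff_const.smul hcomp, fun n => ?_⟩
  obtain ⟨C, hC⟩ := hφ.bound n
  have hC0 : 0 ≤ C := nonneg_of_mul_nonneg_left ((norm_nonneg _).trans (hC 0)) (weight_pos 0)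
  refine ⟨|c| * (C * (((1 + a) * (1 + |x.1|)) ^ 3 * ((1 + b) * (1 + |x.2|)) ^ 3) * ‖L‖ ^ n),
    fun y => ?_⟩
  rw [iteratedFDeriv_const_smul_apply ((hcomp.of_le (by exact_mod_cast le_top)).contDiffAt),
    norm_smul, Real.norm_eq_abs,
    L.iteratedFDeriv_comp_right hφv y (i := n) (by exact_mod_cast le_top), iteratedFDeriv_comp_add_right]
  rw [mul_assoc]
  refine mul_le_mul_of_nonneg_left ?_ (abs_nonneg c)
  refine (ContinuousMultilinearMap.norm_compContinuousLinearMap_le _ _).trans ?_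
  rw [Finset.prod_const, Finset.card_univ, Fintype.card_fin, mul_right_comm]
  refine mul_le_mul_of_nonneg_right ?_ (by positivity)
  have e2 : L y + v = ((x.1 - y.1) / a, (x.2 - y.2) / b) := by
    refine Prod.ext ?_ ?_ <;> simp [hL, hv] <;> ring
  rw [e2, mul_assoc]
  exact (hC _).trans (mul_le_mul_of_nonneg_left (weight_affine_le ha hb x y) hC0)

theorem RapidKernel.reflected {φ : ℝ × ℝ → ℝ} (hφ : RapidKernel φ) {l : ℝ} (hl : 0 < l)
    (x : ℝ × ℝ) : RapidKernel (reflected φ l x) :=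
  hφ.affine hl (Real.rpow_pos_of_pos hl _) _ x

theorem RapidKernel.partial₁_reflected {φ : ℝ × ℝ → ℝ} (hφ : RapidKernel φ) {l : ℝ}
    (x y : ℝ × ℝ) : AnisotropicHolder.partial₁ (AnisotropicHolder.reflected φ l x) y =
      -l⁻¹ * AnisotropicHolder.reflected (AnisotropicHolder.partial₁ φ) l x y := by
  have h1 := hasDerivAt_partial₁ (x := ((x.1 - y.1) / l, (x.2 - y.2) / l ^ (3 / 2 : ℝ)))
    (hφ.differentiable _)
  have h2 : HasDerivAt (fun s : ℝ => (x.1 - s) / l) (-1 / l) y.1 :=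
    ((hasDerivAt_id y.1).const_sub x.1).div_const l
  have h3 := (h1.comp y.1 h2).const_mul ((l ^ (5 / 2 : ℝ))⁻¹)
  refine (h3.deriv).trans ?_
  simp only [AnisotropicHolder.reflected, rescale]
  ring

theorem RapidKernel.partial₂_reflected {φ : ℝ × ℝ → ℝ} (hφ : RapidKernel φ) {l : ℝ}
    (x y : ℝ × ℝ) : AnisotropicHolder.partial₂ (AnisotropicHolder.reflected φ l x) y =
      -(l ^ (3 / 2 : ℝ))⁻¹ * AnisotropicHolder.reflected (AnisotropicHolder.partial₂ φ) l x y := by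
  have h1 := hasDerivAt_partial₂ (x := ((x.1 - y.1) / l, (x.2 - y.2) / l ^ (3 / 2 : ℝ)))
    (hφ.differentiable _)
  have h2 : HasDerivAt (fun s : ℝ => (x.2 - s) / l ^ (3 / 2 : ℝ)) (-1 / l ^ (3 / 2 : ℝ)) y.2 :=
    ((hasDerivAt_id y.2).const_sub x.2).div_const _
  have h3 := (h1.comp y.2 h2).const_mul ((l ^ (5 / 2 : ℝ))⁻¹)
  refine (h3.deriv).trans ?_
  simp only [AnisotropicHolder.reflected, rescale]
  ring

theorem integral_comp_scale (F : ℝ × ℝ → ℝ) {a b : ℝ} (ha : 0 < a) (hb : 0 < b) :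
    ∫ w : ℝ × ℝ, F (a * w.1, b * w.2) = (a * b)⁻¹ * ∫ w, F w := by
  let e : ℝ × ℝ ≃ₜ ℝ × ℝ :=
    (Homeomorph.mulLeft₀ a ha.ne').prodCongr (Homeomorph.mulLeft₀ b hb.ne')
  have h1 : Measure.map e volume = ENNReal.ofReal (a * b)⁻¹ • volume := by
    have : (e : ℝ × ℝ → ℝ × ℝ) = Prod.map (a * ·) (b * ·) := rfl
    rw [this, Measure.volume_eq_prod, ← Measure.map_prod_map _ _ (by fun_prop) (by fun_prop),
      Real.map_volume_mul_left ha.ne', Real.map_volume_mul_left hb.ne', Measure.prod_smul_left,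
      Measure.prod_smul_right, smul_smul, ← ENNReal.ofReal_mul (abs_nonneg _), ← abs_mul, ← mul_inv,
      abs_of_pos (by positivity)]
  have h2 := e.measurableEmbedding.integral_map (μ := volume) F
  rw [h1, integral_smul_measure, ENNReal.toReal_ofReal (by positivity)] at h2
  exact h2.symm

theorem integral_comp_affine (F : ℝ × ℝ → ℝ) {a b : ℝ} (ha : 0 < a) (hb : 0 < b) (x : ℝ × ℝ) :
    ∫ w, F w = a * b * ∫ w : ℝ × ℝ, F (x.1 - a * w.1, x.2 - b * w.2) := by
  have h := integral_comp_scale (fun y => F (x.1 - y.1, x.2 - y.2)) ha hb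
  have h2 : ∫ y : ℝ × ℝ, F (x.1 - y.1, x.2 - y.2) = ∫ w, F w := integral_sub_left_eq_self F volume x
  simp only at h
  rw [h, h2, mul_inv_cancel_left₀ (by positivity)]

/-- Substitution `y = x - (ℓ w₁, ℓ^{3/2} w₂)`; the Jacobian `ℓ^{5/2}` cancels the normalization of
the rescaled kernel. -/
theorem integral_mul_reflected (g κ : ℝ × ℝ → ℝ) {l : ℝ} (hl : 0 < l) (x : ℝ × ℝ) :
    ∫ y, g y * reflected κ l x y =
      ∫ w : ℝ × ℝ, g (x.1 - l * w.1, x.2 - l ^ (3 / 2 : ℝ) * w.2) * κ w := by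
  have hl' : 0 < l ^ (3 / 2 : ℝ) := Real.rpow_pos_of_pos hl _
  rw [integral_comp_affine _ hl hl' x, ← integral_const_mul]
  refine integral_congr_ae (ae_of_all _ fun w => ?_)
  have e : l * l ^ (3 / 2 : ℝ) = l ^ (5 / 2 : ℝ) := by
    nth_rewrite 1 [← Real.rpow_one l]
    rw [← Real.rpow_add hl]; norm_num
  have hl'' : 0 < l ^ (5 / 2 : ℝ) := Real.rpow_pos_of_pos hl _
  simp only [reflected, rescale, e, sub_sub_cancel]
  rw [mul_div_cancel_left₀ _ hl.ne', mul_div_cancel_left₀ _ hl'.ne']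
  field_simp

theorem aniDist_scale {l : ℝ} (hl : 0 < l) (x w : ℝ × ℝ) :
    aniDist (x.1 - l * w.1, x.2 - l ^ (3 / 2 : ℝ) * w.2) x = l * aniDist w 0 := by
  have h : 0 < l ^ (3 / 2 : ℝ) := Real.rpow_pos_of_pos hl _
  simp only [aniDist, Prod.fst_zero, Prod.snd_zero, sub_zero, sub_sub_cancel_left, abs_neg, abs_mul,
    abs_of_pos hl, abs_of_pos h]
  rw [Real.mul_rpow h.le (abs_nonneg _), ← Real.rpow_mul hl.le]
  norm_num
  ring

/-- The kernel annihilates constants, and either `p = 0` or it annihilates `w₁`; hence the affine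
function `g(x) + p(y₁ - x₁)` can be subtracted for free. What is left is bounded by `K d^α`, and the
homogeneity of `d` extracts `ℓ^α`. -/
theorem abs_integral_mul_reflected_le {g : ℝ × ℝ → ℝ} (hg : IsPeriodic g) (hgc : Continuous g)
    {κ : ℝ × ℝ → ℝ} (hκ : RapidKernel κ) (hκ0 : ∫ w, κ w = 0) {α K p : ℝ} (hα0 : 0 ≤ α)
    (hα : α ≤ 3 / 2) {x : ℝ × ℝ} (hp : p * ∫ w, w.1 * κ w = 0)
    (hK : ∀ y : ℝ × ℝ, |g y - g x - p * (y.1 - x.1)| ≤ K * aniDist y x ^ α) {l : ℝ} (hl : 0 < l) :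
    |∫ y, g y * reflected κ l x y| ≤ K * l ^ α * ∫ w, aniDist w 0 ^ α * |κ w| := by
  rw [integral_mul_reflected g κ hl x]
  obtain ⟨B, hB0, hB⟩ := hg.exists_bound hgc
  set S : ℝ × ℝ → ℝ × ℝ := fun w => (x.1 - l * w.1, x.2 - l ^ (3 / 2 : ℝ) * w.2) with hS
  have i1 : Integrable fun w => g (S w) * κ w :=
    hκ.integrable.bdd_mul (c := B) (Continuous.aestronglyMeasurable (by fun_prop))
      (ae_of_all _ fun w => hB _)
  have i2 : Integrable fun w => g x * κ w := hκ.integrable.const_mul _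
  have i3 : Integrable fun w => p * l * (w.1 * κ w) := hκ.integrable_fst_mul.const_mul _
  have e : ∫ w, g (S w) * κ w = ∫ w, (g (S w) - g x - p * ((S w).1 - x.1)) * κ w := by
    have : (fun w => (g (S w) - g x - p * ((S w).1 - x.1)) * κ w) =
        fun w => (g (S w) * κ w - g x * κ w) + p * l * (w.1 * κ w) := by
      funext w; simp only [hS]; ring
    rw [this, integral_add (f := fun w => g (S w) * κ w - g x * κ w) (i1.sub i2) i3, integral_sub i1 i2, integral_const_mul,
      integral_const_mul, hκ0, mul_right_comm, hp]
    ring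
  change |∫ w, g (S w) * κ w| ≤ _
  rw [e, ← integral_const_mul, ← Real.norm_eq_abs]
  refine norm_integral_le_of_norm_le ((hκ.integrable_moment hα0 hα).const_mul _)
    (ae_of_all _ fun w => ?_)
  rw [norm_mul, Real.norm_eq_abs, Real.norm_eq_abs]
  refine (mul_le_mul_of_nonneg_right (hK (S w)) (abs_nonneg _)).trans (le_of_eq ?_)
  rw [hS, aniDist_scale hl, Real.mul_rpow hl.le (aniDist_nonneg _ _)]
  ring

end AnisotropicHolder

namespace AnisotropicHolder

open MeasureTheory Filter Topology
open scoped ContDiff ENNReal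

/-! ### The mask bound -/

theorem integral_cell_mul_periodize_of_rapid {g κ : ℝ × ℝ → ℝ} (hg : IsPeriodic g)
    (hgc : Continuous g) (hκ : RapidKernel κ) :
    ∫ x in cell, g x * periodize κ x = ∫ x, g x * κ x := by
  obtain ⟨C, hC0, hC⟩ := hκ.norm_le
  exact integral_cell_mul_periodize hg hgc hκ.continuous hC0 hC

theorem integral_cell_const_mul_periodize_reflected {φ : ℝ × ℝ → ℝ} (hφ : RapidKernel φ) {l : ℝ}
    (hl : 0 < l) (x : ℝ × ℝ) (c : ℝ) :
    ∫ y in cell, c * periodize (reflected φ l x) y = c * ∫ w, φ w := by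
  rw [integral_cell_mul_periodize_of_rapid (g := fun _ => c) (fun _ => ⟨rfl, rfl⟩) continuous_const
    (hφ.reflected hl x), integral_mul_reflected (fun _ => c) φ hl x, integral_const_mul]

theorem integral_cell_mul_partial₁ {φ g : ℝ × ℝ → ℝ} (hφ : RapidKernel φ) (hg : IsPeriodic g)
    (hgc : Continuous g) {l : ℝ} (hl : 0 < l) (x : ℝ × ℝ) :
    ∫ y in cell, g y * partial₁ (periodize (reflected φ l x)) y =
      -l⁻¹ * ∫ y, g y * reflected (partial₁ φ) l x y := by
  rw [(hφ.reflected hl x).partial₁_periodize, integral_cell_mul_periodize_of_rapid hg hgc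
    (hφ.reflected hl x).partial₁, ← integral_const_mul]
  refine integral_congr_ae (ae_of_all _ fun y => ?_)
  simp only [hφ.partial₁_reflected]; ring

theorem integral_cell_mul_partial₂ {φ g : ℝ × ℝ → ℝ} (hφ : RapidKernel φ) (hg : IsPeriodic g)
    (hgc : Continuous g) {l : ℝ} (hl : 0 < l) (x : ℝ × ℝ) :
    ∫ y in cell, g y * partial₂ (periodize (reflected φ l x)) y =
      -(l ^ (3 / 2 : ℝ))⁻¹ * ∫ y, g y * reflected (partial₂ φ) l x y := by
  rw [(hφ.reflected hl x).partial₂_periodize, integral_cell_mul_periodize_of_rapid hg hgc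
    (hφ.reflected hl x).partial₂, ← integral_const_mul]
  refine integral_congr_ae (ae_of_all _ fun y => ?_)
  simp only [hφ.partial₂_reflected]; ring

theorem integral_cell_mul_partial₁_partial₁ {φ g : ℝ × ℝ → ℝ} (hφ : RapidKernel φ)
    (hg : IsPeriodic g) (hgc : Continuous g) {l : ℝ} (hl : 0 < l) (x : ℝ × ℝ) :
    ∫ y in cell, g y * partial₁ (partial₁ (periodize (reflected φ l x))) y =
      (l⁻¹) ^ 2 * ∫ y, g y * reflected (partial₁ (partial₁ φ)) l x y := by
  have hR := hφ.reflected hl x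
  have e : partial₁ (partial₁ (reflected φ l x)) = fun y =>
      (l⁻¹) ^ 2 * reflected (partial₁ (partial₁ φ)) l x y := by
    have e1 : partial₁ (reflected φ l x) = fun y => -l⁻¹ * reflected (partial₁ φ) l x y :=
      funext fun y => hφ.partial₁_reflected x y
    funext y
    rw [e1]
    have h := (hasDerivAt_partial₁ (x := y) ((hφ.partial₁.reflected hl x).differentiable y)).const_mul
      (-l⁻¹)
    refine h.deriv.trans ?_
    rw [hφ.partial₁.partial₁_reflected]; ring
  rw [hR.partial₁_periodize, hR.partial₁.partial₁_periodize, integral_cell_mul_periodize_of_rapid hg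
    hgc hR.partial₁.partial₁, ← integral_const_mul, e]
  refine integral_congr_ae (ae_of_all _ fun y => ?_)
  simp only; ring

theorem conv_eq (f : PeriodicDistribution) {φ : ℝ × ℝ → ℝ} (hφ : RapidKernel φ) {l : ℝ}
    (hl : 0 < l) (x : ℝ × ℝ) : conv (rescale φ l) f x =
      f (TorusTest.mk (periodize (reflected φ l x)) (hφ.reflected hl x).periodize_mem) :=
  evalAt_of_mem f (hφ.reflected hl x).periodize_mem

theorem holderSlope_of_le {α : ℝ} (hα : α ≤ 1) (g : ℝ × ℝ → ℝ) (x : ℝ × ℝ) :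
    holderSlope α g x = 0 := if_pos hα

theorem abs_integral_mul_reflected_le_of_holder {g : ℝ × ℝ → ℝ} (hg : IsPeriodic g) {α : ℝ}
    (hα0 : 0 < α) (hα : α ≤ 3 / 2) (hgα : holderNorm α g ≠ ⊤) {κ : ℝ × ℝ → ℝ}
    (hκ : RapidKernel κ) (hκ0 : ∫ w, κ w = 0) (hκ1 : α ≤ 1 ∨ ∫ w, w.1 * κ w = 0) {l : ℝ}
    (hl : 0 < l) (x : ℝ × ℝ) :
    |∫ y, g y * reflected κ l x y| ≤
      (holderNorm α g).toReal * l ^ α * ∫ w, aniDist w 0 ^ α * |κ w| := by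
  refine abs_integral_mul_reflected_le (p := holderSlope α g x) hg (continuous_of_holderNorm hα0 hgα)
    hκ hκ0 hα0.le hα ?_ (fun y => holder_bound hα0 hgα x y) hl
  rcases hκ1 with h | h
  · rw [holderSlope_of_le h, zero_mul]
  · rw [h, mul_zero]

/-! ### Integration by parts on the torus and the constant in a decomposition -/

theorem setIntegral_cell {F : ℝ × ℝ → ℝ} (hF : Continuous F) :
    ∫ x in cell, F x = ∫ s in (0 : ℝ)..1, ∫ t in (0 : ℝ)..1, F (s, t) := by
  have h := integrableOn_cell hF
  rw [cell, Measure.volume_eq_prod] at h ⊢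
  rw [setIntegral_prod _ h]
  simp only [integral_Ico_eq_integral_Ioc, intervalIntegral.integral_of_le zero_le_one]

theorem setIntegral_cell_swap {F : ℝ × ℝ → ℝ} (hF : Continuous F) :
    ∫ x in cell, F x = ∫ t in (0 : ℝ)..1, ∫ s in (0 : ℝ)..1, F (s, t) := by
  have h := setIntegral_cell (F := fun x => F x.swap) (by fun_prop)
  simp only [Prod.swap_prod_mk] at h
  rw [← h, cell, Measure.volume_eq_prod, ← setIntegral_prod_swap]

theorem integral_cell_D₁ (u : TorusTest) : ∫ x in cell, partial₁ u.toFun x = 0 := by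
  have hc : Continuous (partial₁ u.toFun) := (contDiff_partial₁ u.contDiff).continuous
  rw [setIntegral_cell_swap hc]
  have : ∀ t : ℝ, ∫ s in (0 : ℝ)..1, partial₁ u.toFun (s, t) = 0 := fun t => by
    rw [intervalIntegral.integral_eq_sub_of_hasDerivAt (f := fun s => u.toFun (s, t)) (f' := fun s => partial₁ u.toFun (s, t))
      (fun s _ => hasDerivAt_partial₁ (x := (s, t)) (u.differentiable _))
      ((hc.comp (by fun_prop : Continuous fun s : ℝ => (s, t))).intervalIntegrable _ _)]
    have := (u.isPeriodic (0, t)).1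
    simp only [zero_add] at this
    simp [this]
  simp [this]

theorem integral_cell_D₂ (u : TorusTest) : ∫ x in cell, partial₂ u.toFun x = 0 := by
  have hc : Continuous (partial₂ u.toFun) := (contDiff_partial₂ u.contDiff).continuous
  rw [setIntegral_cell hc]
  have : ∀ s : ℝ, ∫ t in (0 : ℝ)..1, partial₂ u.toFun (s, t) = 0 := fun s => by
    rw [intervalIntegral.integral_eq_sub_of_hasDerivAt (f := fun t => u.toFun (s, t)) (f' := fun t => partial₂ u.toFun (s, t))
      (fun t _ => hasDerivAt_partial₂ (x := (s, t)) (u.differentiable _))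
      ((hc.comp (by fun_prop : Continuous fun t : ℝ => (s, t))).intervalIntegrable _ _)]
    have := (u.isPeriodic (s, 0)).2
    simp only [zero_add] at this
    simp [this]
  simp [this]

/-- The product of two test functions. -/
def TorusTest.mul (u v : TorusTest) : TorusTest :=
  TorusTest.mk (fun x => u x * v x) ⟨u.contDiff.mul v.contDiff, fun x => by
    simp [(u.isPeriodic x).1, (u.isPeriodic x).2, (v.isPeriodic x).1, (v.isPeriodic x).2]⟩

theorem integral_cell_mul_D₁ (u v : TorusTest) :
    ∫ x in cell, u x * (TorusTest.D₁ v) x = -∫ x in cell, (TorusTest.D₁ u) x * v x := by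
  have h := integral_cell_D₁ (u.mul v)
  have e : partial₁ (u.mul v).toFun =
      fun x => (TorusTest.D₁ u) x * v x + u x * (TorusTest.D₁ v) x := funext fun x =>
    ((hasDerivAt_partial₁ (u.differentiable x)).mul (hasDerivAt_partial₁ (v.differentiable x))).deriv
  rw [e, integral_add (integrableOn_cell (by fun_prop)) (integrableOn_cell (by fun_prop))] at h
  linarith

theorem integral_cell_mul_D₂ (u v : TorusTest) :
    ∫ x in cell, u x * (TorusTest.D₂ v) x = -∫ x in cell, (TorusTest.D₂ u) x * v x := by
  have h := integral_cell_D₂ (u.mul v)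
  have e : partial₂ (u.mul v).toFun =
      fun x => (TorusTest.D₂ u) x * v x + u x * (TorusTest.D₂ v) x := funext fun x =>
    ((hasDerivAt_partial₂ (u.differentiable x)).mul (hasDerivAt_partial₂ (v.differentiable x))).deriv
  rw [e, integral_add (integrableOn_cell (by fun_prop)) (integrableOn_cell (by fun_prop))] at h
  linarith

theorem partial₁_one : partial₁ TorusTest.one.toFun = 0 := by
  funext x; exact deriv_const x.1 (1 : ℝ)

theorem partial₂_one : partial₂ TorusTest.one.toFun = 0 := by
  funext x; exact deriv_const x.2 (1 : ℝ)

theorem partial₁_partial₁_one : partial₁ (partial₁ TorusTest.one.toFun) = 0 := by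
  rw [partial₁_one]; funext x; exact deriv_const x.1 (0 : ℝ)

theorem integral_cell_const_mul_one (c : ℝ) : ∫ x in cell, c * TorusTest.one.toFun x = c := by
  have : ∀ x, TorusTest.one.toFun x = 1 := fun _ => rfl
  simp [this, measureReal_def]

/-- Testing with the constant 1 removes both derivative terms. Hence `c` vanishes together with the
average, which is what allows large scales. -/
theorem IsDecomp₁.average_eq {f : PeriodicDistribution} {c : ℝ} {g h : ℝ × ℝ → ℝ}
    (hd : IsDecomp₁ f c g h) : average f = c := by
  rw [average, hd, partial₁_one, partial₂_one, integral_cell_const_mul_one]; simp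

theorem IsDecomp₂.average_eq {f : PeriodicDistribution} {c : ℝ} {g h : ℝ × ℝ → ℝ}
    (hd : IsDecomp₂ f c g h) : average f = c := by
  rw [average, hd, partial₁_partial₁_one, partial₂_one, integral_cell_const_mul_one]; simp

/-- Bookkeeping shared by the two ranges of `β`: the factors `ℓ^{-β}` and `ℓ^β` cancel in the Hölder
terms, while the constant term uses that either `ℓ^{-β} ≤ 1` or `c = 0`. -/
theorem ofReal_rpow_mul_enorm_le {I M₁ M₂ l β r c : ℝ} {G H : ℝ≥0∞} (hG : G ≠ ⊤) (hH : H ≠ ⊤)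
    (hI : 0 ≤ I) (hM₁ : 0 ≤ M₁) (hM₂ : 0 ≤ M₂) (hl : 0 < l) (hβ : β < 0) (hlc : l ≤ 1 ∨ c = 0)
    (hr : |r| ≤ |c| * I + G.toReal * l ^ β * M₁ + H.toReal * l ^ β * M₂) :
    ENNReal.ofReal (l ^ (-β)) * ‖r‖ₑ ≤ (1 + I + M₁ + M₂).toNNReal * (‖c‖ₑ + G + H) := by
  have hl' := Real.rpow_pos_of_pos hl (-β)
  have e : l ^ (-β) * l ^ β = 1 := by rw [← Real.rpow_add hl]; simp
  have hG0 := ENNReal.toReal_nonneg (a := G)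
  have hH0 := ENNReal.toReal_nonneg (a := H)
  have hc : l ^ (-β) * |c| ≤ |c| := by
    rcases hlc with h | h
    · exact mul_le_of_le_one_left (abs_nonneg c) (Real.rpow_le_one hl.le h (by linarith))
    · simp [h]
  have key : l ^ (-β) * |r| ≤ (1 + I + M₁ + M₂) * (|c| + G.toReal + H.toReal) := by
    calc l ^ (-β) * |r| ≤ l ^ (-β) * (|c| * I + G.toReal * l ^ β * M₁ + H.toReal * l ^ β * M₂) := by
          gcongr
      _ = (l ^ (-β) * |c|) * I + (l ^ (-β) * l ^ β) * (G.toReal * M₁ + H.toReal * M₂) := by ring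
      _ ≤ |c| * I + (G.toReal * M₁ + H.toReal * M₂) := by
          rw [e, one_mul]; gcongr
      _ ≤ _ := by
          have h0 := abs_nonneg c
          have : (1 + I + M₁ + M₂) * (|c| + G.toReal + H.toReal) =
            |c| * I + (G.toReal * M₁ + H.toReal * M₂) + (|c| * (1 + M₁ + M₂) +
              G.toReal * (1 + I + M₂) + H.toReal * (1 + I + M₁)) := by ring
          rw [this]
          have : 0 ≤ |c| * (1 + M₁ + M₂) + G.toReal * (1 + I + M₂) + H.toReal * (1 + I + M₁) := by
            positivity
          linarith
  rw [← ofReal_norm, Real.norm_eq_abs, ← ENNReal.ofReal_mul hl'.le]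
  refine (ENNReal.ofReal_le_ofReal key).trans (le_of_eq ?_)
  rw [ENNReal.ofReal_mul (by positivity), ENNReal.ofReal_add (by positivity) hH0,
    ENNReal.ofReal_add (by positivity) hG0, ENNReal.ofReal_toReal hG, ENNReal.ofReal_toReal hH,
    ← Real.norm_eq_abs, ofReal_norm]
  rfl

theorem ne_top_of_sum_ne_top {a b c : ℝ≥0∞} (h : a + b + c ≠ ⊤) : b ≠ ⊤ ∧ c ≠ ⊤ := by
  simp only [ne_eq, ENNReal.add_eq_top, not_or] at h
  exact ⟨h.1.2, h.2⟩

theorem rpow_mul_inv_cancel {l : ℝ} (hl : 0 < l) {a b β : ℝ} (h : a - b = β) :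
    l ^ a * (l ^ b)⁻¹ = l ^ β := by
  rw [← Real.rpow_neg hl.le, ← Real.rpow_add hl, ← h, sub_eq_add_neg]

/-- Powers of `ℓ`: `-3/2 + (β + 3/2)` for `h`, and `-1 + (β + 1)` or `-2 + (β + 2)` for `g`. The
exponent of `g` is at most one in its range of `β`, so for `g` the vanishing mean of the
differentiated kernel is enough. -/
theorem exists_mask_bound {φ : ℝ × ℝ → ℝ} (hφ : RapidKernel φ) {β : ℝ}
    (hβ : β ∈ Set.Ioo (-3 / 2 : ℝ) 0) :
    ∃ C : NNReal, ∀ (f : PeriodicDistribution) (l : ℝ) (x : ℝ × ℝ), 0 < l →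
      (l ≤ 1 ∨ average f = 0) →
      ENNReal.ofReal (l ^ (-β)) * ‖conv (rescale φ l) f x‖ₑ ≤ C * negHolderNorm β f := by
  obtain ⟨hβ1, hβ2⟩ := hβ
  have hM : ∀ (α : ℝ) (κ : ℝ × ℝ → ℝ), 0 ≤ ∫ w, aniDist w 0 ^ α * |κ w| := fun α κ =>
    integral_nonneg fun w => mul_nonneg (Real.rpow_nonneg (aniDist_nonneg _ _) _) (abs_nonneg _)
  have hh : ∀ {h : ℝ × ℝ → ℝ} (_ : IsPeriodic h) (_ : holderNorm (β + 3 / 2) h ≠ ⊤) {l : ℝ}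
      (_ : 0 < l) (x : ℝ × ℝ), |(l ^ (3 / 2 : ℝ))⁻¹ * ∫ y, h y * reflected (partial₂ φ) l x y| ≤
      (holderNorm (β + 3 / 2) h).toReal * l ^ β *
        ∫ w, aniDist w 0 ^ (β + 3 / 2) * |partial₂ φ w| := by
    intro h hp hf l hl x
    have hl' := Real.rpow_pos_of_pos hl (3 / 2)
    have := abs_integral_mul_reflected_le_of_holder hp (by linarith) (by linarith) hf hφ.partial₂
      hφ.integral_partial₂ (Or.inr hφ.integral_fst_mul_partial₂) hl x
    rw [abs_mul, abs_of_pos (inv_pos.2 hl')]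
    refine (mul_le_mul_of_nonneg_left this (inv_pos.2 hl').le).trans (le_of_eq ?_)
    rw [← rpow_mul_inv_cancel hl (show β + 3 / 2 - 3 / 2 = β by ring)]
    ring
  by_cases hβ' : -1 < β
  · refine ⟨(1 + |∫ w, φ w| + (∫ w, aniDist w 0 ^ (β + 1) * |partial₁ φ w|) +
      ∫ w, aniDist w 0 ^ (β + 3 / 2) * |partial₂ φ w|).toNNReal, fun f l x hl hlc => ?_⟩
    -- Moving the constant to the left lets the infimum be bounded one decomposition at a time. The
    -- summand 1 in the constant makes this division legitimate.
    rw [← ENNReal.div_le_iff' (by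
      simp only [ne_eq, ENNReal.coe_eq_zero, Real.toNNReal_eq_zero, not_le]
      have := abs_nonneg (∫ w, φ w)
      linarith [hM (β + 1) (partial₁ φ), hM (β + 3 / 2) (partial₂ φ)]) ENNReal.coe_ne_top]
    rw [negHolderNorm, if_pos hβ']
    refine le_iInf fun c => le_iInf fun g => le_iInf fun h => le_iInf fun hg => le_iInf fun hp =>
      le_iInf fun hd => ?_
    refine ENNReal.div_le_of_le_mul' ?_
    -- Decompositions of infinite size impose nothing; in the others `g` and `h` are continuous, as
    -- the integral identities require.
    by_cases htop : ‖c‖ₑ + holderNorm (β + 1) g + holderNorm (β + 3 / 2) h = ⊤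
    · rw [htop, ENNReal.mul_top]
      · exact le_top
      · simp only [ne_eq, ENNReal.coe_eq_zero, Real.toNNReal_eq_zero, not_le]
        have := abs_nonneg (∫ w, φ w)
        linarith [hM (β + 1) (partial₁ φ), hM (β + 3 / 2) (partial₂ φ)]
    obtain ⟨hgt, hht⟩ := ne_top_of_sum_ne_top htop
    refine ofReal_rpow_mul_enorm_le hgt hht (abs_nonneg _) (hM _ _) (hM _ _) hl hβ2
      (hlc.imp_right fun h0 => hd.average_eq ▸ h0) ?_
    rw [conv_eq f hφ hl, hd]
    simp only [TorusTest.mk_apply]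
    rw [integral_cell_const_mul_periodize_reflected hφ hl,
      integral_cell_mul_partial₁ hφ hg (continuous_of_holderNorm (by linarith) hgt) hl,
      integral_cell_mul_partial₂ hφ hp (continuous_of_holderNorm (by linarith) hht) hl]
    have h2 := hh hp hht hl x
    have h1 : |l⁻¹ * ∫ y, g y * reflected (partial₁ φ) l x y| ≤
        (holderNorm (β + 1) g).toReal * l ^ β * ∫ w, aniDist w 0 ^ (β + 1) * |partial₁ φ w| := by
      have := abs_integral_mul_reflected_le_of_holder hg (by linarith) (by linarith) hgt
        hφ.partial₁ hφ.integral_partial₁ (Or.inl (by linarith)) hl x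
      rw [abs_mul, abs_of_pos (inv_pos.2 hl)]
      refine (mul_le_mul_of_nonneg_left this (inv_pos.2 hl).le).trans (le_of_eq ?_)
      rw [← rpow_mul_inv_cancel hl (show β + 1 - 1 = β by ring), Real.rpow_one]
      ring
    rw [neg_mul, neg_mul, sub_neg_eq_add, sub_neg_eq_add]
    exact (abs_add_three _ _ _).trans (by rw [abs_mul c]; linarith)
  · refine ⟨(1 + |∫ w, φ w| + (∫ w, aniDist w 0 ^ (β + 2) * |partial₁ (partial₁ φ) w|) +
      ∫ w, aniDist w 0 ^ (β + 3 / 2) * |partial₂ φ w|).toNNReal, fun f l x hl hlc => ?_⟩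
    rw [← ENNReal.div_le_iff' (by
      simp only [ne_eq, ENNReal.coe_eq_zero, Real.toNNReal_eq_zero, not_le]
      have := abs_nonneg (∫ w, φ w)
      linarith [hM (β + 2) (partial₁ (partial₁ φ)), hM (β + 3 / 2) (partial₂ φ)])
      ENNReal.coe_ne_top]
    rw [negHolderNorm, if_neg hβ']
    refine le_iInf fun c => le_iInf fun g => le_iInf fun h => le_iInf fun hg => le_iInf fun hp =>
      le_iInf fun hd => ?_
    refine ENNReal.div_le_of_le_mul' ?_
    by_cases htop : ‖c‖ₑ + holderNorm (β + 2) g + holderNorm (β + 3 / 2) h = ⊤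
    · rw [htop, ENNReal.mul_top]
      · exact le_top
      · simp only [ne_eq, ENNReal.coe_eq_zero, Real.toNNReal_eq_zero, not_le]
        have := abs_nonneg (∫ w, φ w)
        linarith [hM (β + 2) (partial₁ (partial₁ φ)), hM (β + 3 / 2) (partial₂ φ)]
    obtain ⟨hgt, hht⟩ := ne_top_of_sum_ne_top htop
    refine ofReal_rpow_mul_enorm_le hgt hht (abs_nonneg _) (hM _ _) (hM _ _) hl hβ2
      (hlc.imp_right fun h0 => hd.average_eq ▸ h0) ?_
    rw [conv_eq f hφ hl, hd]
    simp only [TorusTest.mk_apply]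
    rw [integral_cell_const_mul_periodize_reflected hφ hl,
      integral_cell_mul_partial₁_partial₁ hφ hg (continuous_of_holderNorm (by linarith) hgt) hl,
      integral_cell_mul_partial₂ hφ hp (continuous_of_holderNorm (by linarith) hht) hl]
    have h2 := hh hp hht hl x
    have h1 : |l⁻¹ ^ 2 * ∫ y, g y * reflected (partial₁ (partial₁ φ)) l x y| ≤
        (holderNorm (β + 2) g).toReal * l ^ β *
          ∫ w, aniDist w 0 ^ (β + 2) * |partial₁ (partial₁ φ) w| := by
      have hl2 : 0 < l⁻¹ ^ 2 := by positivity
      have := abs_integral_mul_reflected_le_of_holder hg (by linarith) (by linarith) hgt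
        hφ.partial₁.partial₁ hφ.partial₁.integral_partial₁ (Or.inl (by linarith)) hl x
      rw [abs_mul, abs_of_pos hl2]
      refine (mul_le_mul_of_nonneg_left this hl2.le).trans (le_of_eq ?_)
      rw [← rpow_mul_inv_cancel hl (show β + 2 - (2 : ℕ) = β by push_cast; ring),
        Real.rpow_natCast]
      ring
    rw [neg_mul, sub_neg_eq_add]
    exact (abs_add_three _ _ _).trans (by rw [abs_mul c]; linarith)

theorem maskSup_le {φ : ℝ × ℝ → ℝ} {β : ℝ} {C : NNReal} {f : PeriodicDistribution} {I : Set ℝ}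
    (h : ∀ l ∈ I, ∀ x, ENNReal.ofReal (l ^ (-β)) * ‖conv (rescale φ l) f x‖ₑ ≤
      C * negHolderNorm β f) : maskSup φ I β f ≤ C * negHolderNorm β f := by
  refine iSup₂_le fun l hl => ?_
  rw [supNorm, ENNReal.mul_iSup]
  exact iSup_le fun x => h l hl x

/-- The weight is a product of two cubes, so decay of order six in the norm suffices. -/
theorem rapidKernel_schwartz (φ : 𝓢(ℝ × ℝ, ℝ)) : RapidKernel φ := by
  refine ⟨φ.smooth ⊤, fun n => ?_⟩
  obtain ⟨C, hC⟩ : ∃ C, ∀ x, (1 + ‖x‖) ^ 6 * ‖iteratedFDeriv ℝ n φ x‖ ≤ C :=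
    ⟨_, fun x => SchwartzMap.one_add_le_sup_seminorm_apply (𝕜 := ℝ) (m := (6, n)) le_rfl le_rfl φ x⟩
  refine ⟨C, fun x => ?_⟩
  rw [weight, ← div_eq_mul_inv, le_div_iff₀ (by positivity), mul_comm]
  refine le_trans (mul_le_mul_of_nonneg_right ?_ (norm_nonneg _)) (hC x)
  calc (1 + |x.1|) ^ 3 * (1 + |x.2|) ^ 3 ≤ (1 + ‖x‖) ^ 3 * (1 + ‖x‖) ^ 3 := by
        gcongr
        · exact norm_fst_le x
        · exact norm_snd_le x
    _ = (1 + ‖x‖) ^ 6 := by ring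

theorem mask_part {β : ℝ} (hβ : β ∈ Set.Ioo (-3 / 2 : ℝ) 0) {φ : ℝ × ℝ → ℝ} (hφ : RapidKernel φ) :
    ∃ C : NNReal,
      (∀ f : PeriodicDistribution, maskSup φ (Set.Ioc 0 1) β f ≤ C * negHolderNorm β f) ∧
      (∀ f : PeriodicDistribution, average f = 0 →
        maskSup φ (Set.Ioi 0) β f ≤ C * negHolderNorm β f) := by
  obtain ⟨C, hC⟩ := exists_mask_bound hφ hβ
  exact ⟨C, fun f => maskSup_le fun l hl x => hC f l x hl.1 (Or.inl hl.2),
    fun f hf => maskSup_le fun l hl x => hC f l x hl (Or.inr hf)⟩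

end AnisotropicHolder

namespace AnisotropicHolder

open MeasureTheory Filter Topology
open scoped ContDiff ENNReal FourierTransform

/-! ### Decay of one-dimensional Fourier transforms -/

/-- Integration by parts on each half-line. The boundary terms at 0 cancel by continuity, those at
infinity vanish by integrability. Differentiability at 0 must not be assumed, since derivatives of
`exp(-T|k|³)` eventually develop a corner there. -/
theorem fourier_of_hasDerivAt_off_zero {F F' : ℝ → ℂ} (hc : Continuous F)
    (hd : ∀ ξ, ξ ≠ 0 → HasDerivAt F (F' ξ) ξ) (hF : Integrable F) (hF' : Integrable F') (s : ℝ) :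
    𝓕 F' s = (2 * Real.pi * Complex.I * s) * 𝓕 F s := by
  set e : ℝ → ℂ := fun ξ => Complex.exp (((-2 * Real.pi * ξ * s : ℝ) : ℂ) * Complex.I) with he
  have hec : Continuous e := by fun_prop
  have hen : ∀ ξ, ‖e ξ‖ = 1 := fun ξ => Complex.norm_exp_ofReal_mul_I _
  have hed : ∀ ξ, HasDerivAt e (e ξ * (-(2 * Real.pi * Complex.I * s))) ξ := fun ξ => by
    have h1 : HasDerivAt (fun ξ : ℝ => -2 * Real.pi * ξ * s) (-2 * Real.pi * s) ξ := by
      simpa using ((hasDerivAt_id ξ).const_mul (-2 * Real.pi)).mul_const s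
    have h2 := (h1.ofReal_comp.mul_const Complex.I).cexp
    convert h2 using 1
    simp only [he]
    push_cast
    ring
  have heF : Integrable fun ξ => e ξ * F ξ := hF.bdd_mul (c := 1) hec.aestronglyMeasurable
    (ae_of_all _ fun ξ => (hen ξ).le)
  have heF' : Integrable fun ξ => e ξ * F' ξ := hF'.bdd_mul (c := 1) hec.aestronglyMeasurable
    (ae_of_all _ fun ξ => (hen ξ).le)
  have hφ : ∀ ξ, ξ ≠ 0 → HasDerivAt (fun ξ => e ξ * F ξ)
      (e ξ * F' ξ - (2 * Real.pi * Complex.I * s) * (e ξ * F ξ)) ξ := fun ξ hξ => by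
    have h := (hed ξ).mul (hd ξ hξ)
    exact h.congr_deriv (by ring)
  have hφi : Integrable fun ξ => e ξ * F' ξ - (2 * Real.pi * Complex.I * s) * (e ξ * F ξ) :=
    heF'.sub (heF.const_mul _)
  have hφc : Continuous fun ξ => e ξ * F ξ := hec.mul hc
  have h1 := integral_Ioi_of_hasDerivAt_of_tendsto (a := 0) hφc.continuousWithinAt
    (fun ξ hξ => hφ ξ (ne_of_gt hξ)) hφi.integrableOn
    (tendsto_zero_of_hasDerivAt_of_integrableOn_Ioi (a := 0) (fun ξ hξ => hφ ξ (ne_of_gt hξ))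
      hφi.integrableOn heF.integrableOn)
  have h2 := integral_Iic_of_hasDerivAt_of_tendsto (a := 0) hφc.continuousWithinAt
    (fun ξ hξ => hφ ξ (ne_of_lt hξ)) hφi.integrableOn
    -- The half-line here is closed, so it has to stop short of the exceptional point 0.
    (tendsto_zero_of_hasDerivAt_of_integrableOn_Iic (a := -1)
      (fun ξ hξ => hφ ξ (ne_of_lt (lt_of_le_of_lt (Set.mem_Iic.1 hξ) (by norm_num))))
      hφi.integrableOn heF.integrableOn)
  have h3 : ∫ ξ, (e ξ * F' ξ - (2 * Real.pi * Complex.I * s) * (e ξ * F ξ)) = 0 := by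
    rw [← intervalIntegral.integral_Iic_add_Ioi (b := 0) hφi.integrableOn hφi.integrableOn, h1, h2]
    ring
  rw [integral_sub heF' (heF.const_mul _), integral_const_mul, sub_eq_zero] at h3
  simp only [Real.fourier_real_eq_integral_exp_smul, smul_eq_mul]
  exact h3

/-- `|s|ᵏ |𝓕 F (s)|` is bounded. -/
def FourierDecay (k : ℕ) (F : ℝ → ℂ) : Prop := ∃ C, ∀ s : ℝ, |s| ^ k * ‖𝓕 F s‖ ≤ C

theorem fourierDecay_zero (F : ℝ → ℂ) : FourierDecay 0 F :=
  ⟨∫ ξ, ‖F ξ‖, fun s => by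
    rw [pow_zero, one_mul]
    exact VectorFourier.norm_fourierIntegral_le_integral_norm _ _ _ _ _⟩

theorem FourierDecay.succ {k : ℕ} {F F' : ℝ → ℂ} (hc : Continuous F)
    (hd : ∀ ξ, ξ ≠ 0 → HasDerivAt F (F' ξ) ξ) (hF : Integrable F) (hF' : Integrable F')
    (h : FourierDecay k F') : FourierDecay (k + 1) F := by
  obtain ⟨C, hC⟩ := h
  refine ⟨C, fun s => ?_⟩
  have h1 := hC s
  rw [fourier_of_hasDerivAt_off_zero hc hd hF hF' s, norm_mul] at h1
  have h2 : ‖(2 * Real.pi * Complex.I * s : ℂ)‖ = 2 * Real.pi * |s| := by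
    simp [abs_of_pos Real.pi_pos]
  rw [h2] at h1
  have h3 : 0 ≤ |s| ^ k * (|s| * ‖𝓕 F s‖) := by positivity
  have h4 : |s| ^ k * (2 * Real.pi * |s| * ‖𝓕 F s‖) =
    2 * Real.pi * (|s| ^ k * (|s| * ‖𝓕 F s‖)) := by ring
  rw [h4] at h1
  have h5 : 1 ≤ 2 * Real.pi := by linarith [Real.pi_gt_three]
  calc |s| ^ (k + 1) * ‖𝓕 F s‖ = 1 * (|s| ^ k * (|s| * ‖𝓕 F s‖)) := by ring
    _ ≤ 2 * Real.pi * (|s| ^ k * (|s| * ‖𝓕 F s‖)) := by gcongr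
    _ ≤ C := h1

theorem FourierDecay.linear {k : ℕ} {F G : ℝ → ℂ} (hF : FourierDecay k F) (hG : FourierDecay k G)
    (hFi : Integrable F) (hGi : Integrable G) (a b : ℂ) :
    FourierDecay k (fun ξ => a * F ξ - b * G ξ) := by
  obtain ⟨C, hC⟩ := hF
  obtain ⟨C', hC'⟩ := hG
  refine ⟨‖a‖ * C + ‖b‖ * C', fun s => ?_⟩
  have e : 𝓕 (fun ξ => a * F ξ - b * G ξ) s = a * 𝓕 F s - b * 𝓕 G s := by
    have hexp : ∀ {H : ℝ → ℂ}, Integrable H → Integrable fun v : ℝ =>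
        Complex.exp (((-2 * Real.pi * v * s : ℝ) : ℂ) * Complex.I) * H v := fun hH =>
      hH.bdd_mul (c := 1) (Continuous.aestronglyMeasurable (by fun_prop))
        (ae_of_all _ fun ξ => (Complex.norm_exp_ofReal_mul_I _).le)
    simp only [Real.fourier_real_eq_integral_exp_smul, smul_eq_mul]
    rw [← integral_const_mul, ← integral_const_mul,
      ← integral_sub ((hexp hFi).const_mul _) ((hexp hGi).const_mul _)]
    refine integral_congr_ae (ae_of_all _ fun v => ?_)
    simp only; ring
  rw [e]
  have h1 := mul_le_mul_of_nonneg_left (hC s) (norm_nonneg a)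
  have h2 := mul_le_mul_of_nonneg_left (hC' s) (norm_nonneg b)
  calc |s| ^ k * ‖a * 𝓕 F s - b * 𝓕 G s‖ ≤ |s| ^ k * (‖a‖ * ‖𝓕 F s‖ + ‖b‖ * ‖𝓕 G s‖) := by
        gcongr
        refine (norm_sub_le _ _).trans ?_
        rw [norm_mul, norm_mul]
    _ = ‖a‖ * (|s| ^ k * ‖𝓕 F s‖) + ‖b‖ * (|s| ^ k * ‖𝓕 G s‖) := by ring
    _ ≤ _ := by linarith

/-! ### Stretched exponentials -/

theorem abs_pow_mul_exp_le {c : ℝ} (hc : 0 < c) {m : ℕ} (hm : 1 ≤ m) (a : ℕ) :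
    ∃ B, ∀ ξ : ℝ, |ξ| ^ a * Real.exp (-c * |ξ| ^ m) ≤ B := by
  -- The 1 covers `|ξ| ≤ 1`. For `|ξ| ≥ 1` the other term comes from `xᵃ/a! ≤ eˣ` at `x = c|ξ|ᵐ`.
  refine ⟨1 + a.factorial / c ^ a, fun ξ => ?_⟩
  have he : Real.exp (-c * |ξ| ^ m) ≤ 1 := by
    rw [Real.exp_le_one_iff, neg_mul, neg_nonpos]; positivity
  have hp : 0 ≤ (a.factorial : ℝ) / c ^ a := by positivity
  rcases le_total |ξ| 1 with h | h
  · have := pow_le_one₀ (n := a) (abs_nonneg ξ) h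
    nlinarith [Real.exp_pos (-c * |ξ| ^ m)]
  · have h1 := Real.pow_div_factorial_le_exp (x := c * |ξ| ^ m) (by positivity) a
    have h2 : |ξ| ^ a ≤ (|ξ| ^ m) ^ a := by
      rw [← pow_mul]; exact pow_le_pow_right₀ h (Nat.le_mul_of_pos_left a hm)
    have h3 : |ξ| ^ a ≤ a.factorial / c ^ a * Real.exp (c * |ξ| ^ m) := by
      rw [div_le_iff₀ (by positivity), mul_pow] at h1
      rw [div_mul_eq_mul_div, le_div_iff₀ (by positivity)]
      nlinarith [pow_pos hc a]
    calc |ξ| ^ a * Real.exp (-c * |ξ| ^ m)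
        ≤ (a.factorial / c ^ a * Real.exp (c * |ξ| ^ m)) * Real.exp (-c * |ξ| ^ m) := by gcongr
      _ = a.factorial / c ^ a := by
          rw [mul_assoc, ← Real.exp_add]; simp
      _ ≤ _ := by linarith

theorem integrable_of_le_abs_pow_mul_exp {c : ℝ} (hc : 0 < c) {m : ℕ} (hm : 1 ≤ m) (a : ℕ)
    {F : ℝ → ℂ} (hF : AEStronglyMeasurable F)
    (h : ∀ ξ, ‖F ξ‖ ≤ |ξ| ^ a * Real.exp (-c * |ξ| ^ m)) : Integrable F := by
  obtain ⟨B, hB⟩ := abs_pow_mul_exp_le hc hm a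
  obtain ⟨B', hB'⟩ := abs_pow_mul_exp_le hc hm (a + 2)
  refine (integrable_inv_one_add_sq.const_mul (B + B')).mono' hF (ae_of_all _ fun ξ => ?_)
  rw [← div_eq_mul_inv, le_div_iff₀ (by positivity)]
  have h1 := h ξ
  have h2 := hB ξ
  have h3 := hB' ξ
  calc ‖F ξ‖ * (1 + ξ ^ 2) ≤ (|ξ| ^ a * Real.exp (-c * |ξ| ^ m)) * (1 + ξ ^ 2) := by gcongr
    _ = |ξ| ^ a * Real.exp (-c * |ξ| ^ m) + |ξ| ^ (a + 2) * Real.exp (-c * |ξ| ^ m) := by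
        rw [pow_add, sq_abs]; ring
    _ ≤ _ := by linarith

/-- The functions `τ(ξ)^ε ξᵃ exp(-c|ξ|ᵐ)`. -/
noncomputable def stretched (τ : ℝ → ℝ) (c : ℝ) (m ε a : ℕ) (ξ : ℝ) : ℂ :=
  ((τ ξ ^ ε * ξ ^ a * Real.exp (-c * |ξ| ^ m) : ℝ) : ℂ)

/-- `τ` is a locally constant factor in the derivative of `|ξ|ᵐ`. -/
structure IsSignFactor (τ : ℝ → ℝ) (m : ℕ) : Prop where
  measurable : Measurable τ
  abs_le : ∀ ξ, |τ ξ| ≤ 1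
  deriv : ∀ ξ, ξ ≠ 0 → HasDerivAt τ 0 ξ
  deriv_abs : ∀ ξ, ξ ≠ 0 → HasDerivAt (fun t => |t| ^ m) (m * τ ξ * ξ ^ (m - 1)) ξ
  cases : τ = 1 ∨ 3 ≤ m

theorem norm_stretched_le {τ : ℝ → ℝ} {m : ℕ} (hτ : IsSignFactor τ m) (c : ℝ) (ε a : ℕ) (ξ : ℝ) :
    ‖stretched τ c m ε a ξ‖ ≤ |ξ| ^ a * Real.exp (-c * |ξ| ^ m) := by
  rw [stretched, Complex.norm_real, norm_mul, norm_mul, norm_pow, norm_pow, Real.norm_eq_abs,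
    Real.norm_eq_abs, Real.norm_of_nonneg (Real.exp_pos _).le]
  have : |τ ξ| ^ ε ≤ 1 := pow_le_one₀ (abs_nonneg _) (hτ.abs_le ξ)
  have h2 : 0 ≤ |ξ| ^ a := by positivity
  gcongr
  nlinarith

theorem integrable_stretched {τ : ℝ → ℝ} {m : ℕ} (hτ : IsSignFactor τ m) (hm : 1 ≤ m) {c : ℝ}
    (hc : 0 < c) (ε a : ℕ) : Integrable (stretched τ c m ε a) := by
  refine integrable_of_le_abs_pow_mul_exp hc hm a ?_ (norm_stretched_le hτ c ε a)
  have := hτ.measurable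
  unfold stretched
  exact Measurable.aestronglyMeasurable (by fun_prop)

/-- The factor `τ` may jump at 0; a positive power of `ξ` hides the jump, and otherwise `τ` is
absent or constant. -/
theorem continuous_stretched {τ : ℝ → ℝ} {m : ℕ} (hτ : IsSignFactor τ m) (c : ℝ) {ε a : ℕ}
    (h : 1 ≤ a ∨ ε = 0 ∨ τ = 1) : Continuous (stretched τ c m ε a) := by
  have hexp : Continuous fun ξ : ℝ => Real.exp (-c * |ξ| ^ m) := by fun_prop
  have main : Continuous fun ξ : ℝ => τ ξ ^ ε * ξ ^ a := by
    rcases h with h | h | h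
    · refine continuous_iff_continuousAt.2 fun ξ => ?_
      rcases eq_or_ne ξ 0 with rfl | hξ
      · rw [ContinuousAt, zero_pow (by omega), mul_zero]
        have h0 : Tendsto (fun ξ : ℝ => |ξ| ^ a) (𝓝 0) (𝓝 0) := by
          have : Continuous fun ξ : ℝ => |ξ| ^ a := by fun_prop
          have h0 := this.tendsto 0
          rwa [abs_zero, zero_pow (by omega)] at h0
        refine squeeze_zero_norm (fun ξ => ?_) h0
        rw [norm_mul, norm_pow, norm_pow, Real.norm_eq_abs, Real.norm_eq_abs]
        exact mul_le_of_le_one_left (by positivity) (pow_le_one₀ (abs_nonneg _) (hτ.abs_le ξ))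
      · exact ((hτ.deriv ξ hξ).continuousAt.pow ε).mul (continuousAt_id.pow a)
    · subst h; simp only [pow_zero, one_mul]; fun_prop
    · subst h; simp only [Pi.one_apply, one_pow, one_mul]; fun_prop
  exact Complex.continuous_ofReal.comp (main.mul hexp)

theorem hasDerivAt_stretched {τ : ℝ → ℝ} {m : ℕ} (hτ : IsSignFactor τ m) (c : ℝ) (ε a : ℕ) {ξ : ℝ}
    (hξ : ξ ≠ 0) : HasDerivAt (stretched τ c m ε a)
      (a * stretched τ c m ε (a - 1) ξ - (c * m) * stretched τ c m (ε + 1) (a + (m - 1)) ξ) ξ := by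
  have h1 := ((hτ.deriv ξ hξ).pow ε).mul (hasDerivAt_pow a ξ)
  have h2 := ((hτ.deriv_abs ξ hξ).const_mul (-c)).exp
  have h3 := (h1.mul h2).ofReal_comp
  refine h3.congr_deriv ?_
  simp only [stretched]
  push_cast
  simp only [Pi.pow_apply, Pi.mul_apply]
  push_cast
  ring

/-- One derivative yields a term with `a` lowered by one and a term with one more factor `τ` and `m
- 1` more powers of `ξ`. If `τ` is the sign, then `m ≥ 3`, so its first appearance brings at least
two powers of `ξ`. These keep the functions continuous for the at most two integrations by parts
that remain, whence `k ≤ 3`. -/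
theorem fourierDecay_stretched {τ : ℝ → ℝ} {m : ℕ} (hτ : IsSignFactor τ m) (hm : 1 ≤ m) {c : ℝ}
    (hc : 0 < c) (k : ℕ) (hk : k ≤ 3) (ε a : ℕ) (h : k ≤ a ∨ ε = 0 ∨ τ = 1) :
    FourierDecay k (stretched τ c m ε a) := by
  induction k generalizing ε a with
  | zero => exact fourierDecay_zero _
  | succ k ih =>
    have i1 := integrable_stretched hτ hm hc ε (a - 1)
    have i2 := integrable_stretched hτ hm hc (ε + 1) (a + (m - 1))
    refine FourierDecay.succ (continuous_stretched hτ c (h.imp_left fun h => by omega))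
      (fun ξ hξ => hasDerivAt_stretched hτ c ε a hξ) (integrable_stretched hτ hm hc ε a)
      ((i1.const_mul _).sub (i2.const_mul _)) ?_
    refine FourierDecay.linear (ih (by omega) _ _ (h.imp_left fun h => by omega))
      (ih (by omega) _ _ ?_) i1 i2 _ _
    rcases hτ.cases with h1 | h1
    · exact Or.inr (Or.inr h1)
    · exact Or.inl (by omega)

theorem isSignFactor_two : IsSignFactor 1 2 where
  measurable := measurable_const
  abs_le _ := by simp
  deriv ξ _ := hasDerivAt_const ξ (1 : ℝ)
  deriv_abs ξ _ := by
    simp only [sq_abs]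
    simpa using hasDerivAt_pow 2 ξ
  cases := Or.inl rfl

theorem isSignFactor_three : IsSignFactor (fun ξ => (SignType.sign ξ : ℝ)) 3 where
  measurable := by
    have : (fun ξ : ℝ => (SignType.sign ξ : ℝ)) = fun ξ => if 0 < ξ then 1 else if ξ < 0 then -1 else 0 := by
      funext ξ; rw [sign_apply]; split_ifs <;> simp
    rw [this]
    exact Measurable.ite measurableSet_Ioi measurable_const
      (Measurable.ite measurableSet_Iio measurable_const measurable_const)
  abs_le ξ := by
    rcases lt_trichotomy ξ 0 with h | h | h
    · simp [sign_neg h]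
    · simp [h]
    · simp [sign_pos h]
  deriv ξ hξ := by
    rcases lt_or_gt_of_ne hξ with h | h
    · refine (hasDerivAt_const ξ (-1 : ℝ)).congr_of_eventuallyEq ?_
      filter_upwards [Iio_mem_nhds h] with t ht
      simp [sign_neg (Set.mem_Iio.1 ht)]
    · refine (hasDerivAt_const ξ (1 : ℝ)).congr_of_eventuallyEq ?_
      filter_upwards [Ioi_mem_nhds h] with t ht
      simp [sign_pos (Set.mem_Ioi.1 ht)]
  deriv_abs ξ hξ := by
    refine ((hasDerivAt_abs hξ).pow 3).congr_deriv ?_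
    simp only [sq_abs, Nat.add_one_sub_one]
    push_cast
    ring
  cases := Or.inr le_rfl

end AnisotropicHolder

namespace AnisotropicHolder

open MeasureTheory Filter Topology
open scoped ContDiff ENNReal FourierTransform

/-! ### One-dimensional heat kernels -/

/-- The symbol `exp(-T |2πξ|ᵐ)`. -/
noncomputable def symb (m : ℕ) (T : ℝ) (ξ : ℝ) : ℂ := ((Real.exp (-T * |2 * Real.pi * ξ| ^ m) : ℝ) : ℂ)

/-- The one-dimensional kernel with symbol `exp(-T |k|ᵐ)`. -/
noncomputable def kern (m : ℕ) (T : ℝ) (s : ℝ) : ℝ := (𝓕 (symb m T) s).re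

theorem symb_eq_stretched (τ : ℝ → ℝ) (m : ℕ) (T : ℝ) :
    symb m T = stretched τ (T * (2 * Real.pi) ^ m) m 0 0 := by
  funext ξ
  simp only [symb, stretched, pow_zero, one_mul, abs_mul, abs_of_pos Real.two_pi_pos, mul_pow]
  ring_nf

theorem symb_neg (m : ℕ) (T ξ : ℝ) : symb m T (-ξ) = symb m T ξ := by simp [symb]

theorem fourier_symb_neg (m : ℕ) (T s : ℝ) : 𝓕 (symb m T) (-s) = 𝓕 (symb m T) s := by
  simp only [Real.fourier_real_eq_integral_exp_smul]
  rw [← integral_neg_eq_self]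
  simp only [symb_neg, neg_mul, mul_neg, neg_neg]

theorem fourier_symb_eq_kern (m : ℕ) (T s : ℝ) : 𝓕 (symb m T) s = (kern m T s : ℂ) := by
  refine (Complex.conj_eq_iff_re.1 ?_).symm
  conv_rhs => rw [← fourier_symb_neg]
  simp only [Real.fourier_real_eq_integral_exp_smul]
  rw [← integral_conj]
  refine integral_congr_ae (ae_of_all _ fun ξ => ?_)
  simp only [smul_eq_mul, map_mul, ← Complex.exp_conj, Complex.conj_ofReal, Complex.conj_I, symb]
  congr 2
  push_cast
  ring

/-- The substitution `k = -2πξ` converts between the two normalizations of the Fourier transform;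
the sign does not matter since the symbol is even. -/
theorem integral_exp_eq_kern (m : ℕ) (T s : ℝ) :
    ∫ k : ℝ, Complex.exp (Complex.I * ((k * s : ℝ) : ℂ)) * ((Real.exp (-T * |k| ^ m) : ℝ) : ℂ) =
      ((2 * Real.pi * kern m T s : ℝ) : ℂ) := by
  have h := Measure.integral_comp_mul_left (fun k : ℝ =>
    Complex.exp (Complex.I * ((k * s : ℝ) : ℂ)) * ((Real.exp (-T * |k| ^ m) : ℝ) : ℂ))
    (-(2 * Real.pi))
  have e : |(-(2 * Real.pi))⁻¹| = (2 * Real.pi)⁻¹ := by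
    rw [inv_neg, abs_neg, abs_of_pos (by positivity)]
  rw [e, eq_inv_smul_iff₀ (by positivity)] at h
  rw [← h, Complex.ofReal_mul, ← fourier_symb_eq_kern, Real.fourier_real_eq_integral_exp_smul,
    Complex.real_smul]
  congr 1
  refine integral_congr_ae (ae_of_all _ fun ξ => ?_)
  simp only [smul_eq_mul, symb, neg_mul, abs_neg]
  congr 2
  push_cast
  ring

theorem heatKernel_eq (T : ℝ) (x : ℝ × ℝ) : heatKernel T x = kern 3 T x.1 * kern 2 T x.2 := by
  have e : ∀ k : ℝ × ℝ, Complex.exp (Complex.I * ((k.1 * x.1 + k.2 * x.2 : ℝ) : ℂ)) *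
      ((Real.exp (-T * (|k.1| ^ 3 + k.2 ^ 2)) : ℝ) : ℂ) =
      (Complex.exp (Complex.I * ((k.1 * x.1 : ℝ) : ℂ)) * ((Real.exp (-T * |k.1| ^ 3) : ℝ) : ℂ)) *
      (Complex.exp (Complex.I * ((k.2 * x.2 : ℝ) : ℂ)) * ((Real.exp (-T * |k.2| ^ 2) : ℝ) : ℂ)) := by
    intro k
    rw [mul_add, Real.exp_add, sq_abs]
    push_cast
    rw [mul_add, Complex.exp_add]
    ring
  simp only [heatKernel, e]
  rw [Measure.volume_eq_prod, integral_prod_mul (fun k : ℝ =>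
    Complex.exp (Complex.I * ((k * x.1 : ℝ) : ℂ)) * ((Real.exp (-T * |k| ^ 3) : ℝ) : ℂ)) (fun k : ℝ =>
    Complex.exp (Complex.I * ((k * x.2 : ℝ) : ℂ)) * ((Real.exp (-T * |k| ^ 2) : ℝ) : ℂ)),
    integral_exp_eq_kern, integral_exp_eq_kern, ← Complex.ofReal_mul, Complex.real_smul,
    ← Complex.ofReal_mul, Complex.ofReal_re]
  have := Real.pi_pos
  field_simp

theorem kern_pow_mul (m : ℕ) {b : ℝ} (hb : 0 < b) (T s : ℝ) :
    kern m (b ^ m * T) s = b⁻¹ * kern m T (s / b) := by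
  have h := Measure.integral_comp_mul_left (fun ξ : ℝ =>
    Complex.exp (((-2 * Real.pi * ξ * (s / b) : ℝ) : ℂ) * Complex.I) • symb m T ξ) b
  rw [abs_of_pos (inv_pos.2 hb), ← Real.fourier_real_eq_integral_exp_smul, fourier_symb_eq_kern,
    Complex.real_smul, ← Complex.ofReal_mul] at h
  rw [← Complex.ofReal_inj, ← h, ← fourier_symb_eq_kern, Real.fourier_real_eq_integral_exp_smul]
  refine integral_congr_ae (ae_of_all _ fun ξ => ?_)
  have e1 : -2 * Real.pi * (b * ξ) * (s / b) = -2 * Real.pi * ξ * s := by field_simp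
  have e2 : symb m (b ^ m * T) ξ = symb m T (b * ξ) := by
    simp only [symb]
    rw [mul_left_comm (2 * Real.pi) b ξ, abs_mul b, mul_pow, abs_of_pos hb]
    ring_nf
  simp only [e1, e2]

/-- With `ℓ = T^{1/3}` and `ℓ^{3/2} = T^{1/2}`, both `|ℓk₁|³` and `(ℓ^{3/2}k₂)²` pick up exactly the
factor `T`. Heat averages are thus mask averages at scale `T^{1/3}`. -/
theorem heatKernel_eq_rescale {T : ℝ} (hT : 0 < T) :
    heatKernel T = rescale (heatKernel 1) (T ^ (1 / 3 : ℝ)) := by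
  set l := T ^ (1 / 3 : ℝ) with hl
  have hl0 : 0 < l := Real.rpow_pos_of_pos hT _
  set b := l ^ (3 / 2 : ℝ) with hb
  have hb0 : 0 < b := Real.rpow_pos_of_pos hl0 _
  have e3 : l ^ 3 = T := by
    rw [hl, ← Real.rpow_natCast, ← Real.rpow_mul hT.le]; norm_num
  have e2 : b ^ 2 = T := by
    rw [hb, ← Real.rpow_natCast, ← Real.rpow_mul hl0.le, ← e3, ← Real.rpow_natCast]; norm_num
  have e5 : l ^ (5 / 2 : ℝ) = l * b := by
    rw [hb]; nth_rewrite 2 [← Real.rpow_one l]; rw [← Real.rpow_add hl0]; norm_num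
  funext x
  have h3 := kern_pow_mul 3 hl0 1 x.1
  have h2 := kern_pow_mul 2 hb0 1 x.2
  rw [mul_one, e3] at h3
  rw [mul_one, e2] at h2
  rw [heatKernel_eq, rescale, heatKernel_eq, h3, h2, e5, mul_inv]
  ring

section

variable {τ : ℝ → ℝ} {m : ℕ}

theorem two_pi_pow_mul_pos {T : ℝ} (hT : 0 < T) (m : ℕ) : 0 < T * (2 * Real.pi) ^ m := by
  have := Real.pi_pos; positivity

theorem pow_smul_symb (τ : ℝ → ℝ) (m : ℕ) (T : ℝ) (n : ℕ) :
    (fun ξ : ℝ => ξ ^ n • symb m T ξ) = stretched τ (T * (2 * Real.pi) ^ m) m 0 n := by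
  funext ξ
  rw [symb_eq_stretched τ, Complex.real_smul]
  simp [stretched]

theorem integrable_pow_smul_symb (hτ : IsSignFactor τ m) (hm : 1 ≤ m) {T : ℝ} (hT : 0 < T) (n : ℕ) :
    Integrable fun ξ : ℝ => ξ ^ n • symb m T ξ := by
  rw [pow_smul_symb τ]
  exact integrable_stretched hτ hm (two_pi_pow_mul_pos hT m) 0 n

theorem contDiff_fourier_symb (hτ : IsSignFactor τ m) (hm : 1 ≤ m) {T : ℝ} (hT : 0 < T) :
    ContDiff ℝ ∞ (𝓕 (symb m T)) := by
  refine Real.contDiff_fourier (N := ⊤) fun n _ => ?_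
  refine (integrable_pow_smul_symb hτ hm hT n).norm.congr (ae_of_all _ fun ξ => ?_)
  simp only [norm_smul, norm_pow]

theorem one_add_pow_three_le {t : ℝ} (ht : 0 ≤ t) : (1 + t) ^ 3 ≤ 4 * (1 + t ^ 3) := by
  nlinarith [mul_nonneg ht (sq_nonneg (t - 1)), sq_nonneg (t - 1)]

/-- Differentiating the transform multiplies the symbol by powers of `ξ`, which stays within the
stretched exponentials. Their transforms are bounded (order 0) and decay cubically (order 3), and
the two bounds are added. -/
theorem norm_iteratedDeriv_fourier_symb_le (hτ : IsSignFactor τ m) (hm : 1 ≤ m) {T : ℝ}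
    (hT : 0 < T) (n : ℕ) : ∃ C, ∀ s, ‖iteratedDeriv n (𝓕 (symb m T)) s‖ ≤ C * ((1 + |s|) ^ 3)⁻¹ := by
  have hc := two_pi_pow_mul_pos hT m
  obtain ⟨C₀, h0⟩ := fourierDecay_stretched hτ hm hc 0 (by norm_num) 0 n (by simp)
  obtain ⟨C₃, h3⟩ := fourierDecay_stretched hτ hm hc 3 le_rfl 0 n (by simp)
  refine ⟨(2 * Real.pi) ^ n * (4 * (C₀ + C₃)), fun s => ?_⟩
  rw [Real.iteratedDeriv_fourier (N := ⊤) (fun n _ => integrable_pow_smul_symb hτ hm hT n) le_top]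
  have e : (fun ξ : ℝ => (-2 * Real.pi * Complex.I * ξ : ℂ) ^ n • symb m T ξ) =
      (-2 * Real.pi * Complex.I : ℂ) ^ n • stretched τ (T * (2 * Real.pi) ^ m) m 0 n := by
    funext ξ
    rw [Pi.smul_apply, ← pow_smul_symb τ]
    simp only [smul_eq_mul, Complex.real_smul]
    push_cast
    ring
  have e2 : 𝓕 ((-2 * Real.pi * Complex.I : ℂ) ^ n • stretched τ (T * (2 * Real.pi) ^ m) m 0 n) s =
      (-2 * Real.pi * Complex.I : ℂ) ^ n * 𝓕 (stretched τ (T * (2 * Real.pi) ^ m) m 0 n) s := by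
    simp only [Real.fourier_real_eq_integral_exp_smul, Pi.smul_apply, smul_eq_mul]
    rw [← integral_const_mul]
    refine integral_congr_ae (ae_of_all _ fun v => ?_)
    simp only; ring
  rw [e, e2, norm_mul, norm_pow]
  have e3 : ‖(-2 * Real.pi * Complex.I : ℂ)‖ = 2 * Real.pi := by
    simp [abs_of_pos Real.pi_pos]
  rw [e3, mul_assoc]
  have hpi := Real.pi_pos
  refine mul_le_mul_of_nonneg_left ?_ (by positivity)
  rw [← div_eq_mul_inv, le_div_iff₀ (by positivity)]
  have h0' := h0 s
  have h3' := h3 s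
  rw [pow_zero, one_mul] at h0'
  calc ‖𝓕 (stretched τ (T * (2 * Real.pi) ^ m) m 0 n) s‖ * (1 + |s|) ^ 3
      ≤ ‖𝓕 (stretched τ (T * (2 * Real.pi) ^ m) m 0 n) s‖ * (4 * (1 + |s| ^ 3)) := by
        gcongr; exact one_add_pow_three_le (abs_nonneg s)
    _ = 4 * (‖𝓕 (stretched τ (T * (2 * Real.pi) ^ m) m 0 n) s‖ +
        |s| ^ 3 * ‖𝓕 (stretched τ (T * (2 * Real.pi) ^ m) m 0 n) s‖) := by ring
    _ ≤ _ := by linarith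

/-- Smooth functions of one variable all of whose derivatives decay like `(1 + |s|)⁻³`. -/
structure RapidKernel₁ (p : ℝ → ℝ) : Prop where
  contDiff : ContDiff ℝ ∞ p
  bound : ∀ n : ℕ, ∃ C, ∀ s, ‖iteratedFDeriv ℝ n p s‖ ≤ C * ((1 + |s|) ^ 3)⁻¹

theorem kern_eq_comp (m : ℕ) (T : ℝ) : kern m T = Complex.reCLM ∘ 𝓕 (symb m T) := rfl

theorem rapidKernel₁_kern (hτ : IsSignFactor τ m) (hm : 1 ≤ m) {T : ℝ} (hT : 0 < T) :
    RapidKernel₁ (kern m T) := by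
  have hcd := contDiff_fourier_symb hτ hm hT
  refine ⟨Complex.reCLM.contDiff.comp hcd, fun n => ?_⟩
  obtain ⟨C, hC⟩ := norm_iteratedDeriv_fourier_symb_le hτ hm hT n
  refine ⟨C, fun s => ?_⟩
  rw [kern_eq_comp]
  refine (Complex.reCLM.norm_iteratedFDeriv_comp_left (n := n) hcd.contDiffAt
    (by exact_mod_cast le_top)).trans ?_
  rw [Complex.reCLM_norm, one_mul, norm_iteratedFDeriv_eq_norm_iteratedDeriv]
  exact hC s

theorem RapidKernel₁.norm_iteratedFDeriv_comp_le {p : ℝ → ℝ} (hp : RapidKernel₁ p)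
    (L : ℝ × ℝ →L[ℝ] ℝ) (hL : ‖L‖ ≤ 1) (n : ℕ) :
    ∃ C, 0 ≤ C ∧ ∀ x, ‖iteratedFDeriv ℝ n (p ∘ L) x‖ ≤ C * ((1 + |L x|) ^ 3)⁻¹ := by
  obtain ⟨C, hC⟩ := hp.bound n
  have hC0 : 0 ≤ C := nonneg_of_mul_nonneg_left ((norm_nonneg _).trans (hC 0)) (by positivity)
  refine ⟨C, hC0, fun x => ?_⟩
  rw [L.iteratedFDeriv_comp_right hp.contDiff x (i := n) (by exact_mod_cast le_top)]
  refine (ContinuousMultilinearMap.norm_compContinuousLinearMap_le _ _).trans ?_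
  rw [Finset.prod_const]
  exact (mul_le_of_le_one_right (norm_nonneg _) (pow_le_one₀ (norm_nonneg _) hL)).trans (hC _)

theorem RapidKernel₁.prod {p q : ℝ → ℝ} (hp : RapidKernel₁ p) (hq : RapidKernel₁ q) :
    RapidKernel fun x : ℝ × ℝ => p x.1 * q x.2 := by
  have hp' : ContDiff ℝ ∞ (p ∘ ContinuousLinearMap.fst ℝ ℝ ℝ) :=
    hp.contDiff.comp (ContinuousLinearMap.contDiff _)
  have hq' : ContDiff ℝ ∞ (q ∘ ContinuousLinearMap.snd ℝ ℝ ℝ) :=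
    hq.contDiff.comp (ContinuousLinearMap.contDiff _)
  refine ⟨hp'.mul hq', fun n => ?_⟩
  choose C hC0 hC using hp.norm_iteratedFDeriv_comp_le (ContinuousLinearMap.fst ℝ ℝ ℝ)
    (ContinuousLinearMap.norm_fst_le ℝ ℝ ℝ)
  choose D hD0 hD using hq.norm_iteratedFDeriv_comp_le (ContinuousLinearMap.snd ℝ ℝ ℝ)
    (ContinuousLinearMap.norm_snd_le ℝ ℝ ℝ)
  refine ⟨∑ i ∈ Finset.range (n + 1), (n.choose i : ℝ) * C i * D (n - i), fun x => ?_⟩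
  refine (norm_iteratedFDeriv_mul_le hp' hq' x (n := n) (by exact_mod_cast le_top)).trans ?_
  rw [Finset.sum_mul]
  refine Finset.sum_le_sum fun i _ => ?_
  have h1 : ‖iteratedFDeriv ℝ i (p ∘ ContinuousLinearMap.fst ℝ ℝ ℝ) x‖ ≤
    C i * ((1 + |x.1|) ^ 3)⁻¹ := hC i x
  have h2 : ‖iteratedFDeriv ℝ (n - i) (q ∘ ContinuousLinearMap.snd ℝ ℝ ℝ) x‖ ≤
    D (n - i) * ((1 + |x.2|) ^ 3)⁻¹ := hD (n - i) x
  have := hC0 i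
  calc _ ≤ (n.choose i : ℝ) * (C i * ((1 + |x.1|) ^ 3)⁻¹) * (D (n - i) * ((1 + |x.2|) ^ 3)⁻¹) := by
        gcongr
    _ = _ := by rw [weight, mul_inv]; ring

theorem rapidKernel_heatKernel {T : ℝ} (hT : 0 < T) : RapidKernel (heatKernel T) := by
  have : heatKernel T = fun x => kern 3 T x.1 * kern 2 T x.2 := funext (heatKernel_eq T)
  rw [this]
  exact (rapidKernel₁_kern isSignFactor_three (by norm_num) hT).prod
    (rapidKernel₁_kern isSignFactor_two (by norm_num) hT)

/-! ### Poisson summation for the heat kernel -/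

theorem isBigO_of_pow_mul_le {f : ℝ → ℂ} {C : ℝ} (h : ∀ s, |s| ^ 3 * ‖f s‖ ≤ C) :
    f =O[cocompact ℝ] fun x => |x| ^ (-3 : ℝ) := by
  refine Asymptotics.IsBigO.of_bound C ?_
  have h0 : ∀ᶠ x : ℝ in cocompact ℝ, x ≠ 0 := by
    have := (isCompact_singleton (x := (0 : ℝ))).compl_mem_cocompact
    exact this
  filter_upwards [h0] with x hx
  have hx' : 0 < |x| := abs_pos.2 hx
  rw [Real.rpow_neg hx'.le, show (3 : ℝ) = ((3 : ℕ) : ℝ) by norm_num, Real.rpow_natCast,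
    Real.norm_of_nonneg (by positivity), ← div_eq_mul_inv, le_div_iff₀ (by positivity), mul_comm]
  exact h x

theorem continuous_symb (m : ℕ) (T : ℝ) : Continuous (symb m T) := by unfold symb; fun_prop

theorem fourier_fourier_symb (hτ : IsSignFactor τ m) (hm : 1 ≤ m) {T : ℝ} (hT : 0 < T) :
    𝓕 (𝓕 (symb m T)) = symb m T := by
  have hi : Integrable (symb m T) := by
    simpa using integrable_pow_smul_symb hτ hm hT 0
  have hF : Integrable (𝓕 (symb m T)) := by
    obtain ⟨C, hC⟩ := norm_iteratedDeriv_fourier_symb_le hτ hm hT 0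
    simp only [iteratedDeriv_zero] at hC
    exact (integrable_one_add_abs.const_mul C).mono'
      (contDiff_fourier_symb hτ hm hT).continuous.aestronglyMeasurable (ae_of_all _ hC)
  have h := (continuous_symb m T).fourierInv_fourier_eq hi hF
  funext ξ
  have h2 := congrFun h (-ξ)
  rw [Real.fourierInv_eq_fourier_neg, neg_neg, symb_neg] at h2
  exact h2

/-- Poisson summation applied to the transform of the symbol, which is the kernel. Its own transform
is again the symbol, by Fourier inversion and evenness. Cubic decay of the kernel and exponential
decay of the symbol justify the formula. -/
theorem tsum_kern (hτ : IsSignFactor τ m) (hm : 1 ≤ m) {T : ℝ} (hT : 0 < T) (s : ℝ) :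
    ((∑' z : ℤ, kern m T (s + z) : ℝ) : ℂ) =
      ∑' k : ℤ, symb m T k * Complex.exp (2 * Real.pi * Complex.I * k * s) := by
  have hc := two_pi_pow_mul_pos hT m
  obtain ⟨C, hC⟩ := fourierDecay_stretched hτ hm hc 3 le_rfl 0 0 (by simp)
  rw [← symb_eq_stretched] at hC
  obtain ⟨B, hB⟩ := abs_pow_mul_exp_le hc hm 3
  have h := Real.tsum_eq_tsum_fourier_of_rpow_decay (f := 𝓕 (symb m T))
    (contDiff_fourier_symb hτ hm hT).continuous (b := 3) (by norm_num) (isBigO_of_pow_mul_le hC)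
    (by
      rw [fourier_fourier_symb hτ hm hT]
      refine isBigO_of_pow_mul_le (C := B) fun s => ?_
      refine le_trans (mul_le_mul_of_nonneg_left ?_ (by positivity)) (hB s)
      rw [symb_eq_stretched τ]
      simpa using norm_stretched_le hτ (T * (2 * Real.pi) ^ m) 0 0 s) s
  rw [fourier_fourier_symb hτ hm hT] at h
  simp only [fourier_symb_eq_kern, fourier_coe_apply, Complex.ofReal_one, div_one] at h
  rw [Complex.ofReal_tsum]
  exact h

end

/-- `exp(-T (|2πk₁|³ + (2πk₂)²))`. -/
noncomputable def heatSymbol (T : ℝ) (k : ℤ × ℤ) : ℝ :=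
  Real.exp (-T * |2 * Real.pi * k.1| ^ 3) * Real.exp (-T * |2 * Real.pi * k.2| ^ 2)

/-- The characters of the torus. -/
noncomputable def char (k : ℤ × ℤ) (x : ℝ × ℝ) : ℂ :=
  Complex.exp (2 * Real.pi * Complex.I * k.1 * x.1) * Complex.exp (2 * Real.pi * Complex.I * k.2 * x.2)

theorem norm_exp_two_pi (k : ℤ) (s : ℝ) : ‖Complex.exp (2 * Real.pi * Complex.I * k * s)‖ = 1 := by
  have : (2 * Real.pi * Complex.I * k * s : ℂ) = ((2 * Real.pi * k * s : ℝ) : ℂ) * Complex.I := by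
    push_cast; ring
  rw [this, Complex.norm_exp_ofReal_mul_I]

theorem norm_char (k : ℤ × ℤ) (x : ℝ × ℝ) : ‖char k x‖ = 1 := by
  rw [char, norm_mul, norm_exp_two_pi, norm_exp_two_pi, one_mul]

theorem summable_pow_mul_exp {m : ℕ} (hm : 1 ≤ m) {T : ℝ} (hT : 0 < T) (n : ℕ) :
    Summable fun k : ℤ => (1 + |(k : ℝ)|) ^ n * Real.exp (-T * |2 * Real.pi * k| ^ m) := by
  obtain ⟨B₀, h0⟩ := abs_pow_mul_exp_le hT hm 0
  obtain ⟨B, hB⟩ := abs_pow_mul_exp_le hT hm (n + 3)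
  refine (summable_one_add_abs_int.mul_left (2 ^ (n + 3) * (B₀ + B))).of_nonneg_of_le
    (fun k => by positivity) fun k => ?_
  rw [← div_eq_mul_inv, le_div_iff₀ (by positivity)]
  have h1 : Real.exp (-T * |2 * Real.pi * k| ^ m) ≤ Real.exp (-T * |(k : ℝ)| ^ m) := by
    have h2 : |(k : ℝ)| ≤ |2 * Real.pi * k| := by
      rw [abs_mul, abs_of_pos Real.two_pi_pos]
      exact le_mul_of_one_le_left (abs_nonneg _) (by linarith [Real.pi_gt_three])
    have h3 := pow_le_pow_left₀ (abs_nonneg _) h2 m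
    rw [Real.exp_le_exp]
    nlinarith
  have h2 : (1 + |(k : ℝ)|) ^ (n + 3) ≤ 2 ^ (n + 3) * (1 + |(k : ℝ)| ^ (n + 3)) := by
    have ha := abs_nonneg (k : ℝ)
    rcases le_total |(k : ℝ)| 1 with h | h
    · calc (1 + |(k : ℝ)|) ^ (n + 3) ≤ 2 ^ (n + 3) := by gcongr; linarith
        _ ≤ _ := le_mul_of_one_le_right (by positivity) (by simp)
    · calc (1 + |(k : ℝ)|) ^ (n + 3) ≤ (2 * |(k : ℝ)|) ^ (n + 3) := by gcongr; linarith
        _ = 2 ^ (n + 3) * |(k : ℝ)| ^ (n + 3) := mul_pow _ _ _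
        _ ≤ _ := by gcongr; linarith
  have h3 := h0 k
  have h4 := hB k
  rw [pow_zero, one_mul] at h3
  calc (1 + |(k : ℝ)|) ^ n * Real.exp (-T * |2 * Real.pi * k| ^ m) * (1 + |(k : ℝ)|) ^ 3
      = (1 + |(k : ℝ)|) ^ (n + 3) * Real.exp (-T * |2 * Real.pi * k| ^ m) := by ring
    _ ≤ (2 ^ (n + 3) * (1 + |(k : ℝ)| ^ (n + 3))) * Real.exp (-T * |(k : ℝ)| ^ m) := by gcongr
    _ = 2 ^ (n + 3) * (Real.exp (-T * |(k : ℝ)| ^ m) +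
        |(k : ℝ)| ^ (n + 3) * Real.exp (-T * |(k : ℝ)| ^ m)) := by ring
    _ ≤ _ := by gcongr

theorem summable_pow_mul_heatSymbol {T : ℝ} (hT : 0 < T) (n : ℕ) :
    Summable fun k : ℤ × ℤ => ((1 + |(k.1 : ℝ)|) * (1 + |(k.2 : ℝ)|)) ^ n * heatSymbol T k := by
  refine ((summable_pow_mul_exp (m := 3) (by norm_num) hT n).mul_of_nonneg
    (summable_pow_mul_exp (m := 2) (by norm_num) hT n) (fun k => by positivity)
    (fun k => by positivity)).congr fun k => ?_
  rw [heatSymbol, mul_pow]; ring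

theorem heatSymbol_pos (T : ℝ) (k : ℤ × ℤ) : 0 < heatSymbol T k := by unfold heatSymbol; positivity

theorem RapidKernel₁.summable_norm {p : ℝ → ℝ} (hp : RapidKernel₁ p) (s : ℝ) :
    Summable fun z : ℤ => ‖p (s + z)‖ := by
  obtain ⟨C, hC⟩ := hp.bound 0
  have hC0 : 0 ≤ C := nonneg_of_mul_nonneg_left ((norm_nonneg _).trans (hC 0)) (by positivity)
  refine (summable_one_add_abs_int.mul_left (C * (1 + |s|) ^ 3)).of_nonneg_of_le
    (fun k => norm_nonneg _) fun z => ?_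
  have h := hC (s + z)
  rw [norm_iteratedFDeriv_zero] at h
  refine h.trans ?_
  rw [mul_assoc]
  refine mul_le_mul_of_nonneg_left ?_ hC0
  rw [← div_eq_mul_inv, le_div_iff₀ (by positivity), ← div_eq_inv_mul, div_le_iff₀ (by positivity),
    ← mul_pow]
  refine pow_le_pow_left₀ (by positivity) ?_ 3
  have h2 : |(z : ℝ)| ≤ |s| + |s + z| := by
    have := abs_sub_abs_le_abs_sub (z : ℝ) (-s)
    rw [abs_neg, sub_neg_eq_add, add_comm (z : ℝ) s] at this; linarith
  nlinarith [mul_nonneg (abs_nonneg s) (abs_nonneg (s + z))]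

theorem tsum_heatKernel {T : ℝ} (hT : 0 < T) (x : ℝ × ℝ) :
    ((∑' z : ℤ × ℤ, heatKernel T (x.1 + z.1, x.2 + z.2) : ℝ) : ℂ) =
      ∑' k : ℤ × ℤ, (heatSymbol T k : ℂ) * char k x := by
  have h3 := rapidKernel₁_kern isSignFactor_three (by norm_num) hT
  have h2 := rapidKernel₁_kern isSignFactor_two (by norm_num) hT
  simp only [heatKernel_eq]
  rw [← tsum_mul_tsum_of_summable_norm (h3.summable_norm x.1) (h2.summable_norm x.2),
    Complex.ofReal_mul, tsum_kern isSignFactor_three (by norm_num) hT,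
    tsum_kern isSignFactor_two (by norm_num) hT, tsum_mul_tsum_of_summable_norm]
  · refine tsum_congr fun k => ?_
    simp only [symb, heatSymbol, char]
    push_cast
    ring
  · refine (summable_pow_mul_exp (m := 3) (by norm_num) hT 0).congr fun k => ?_
    rw [norm_mul, norm_exp_two_pi, symb, Complex.norm_real, Real.norm_of_nonneg (Real.exp_pos _).le,
      pow_zero, one_mul, mul_one]
  · refine (summable_pow_mul_exp (m := 2) (by norm_num) hT 0).congr fun k => ?_
    rw [norm_mul, norm_exp_two_pi, symb, Complex.norm_real, Real.norm_of_nonneg (Real.exp_pos _).le,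
      pow_zero, one_mul, mul_one]

end AnisotropicHolder

namespace AnisotropicHolder

open MeasureTheory Filter Topology
open scoped ContDiff ENNReal ComplexConjugate

/-! ### Fourier series with rapidly decreasing coefficients -/

theorem char_eq (k : ℤ × ℤ) (x : ℝ × ℝ) :
    char k x = Complex.exp (((2 * Real.pi * (k.1 * x.1 + k.2 * x.2) : ℝ) : ℂ) * Complex.I) := by
  rw [char, ← Complex.exp_add]
  congr 1
  push_cast
  ring

theorem conj_char (k : ℤ × ℤ) (x : ℝ × ℝ) : conj (char k x) = char (-k) x := by
  rw [char_eq, char_eq, ← Complex.exp_conj]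
  congr 1
  simp only [map_mul, Complex.conj_ofReal, Complex.conj_I, Prod.fst_neg, Prod.snd_neg]
  push_cast
  ring

theorem char_sub (k : ℤ × ℤ) (x y : ℝ × ℝ) :
    char k (x.1 - y.1, x.2 - y.2) = char k x * conj (char k y) := by
  rw [conj_char, char_eq, char_eq, char_eq, ← Complex.exp_add]
  congr 1
  simp only [Prod.fst_neg, Prod.snd_neg]
  push_cast
  ring

theorem char_add_one (k : ℤ × ℤ) (x : ℝ × ℝ) :
    char k (x.1 + 1, x.2) = char k x ∧ char k (x.1, x.2 + 1) = char k x := by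
  have h : ∀ (n : ℤ) (s : ℝ), Complex.exp (2 * Real.pi * Complex.I * n * ((s + 1 : ℝ) : ℂ)) =
      Complex.exp (2 * Real.pi * Complex.I * n * s) := fun n s => by
    rw [Complex.ofReal_add, mul_add, Complex.exp_add, Complex.ofReal_one, mul_one,
      mul_comm (2 * Real.pi * Complex.I : ℂ) n, Complex.exp_int_mul_two_pi_mul_I, mul_one]
  simp only [char, h, and_self]

/-- The coordinate `x₁` as a complex-valued linear map. -/
noncomputable def coordC₁ : ℝ × ℝ →L[ℝ] ℂ := Complex.ofRealCLM.comp (ContinuousLinearMap.fst ℝ ℝ ℝ)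

/-- The coordinate `x₂` as a complex-valued linear map. -/
noncomputable def coordC₂ : ℝ × ℝ →L[ℝ] ℂ := Complex.ofRealCLM.comp (ContinuousLinearMap.snd ℝ ℝ ℝ)

theorem coordC₁_apply (x : ℝ × ℝ) : coordC₁ x = (x.1 : ℂ) := rfl

theorem coordC₂_apply (x : ℝ × ℝ) : coordC₂ x = (x.2 : ℂ) := rfl

/-- The factor `2πik₁` by which `∂₁` acts on characters. -/
noncomputable def mult₁ (k : ℤ × ℤ) : ℂ := 2 * Real.pi * Complex.I * k.1

/-- The factor `2πik₂` by which `∂₂` acts on characters. -/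
noncomputable def mult₂ (k : ℤ × ℤ) : ℂ := 2 * Real.pi * Complex.I * k.2

theorem hasFDerivAt_char (k : ℤ × ℤ) (x : ℝ × ℝ) :
    HasFDerivAt (char k) ((mult₁ k * char k x) • coordC₁ + (mult₂ k * char k x) • coordC₂) x := by
  have h1 : HasFDerivAt (fun y : ℝ × ℝ => mult₁ k * coordC₁ y) (mult₁ k • coordC₁) x :=
    coordC₁.hasFDerivAt.const_mul (mult₁ k)
  have h2 : HasFDerivAt (fun y : ℝ × ℝ => mult₂ k * coordC₂ y) (mult₂ k • coordC₂) x :=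
    coordC₂.hasFDerivAt.const_mul (mult₂ k)
  have h := h1.cexp.mul h2.cexp
  refine h.congr_fderiv ?_
  ext <;> simp [char, mult₁, mult₂, coordC₁_apply, coordC₂_apply] <;> ring

/-- Coefficients decreasing faster than any power. -/
def RapidCoeff (c : ℤ × ℤ → ℂ) : Prop :=
  ∀ n : ℕ, Summable fun k : ℤ × ℤ => ((1 + |(k.1 : ℝ)|) * (1 + |(k.2 : ℝ)|)) ^ n * ‖c k‖

theorem RapidCoeff.summable_norm {c : ℤ × ℤ → ℂ} (hc : RapidCoeff c) : Summable fun k => ‖c k‖ := by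
  simpa using hc 0

theorem RapidCoeff.mul {c : ℤ × ℤ → ℂ} (hc : RapidCoeff c) {d : ℤ × ℤ → ℂ} {B : ℝ}
    (hd : ∀ k : ℤ × ℤ, ‖d k‖ ≤ B * ((1 + |(k.1 : ℝ)|) * (1 + |(k.2 : ℝ)|))) :
    RapidCoeff fun k => d k * c k := by
  intro n
  refine ((hc (n + 1)).mul_left B).of_nonneg_of_le (fun k => by positivity) fun k => ?_
  rw [norm_mul, pow_succ]
  have h := mul_le_mul_of_nonneg_right (hd k) (norm_nonneg (c k))
  have h0 : 0 ≤ ((1 + |(k.1 : ℝ)|) * (1 + |(k.2 : ℝ)|)) ^ n := by positivity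
  calc _ ≤ ((1 + |(k.1 : ℝ)|) * (1 + |(k.2 : ℝ)|)) ^ n *
        (B * ((1 + |(k.1 : ℝ)|) * (1 + |(k.2 : ℝ)|)) * ‖c k‖) := by gcongr
    _ = _ := by ring

theorem norm_mult₁ (k : ℤ × ℤ) : ‖mult₁ k‖ = 2 * Real.pi * |(k.1 : ℝ)| := by
  simp [mult₁, abs_of_pos Real.pi_pos]

theorem norm_mult₂ (k : ℤ × ℤ) : ‖mult₂ k‖ = 2 * Real.pi * |(k.2 : ℝ)| := by
  simp [mult₂, abs_of_pos Real.pi_pos]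

theorem RapidCoeff.mult₁ {c : ℤ × ℤ → ℂ} (hc : RapidCoeff c) :
    RapidCoeff fun k => mult₁ k * c k :=
  hc.mul (B := 2 * Real.pi) fun k => by
    rw [norm_mult₁]
    have := Real.pi_pos
    have h1 := abs_nonneg (k.1 : ℝ)
    have h2 := abs_nonneg (k.2 : ℝ)
    gcongr
    nlinarith

theorem RapidCoeff.mult₂ {c : ℤ × ℤ → ℂ} (hc : RapidCoeff c) :
    RapidCoeff fun k => mult₂ k * c k :=
  hc.mul (B := 2 * Real.pi) fun k => by
    rw [norm_mult₂]
    have := Real.pi_pos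
    have h1 := abs_nonneg (k.1 : ℝ)
    have h2 := abs_nonneg (k.2 : ℝ)
    gcongr
    nlinarith

/-- The Fourier series with given coefficients. -/
noncomputable def series (c : ℤ × ℤ → ℂ) (x : ℝ × ℝ) : ℂ := ∑' k, c k * char k x

theorem summable_series {c : ℤ × ℤ → ℂ} (hc : Summable fun k => ‖c k‖) (x : ℝ × ℝ) :
    Summable fun k => c k * char k x :=
  Summable.of_norm_bounded hc fun k => by rw [norm_mul, norm_char, mul_one]

theorem RapidCoeff.hasFDerivAt_series {c : ℤ × ℤ → ℂ} (hc : RapidCoeff c) (x : ℝ × ℝ) :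
    HasFDerivAt (series c) (series (fun k => AnisotropicHolder.mult₁ k * c k) x • coordC₁ +
      series (fun k => AnisotropicHolder.mult₂ k * c k) x • coordC₂) x := by
  have s1 := summable_series hc.mult₁.summable_norm x
  have s2 := summable_series hc.mult₂.summable_norm x
  have h := hasFDerivAt_tsum (𝕜 := ℝ) (f := fun k x => c k * char k x)
    (f' := fun k x => (AnisotropicHolder.mult₁ k * c k * char k x) • coordC₁ +
      (AnisotropicHolder.mult₂ k * c k * char k x) • coordC₂)
    ((hc.mult₁.summable_norm.mul_right ‖coordC₁‖).add (hc.mult₂.summable_norm.mul_right ‖coordC₂‖))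
    (fun k y => ?_) (fun k y => ?_) (x₀ := x) (summable_series hc.summable_norm x) x
  · refine h.congr_fderiv ?_
    rw [(s1.smul_const coordC₁).tsum_add (s2.smul_const coordC₂), s1.tsum_smul_const,
      s2.tsum_smul_const]
    rfl
  · refine ((hasFDerivAt_char k y).const_mul (c k)).congr_fderiv ?_
    rw [smul_add, smul_smul, smul_smul]
    congr 2 <;> ring
  · refine (norm_add_le _ _).trans ?_
    rw [norm_smul, norm_smul, norm_mul, norm_char, mul_one, norm_mul (_ * _), norm_char, mul_one]

theorem RapidCoeff.contDiff_series {c : ℤ × ℤ → ℂ} (hc : RapidCoeff c) (n : ℕ) :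
    ContDiff ℝ n (series c) := by
  induction n generalizing c with
  | zero =>
    exact contDiff_zero.2 (continuous_iff_continuousAt.2 fun y => (hc.hasFDerivAt_series y).continuousAt)
  | succ n ih =>
    push_cast
    rw [contDiff_succ_iff_fderiv]
    refine ⟨fun y => (hc.hasFDerivAt_series y).differentiableAt, by simp, ?_⟩
    have : _root_.fderiv ℝ (series c) = fun x =>
        series (fun k => AnisotropicHolder.mult₁ k * c k) x • coordC₁ +
        series (fun k => AnisotropicHolder.mult₂ k * c k) x • coordC₂ :=
      funext fun y => (hc.hasFDerivAt_series y).fderiv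
    rw [this]
    exact ((ih hc.mult₁).smul contDiff_const).add ((ih hc.mult₂).smul contDiff_const)

theorem RapidCoeff.re_series_mem {c : ℤ × ℤ → ℂ} (hc : RapidCoeff c) :
    (fun x => (series c x).re) ∈ smoothPeriodic :=
  ⟨Complex.reCLM.contDiff.comp (contDiff_infty.2 hc.contDiff_series), fun x => by
    simp only [series, (char_add_one _ x).1, (char_add_one _ x).2, and_self]⟩

/-- The real part of a Fourier series as a test function. -/
noncomputable def reTest (c : ℤ × ℤ → ℂ) (hc : RapidCoeff c) : TorusTest :=
  TorusTest.mk _ hc.re_series_mem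

theorem reTest_apply {c : ℤ × ℤ → ℂ} (hc : RapidCoeff c) (x : ℝ × ℝ) :
    (reTest c hc).toFun x = (series c x).re := rfl

theorem D₁_reTest {c : ℤ × ℤ → ℂ} (hc : RapidCoeff c) :
    TorusTest.D₁ (reTest c hc) = reTest _ hc.mult₁ := by
  refine TorusTest.ext fun x => ?_
  have h : HasFDerivAt (reTest c hc).toFun _ x := Complex.reCLM.hasFDerivAt.comp x (hc.hasFDerivAt_series x)
  rw [TorusTest.coe_D₁, partial₁_eq_fderiv h.differentiableAt, h.fderiv]
  simp [coordC₁_apply, coordC₂_apply, reTest_apply]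

theorem D₂_reTest {c : ℤ × ℤ → ℂ} (hc : RapidCoeff c) :
    TorusTest.D₂ (reTest c hc) = reTest _ hc.mult₂ := by
  refine TorusTest.ext fun x => ?_
  have h : HasFDerivAt (reTest c hc).toFun _ x := Complex.reCLM.hasFDerivAt.comp x (hc.hasFDerivAt_series x)
  rw [TorusTest.coe_D₂, partial₂_eq_fderiv h.differentiableAt, h.fderiv]
  simp [coordC₁_apply, coordC₂_apply, reTest_apply]

theorem contDiff_char (k : ℤ × ℤ) : ContDiff ℝ ∞ (char k) := by
  have : char k = fun x => Complex.exp (mult₁ k * coordC₁ x) * Complex.exp (mult₂ k * coordC₂ x) := rfl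
  rw [this]
  exact ((contDiff_const.mul coordC₁.contDiff).cexp).mul ((contDiff_const.mul coordC₂.contDiff).cexp)

@[fun_prop]
theorem continuous_char (k : ℤ × ℤ) : Continuous (char k) := (contDiff_char k).continuous

/-- The test function `Re (a e_k)`. -/
noncomputable def reChar (a : ℂ) (k : ℤ × ℤ) : TorusTest :=
  TorusTest.mk (fun x => (a * char k x).re)
    ⟨Complex.reCLM.contDiff.comp (contDiff_const.mul (contDiff_char k)), fun x => by
      simp only [(char_add_one _ x).1, (char_add_one _ x).2, and_self]⟩

theorem reChar_apply (a : ℂ) (k : ℤ × ℤ) (x : ℝ × ℝ) :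
    (reChar a k).toFun x = (a * char k x).re := rfl

theorem D₁_reChar (a : ℂ) (k : ℤ × ℤ) : TorusTest.D₁ (reChar a k) = reChar (mult₁ k * a) k := by
  refine TorusTest.ext fun x => ?_
  have h : HasFDerivAt (reChar a k).toFun _ x :=
    Complex.reCLM.hasFDerivAt.comp x ((hasFDerivAt_char k x).const_mul a)
  rw [TorusTest.coe_D₁, partial₁_eq_fderiv h.differentiableAt, h.fderiv, reChar_apply]
  simp only [ContinuousLinearMap.comp_apply, add_apply,
    smul_apply, coordC₁_apply, coordC₂_apply, Complex.reCLM_apply]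
  congr 1
  simp
  ring

theorem D₂_reChar (a : ℂ) (k : ℤ × ℤ) : TorusTest.D₂ (reChar a k) = reChar (mult₂ k * a) k := by
  refine TorusTest.ext fun x => ?_
  have h : HasFDerivAt (reChar a k).toFun _ x :=
    Complex.reCLM.hasFDerivAt.comp x ((hasFDerivAt_char k x).const_mul a)
  rw [TorusTest.coe_D₂, partial₂_eq_fderiv h.differentiableAt, h.fderiv, reChar_apply]
  simp only [ContinuousLinearMap.comp_apply, add_apply,
    smul_apply, coordC₁_apply, coordC₂_apply, Complex.reCLM_apply]
  congr 1
  simp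
  ring

theorem iterate_D_sum_reChar (s : Finset (ℤ × ℤ)) (c : ℤ × ℤ → ℂ) (j l : ℕ) :
    TorusTest.D₁^[j] (TorusTest.D₂^[l] (∑ k ∈ s, reChar (c k) k)) =
      ∑ k ∈ s, reChar (mult₁ k ^ j * (mult₂ k ^ l * c k)) k := by
  have h2 : ∀ (l : ℕ) (c : ℤ × ℤ → ℂ), TorusTest.D₂^[l] (∑ k ∈ s, reChar (c k) k) =
      ∑ k ∈ s, reChar (mult₂ k ^ l * c k) k := by
    intro l
    induction l with
    | zero => intro c; simp
    | succ l ih =>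
      intro c
      rw [Function.iterate_succ_apply, map_sum]
      simp only [D₂_reChar]
      rw [ih]
      simp only [pow_succ, mul_assoc]
  have h1 : ∀ (j : ℕ) (c : ℤ × ℤ → ℂ), TorusTest.D₁^[j] (∑ k ∈ s, reChar (c k) k) =
      ∑ k ∈ s, reChar (mult₁ k ^ j * c k) k := by
    intro j
    induction j with
    | zero => intro c; simp
    | succ j ih =>
      intro c
      rw [Function.iterate_succ_apply, map_sum]
      simp only [D₁_reChar]
      rw [ih]
      simp only [pow_succ, mul_assoc]
  rw [h2, h1]

theorem iterate_D_reTest {c : ℤ × ℤ → ℂ} (hc : RapidCoeff c) (j l : ℕ) :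
    ∃ h : RapidCoeff fun k => mult₁ k ^ j * (mult₂ k ^ l * c k),
      TorusTest.D₁^[j] (TorusTest.D₂^[l] (reTest c hc)) = reTest _ h := by
  have h2 : ∀ (l : ℕ) (c : ℤ × ℤ → ℂ) (hc : RapidCoeff c), ∃ h : RapidCoeff fun k => mult₂ k ^ l * c k,
      TorusTest.D₂^[l] (reTest c hc) = reTest _ h := by
    intro l
    induction l with
    | zero => intro c hc; simp [hc]
    | succ l ih =>
      intro c hc
      obtain ⟨h, e⟩ := ih _ hc.mult₂
      simp only [pow_succ, mul_assoc, Function.iterate_succ_apply, D₂_reTest]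
      exact ⟨h, e⟩
  have h1 : ∀ (j : ℕ) (c : ℤ × ℤ → ℂ) (hc : RapidCoeff c), ∃ h : RapidCoeff fun k => mult₁ k ^ j * c k,
      TorusTest.D₁^[j] (reTest c hc) = reTest _ h := by
    intro j
    induction j with
    | zero => intro c hc; simp [hc]
    | succ j ih =>
      intro c hc
      obtain ⟨h, e⟩ := ih _ hc.mult₁
      simp only [pow_succ, mul_assoc, Function.iterate_succ_apply, D₁_reTest]
      exact ⟨h, e⟩
  obtain ⟨h, e⟩ := h2 l c hc
  obtain ⟨h', e'⟩ := h1 j _ h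
  exact ⟨h', by rw [e, e']⟩

/-- Every differentiated series is again a Fourier series with rapidly decreasing coefficients and
so converges uniformly. Convergence therefore holds in the topology of test functions, and a
distribution may be applied term by term. -/
theorem hasSum_reChar {c : ℤ × ℤ → ℂ} (hc : RapidCoeff c) :
    HasSum (fun k => reChar (c k) k) (reTest c hc) := by
  rw [HasSum, SummationFilter.unconditional_filter, TorusTest.tendsto_iff]
  intro j l
  obtain ⟨h, e⟩ := iterate_D_reTest hc j l
  simp only [iterate_D_sum_reChar, e]
  have key := tendstoUniformly_tsum (f := fun k x =>
    ((mult₁ k ^ j * (mult₂ k ^ l * c k)) * char k x).re) h.summable_norm fun k x => by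
      refine (Complex.abs_re_le_norm _).trans ?_
      rw [norm_mul, norm_char, mul_one]
  have e1 : ∀ s : Finset (ℤ × ℤ), (∑ k ∈ s, reChar (mult₁ k ^ j * (mult₂ k ^ l * c k)) k).toFun =
      fun x => ∑ k ∈ s, ((mult₁ k ^ j * (mult₂ k ^ l * c k)) * char k x).re := fun s =>
    funext fun x => TorusTest.sum_apply _ _ _
  have e2 : (reTest _ h).toFun = fun x => ∑' k, ((mult₁ k ^ j * (mult₂ k ^ l * c k)) * char k x).re :=
    funext fun x => Complex.re_tsum (summable_series h.summable_norm x)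
  simp only [e1, e2]
  exact key

/-! ### Fourier coefficients of periodic distributions -/

/-- The Fourier coefficient `f(e_{-k})`. -/
noncomputable def coef (f : PeriodicDistribution) (k : ℤ × ℤ) : ℂ :=
  (f (reChar 1 k) : ℂ) - Complex.I * (f (reChar (-Complex.I) k) : ℂ)

/-- Distributions are only real-linear on real test functions. The complex number `coef f k`
packages the values of `f` on the cosine and the sine of frequency `k`, and these two span every
`reChar a k`. -/
theorem apply_reChar (f : PeriodicDistribution) (a : ℂ) (k : ℤ × ℤ) :
    f (reChar a k) = (conj a * coef f k).re := by
  have e : reChar a k = a.re • reChar 1 k + (-a.im) • reChar (-Complex.I) k := by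
    refine TorusTest.ext fun x => ?_
    simp only [TorusTest.coe_add, TorusTest.coe_smul, reChar_apply, Pi.add_apply, Pi.smul_apply,
      smul_eq_mul]
    simp
    ring
  rw [e, map_add, map_smul, map_smul]
  simp [coef]
  ring

theorem reChar_neg (a : ℂ) (k : ℤ × ℤ) : reChar a (-k) = reChar (conj a) k := by
  refine TorusTest.ext fun x => ?_
  rw [reChar_apply, reChar_apply, ← conj_char, ← Complex.conj_re, map_mul, Complex.conj_conj]

theorem reChar_smul (r : ℝ) (a : ℂ) (k : ℤ × ℤ) : reChar (r * a) k = r • reChar a k := by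
  refine TorusTest.ext fun x => ?_
  rw [TorusTest.coe_smul, Pi.smul_apply, reChar_apply, reChar_apply, mul_assoc, Complex.re_ofReal_mul]
  rfl

theorem coef_neg (f : PeriodicDistribution) (k : ℤ × ℤ) : coef f (-k) = conj (coef f k) := by
  have h : reChar (Complex.I) k = (-1 : ℝ) • reChar (-Complex.I) k := by
    rw [← reChar_smul]; simp
  simp [coef, reChar_neg, h]

theorem heatSymbol_neg (T : ℝ) (k : ℤ × ℤ) : heatSymbol T (-k) = heatSymbol T k := by
  simp [heatSymbol]

theorem rapidCoeff_heatSymbol {T : ℝ} (hT : 0 < T) {a : ℤ × ℤ → ℂ} (ha : ∀ k, ‖a k‖ ≤ 1) :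
    RapidCoeff fun k => (heatSymbol T k : ℂ) * a k := by
  intro n
  refine (summable_pow_mul_heatSymbol hT n).of_nonneg_of_le (fun k => by positivity) fun k => ?_
  rw [norm_mul, Complex.norm_real, Real.norm_of_nonneg (heatSymbol_pos T k).le]
  have := (heatSymbol_pos T k).le
  gcongr
  exact mul_le_of_le_one_right this (ha k)

/-- No growth bound on the coefficients is needed: `f` maps the convergent cosine and sine series of
test functions to summable real series, and real summability over an index set is absolute. -/
theorem summable_heatSymbol_mul_coef {T : ℝ} (hT : 0 < T) (f : PeriodicDistribution) :
    Summable fun k => ‖(heatSymbol T k : ℂ) * coef f k‖ := by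
  have h1 := ((hasSum_reChar (rapidCoeff_heatSymbol hT (a := fun _ => 1) (by simp))).mapL f).summable
  have h2 := ((hasSum_reChar (rapidCoeff_heatSymbol hT (a := fun _ => -Complex.I) (by simp))).mapL
    f).summable
  refine (h1.abs.add h2.abs).of_nonneg_of_le (fun k => norm_nonneg _) fun k => ?_
  rw [reChar_smul, reChar_smul, map_smul, map_smul, smul_eq_mul, smul_eq_mul, abs_mul, abs_mul,
    ← mul_add, norm_mul, Complex.norm_real, Real.norm_eq_abs]
  gcongr
  refine (norm_sub_le _ _).trans ?_
  simp

/-- Poisson summation expresses the periodized kernel as a Fourier series converging in the space of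
test functions, to which `f` is applied termwise. -/
theorem conv_heatKernel {T : ℝ} (hT : 0 < T) (f : PeriodicDistribution) (x : ℝ × ℝ) :
    (conv (heatKernel T) f x : ℂ) = ∑' k, (heatSymbol T k : ℂ) * coef f k * char k x := by
  have hr : RapidCoeff fun k => (heatSymbol T k : ℂ) * conj (char k x) :=
    rapidCoeff_heatSymbol hT fun k => by rw [Complex.norm_conj, norm_char]
  have hp : (periodize fun y => heatKernel T (x.1 - y.1, x.2 - y.2)) = (reTest _ hr).toFun := by
    funext y
    have h := tsum_heatKernel hT (x.1 - y.1, x.2 - y.2)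
    have e : periodize (fun y => heatKernel T (x.1 - y.1, x.2 - y.2)) y =
        ∑' z : ℤ × ℤ, heatKernel T (x.1 - y.1 + z.1, x.2 - y.2 + z.2) := by
      refine tsum_congr fun z => ?_
      simp only
      congr 2 <;> ring
    rw [e, reTest_apply, ← Complex.ofReal_re (∑' z : ℤ × ℤ, _), h, ← Complex.conj_re, Complex.conj_tsum]
    congr 1
    refine tsum_congr fun k => ?_
    rw [char_sub]
    simp only [map_mul, Complex.conj_conj, Complex.conj_ofReal]
    ring
  have hs : Summable fun k => (heatSymbol T k : ℂ) * coef f k * char k x :=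
    summable_series (summable_heatSymbol_mul_coef hT f) x
  have hre : conv (heatKernel T) f x = (∑' k, (heatSymbol T k : ℂ) * coef f k * char k x).re := by
    rw [conv, hp, evalAt_coe, Complex.re_tsum hs]
    rw [← ((hasSum_reChar hr).mapL f).tsum_eq]
    refine tsum_congr fun k => ?_
    rw [apply_reChar]
    simp only [map_mul, Complex.conj_conj, Complex.conj_ofReal]
    congr 1
    ring
  rw [hre]
  -- Only the real part has been identified so far. The series is real because `k ↦ -k` conjugates
  -- its terms.
  refine Complex.conj_eq_iff_re.1 ?_
  rw [Complex.conj_tsum, ← (Equiv.neg (ℤ × ℤ)).tsum_eq]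
  refine tsum_congr fun k => ?_
  simp only [Equiv.neg_apply, map_mul, Complex.conj_ofReal, heatSymbol_neg, coef_neg,
    Complex.conj_conj, conj_char, neg_neg]

end AnisotropicHolder

namespace AnisotropicHolder

open MeasureTheory Filter Topology
open scoped ContDiff ENNReal ComplexConjugate

/-! ### Compactly supported multipliers -/

/-- `C²` functions supported in `[-8,8]`. -/
structure IsBump (b : ℝ → ℝ) : Prop where
  contDiff : ContDiff ℝ 2 b
  eq_zero : ∀ t, 8 ≤ |t| → b t = 0

theorem IsBump.mul {b : ℝ → ℝ} (hb : IsBump b) {g : ℝ → ℝ} (hg : ContDiff ℝ 2 g) :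
    IsBump fun t => b t * g t :=
  ⟨hb.contDiff.mul hg, fun t ht => by rw [hb.eq_zero t ht, zero_mul]⟩

theorem IsBump.hasCompactSupport {b : ℝ → ℝ} (hb : IsBump b) : HasCompactSupport b := by
  refine HasCompactSupport.intro (isCompact_Icc (a := (-8 : ℝ)) (b := 8)) fun t ht => ?_
  refine hb.eq_zero t ?_
  by_contra h
  exact ht (abs_le.1 (not_le.1 h).le)

/-- The second difference is the increment over `[0,h]` of `u ↦ b(t+u) + b(t-u)`. The derivative of
this function is at most `2hM` there, where `M` bounds the second derivative of `b`. -/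
theorem IsBump.exists_bound {b : ℝ → ℝ} (hb : IsBump b) : ∃ B, 0 ≤ B ∧ (∀ t, |b t| ≤ B) ∧
    ∀ t h, 0 ≤ h → |b (t + h) - 2 * b t + b (t - h)| ≤ B * h ^ 2 := by
  have hc := hb.hasCompactSupport
  have hd1 : ContDiff ℝ 1 (deriv b) := (contDiff_succ_iff_deriv (n := 1).1 hb.contDiff).2.2
  have hd2 : Continuous (deriv (deriv b)) := hd1.continuous_deriv le_rfl
  obtain ⟨B, hB⟩ := hb.contDiff.continuous.bounded_above_of_compact_support hc
  obtain ⟨M, hM⟩ := hd2.bounded_above_of_compact_support hc.deriv.deriv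
  have hB0 : 0 ≤ B := (norm_nonneg _).trans (hB 0)
  have hM0 : 0 ≤ M := (norm_nonneg _).trans (hM 0)
  refine ⟨B + 2 * M, by positivity, fun t => (hB t).trans (by linarith), fun t h hh => ?_⟩
  have hbd : ∀ x, HasDerivAt b (deriv b x) x := fun x =>
    (hb.contDiff.differentiable (by norm_num) x).hasDerivAt
  have lip : ∀ x y, ‖deriv b y - deriv b x‖ ≤ M * ‖y - x‖ := fun x y =>
    convex_univ.norm_image_sub_le_of_norm_deriv_le
      (fun z _ => hd1.differentiable (by norm_num) z) (fun z _ => hM z) trivial trivial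
  have hφ : ∀ u : ℝ, HasDerivAt (fun u => b (t + u) + b (t - u)) (deriv b (t + u) - deriv b (t - u)) u :=
    fun u => by
      have h1 := (hbd (t + u)).comp_const_add t u
      have h2 := (hbd (t - u)).comp_const_sub t u
      rw [sub_eq_add_neg]
      exact h1.add h2
  have key := (convex_Icc (0 : ℝ) h).norm_image_sub_le_of_norm_hasDerivWithin_le
    (fun u _ => (hφ u).hasDerivWithinAt) (C := M * (2 * h)) (fun u hu => by
      refine (lip _ _).trans (mul_le_mul_of_nonneg_left ?_ hM0)
      rw [Real.norm_eq_abs, abs_of_nonneg (by linarith [hu.1])]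
      linarith [hu.2]) (Set.left_mem_Icc.2 hh) (Set.right_mem_Icc.2 hh)
  simp only [add_zero, sub_zero, Real.norm_eq_abs, abs_of_nonneg hh] at key
  calc |b (t + h) - 2 * b t + b (t - h)| = |b (t + h) + b (t - h) - (b t + b t)| := by ring_nf
    _ ≤ M * (2 * h) * h := key
    _ ≤ _ := by nlinarith [mul_nonneg hB0 (sq_nonneg h)]

/-! ### One-dimensional kernels -/

/-- `e^{2πiks}`. -/
noncomputable def char₁ (k : ℤ) (s : ℝ) : ℂ := Complex.exp (2 * Real.pi * Complex.I * k * s)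

theorem norm_char₁ (k : ℤ) (s : ℝ) : ‖char₁ k s‖ = 1 := norm_exp_two_pi k s

theorem char_eq_mul (k : ℤ × ℤ) (x : ℝ × ℝ) : char k x = char₁ k.1 x.1 * char₁ k.2 x.2 := rfl

@[fun_prop]
theorem continuous_char₁ (k : ℤ) : Continuous (char₁ k) := by unfold char₁; fun_prop

theorem char₁_add (k l : ℤ) (s : ℝ) : char₁ (k + l) s = char₁ k s * char₁ l s := by
  rw [char₁, char₁, char₁, ← Complex.exp_add]; congr 1; push_cast; ring

/-- The kernel with Fourier coefficients `b(k/L)`. -/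
noncomputable def kernel₁ (b : ℝ → ℝ) (L : ℕ) (s : ℝ) : ℂ := ∑' k : ℤ, (b (k / L) : ℂ) * char₁ k s

/-- The frequencies at which `b(k/L)` may be nonzero. -/
noncomputable def freq (L : ℕ) : Finset ℤ := Finset.Icc (-(8 * L)) (8 * L)

theorem IsBump.eq_zero_of_notMem {b : ℝ → ℝ} (hb : IsBump b) {L : ℕ} (hL : 0 < L) {k : ℤ}
    (hk : k ∉ freq L) : b (k / L) = 0 := by
  refine hb.eq_zero _ ?_
  have hL' : (0 : ℝ) < L := by exact_mod_cast hL
  rw [abs_div, abs_of_pos hL', le_div_iff₀ hL']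
  rw [freq, Finset.mem_Icc, not_and_or, not_le, not_le] at hk
  have : (8 * L : ℤ) ≤ |k| := by
    rcases hk with h | h
    · have := neg_abs_le k; omega
    · have := le_abs_self k; omega
  exact_mod_cast this

theorem IsBump.kernel₁_eq {b : ℝ → ℝ} (hb : IsBump b) {L : ℕ} (hL : 0 < L) (s : ℝ) :
    kernel₁ b L s = ∑ k ∈ freq L, (b (k / L) : ℂ) * char₁ k s :=
  tsum_eq_sum fun k hk => by rw [hb.eq_zero_of_notMem hL hk]; simp

theorem IsBump.continuous_kernel₁ {b : ℝ → ℝ} (hb : IsBump b) {L : ℕ} (hL : 0 < L) :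
    Continuous (kernel₁ b L) := by
  have : kernel₁ b L = fun s => ∑ k ∈ freq L, (b (k / L) : ℂ) * char₁ k s := funext (hb.kernel₁_eq hL)
  rw [this]; fun_prop

theorem char₁_add_one (k : ℤ) (s : ℝ) : char₁ k (s + 1) = char₁ k s := by
  simp only [char₁]
  rw [Complex.ofReal_add, mul_add, Complex.exp_add, Complex.ofReal_one, mul_one,
    mul_comm (2 * Real.pi * Complex.I : ℂ) k, Complex.exp_int_mul_two_pi_mul_I, mul_one]

theorem kernel₁_periodic (b : ℝ → ℝ) (L : ℕ) : Function.Periodic (kernel₁ b L) 1 := fun s => by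
  simp only [kernel₁, char₁_add_one]

theorem norm_sum_le_card {ι : Type*} {s : Finset ι} {F : ι → ℂ} {B : ℝ} (h : ∀ k ∈ s, ‖F k‖ ≤ B) :
    ‖∑ k ∈ s, F k‖ ≤ s.card * B := by
  refine (norm_sum_le _ _).trans ((Finset.sum_le_card_nsmul _ _ _ h).trans (le_of_eq ?_))
  rw [nsmul_eq_mul]

theorem IsBump.norm_kernel₁_le {b : ℝ → ℝ} (hb : IsBump b) {B : ℝ} (hB0 : 0 ≤ B)
    (hB : ∀ t, |b t| ≤ B) {L : ℕ} (hL : 0 < L) (s : ℝ) : ‖kernel₁ b L s‖ ≤ 17 * B * L := by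
  rw [hb.kernel₁_eq hL]
  refine (norm_sum_le_card (B := B) fun k _ => ?_).trans ?_
  · rw [norm_mul, norm_char₁, mul_one, Complex.norm_real]; exact hB _
  · have h1 : ((freq L).card : ℝ) = 16 * L + 1 := by
      have : (freq L).card = 16 * L + 1 := by rw [freq, Int.card_Icc]; omega
      rw [this]; push_cast; ring
    have h2 : (1 : ℝ) ≤ L := by exact_mod_cast hL
    rw [h1]; nlinarith

theorem IsBump.summable {b : ℝ → ℝ} (hb : IsBump b) {L : ℕ} (hL : 0 < L) (s : ℝ) :
    Summable fun k : ℤ => (b (k / L) : ℂ) * char₁ k s :=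
  summable_of_ne_finset_zero (s := freq L) fun k hk => by
    rw [hb.eq_zero_of_notMem hL hk]; simp

/-- Summation by parts: multiplying by a character shifts the frequency, so multiplying by
`2cos(2πs) - 2` takes a second difference of the coefficients. -/
theorem IsBump.kernel₁_mul {b : ℝ → ℝ} (hb : IsBump b) {L : ℕ} (hL : 0 < L) (s : ℝ) :
    kernel₁ b L s * (char₁ 1 s - 2 + char₁ (-1) s) = ∑' k : ℤ,
      ((b (k / L + 1 / L) - 2 * b (k / L) + b (k / L - 1 / L) : ℝ) : ℂ) * char₁ k s := by
  have hs := hb.summable hL s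
  have h1 : kernel₁ b L s * char₁ 1 s = ∑' k : ℤ, (b (k / L - 1 / L) : ℂ) * char₁ k s := by
    rw [kernel₁, ← tsum_mul_right, ← (Equiv.subRight (1 : ℤ)).tsum_eq]
    refine tsum_congr fun k => ?_
    rw [mul_assoc, ← char₁_add]
    simp [sub_div]
  have h2 : kernel₁ b L s * char₁ (-1) s = ∑' k : ℤ, (b (k / L + 1 / L) : ℂ) * char₁ k s := by
    rw [kernel₁, ← tsum_mul_right, ← (Equiv.addRight (1 : ℤ)).tsum_eq]
    refine tsum_congr fun k => ?_
    rw [mul_assoc, ← char₁_add]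
    simp [add_div]
  have s1 : Summable fun k : ℤ => (b (k / L - 1 / L) : ℂ) * char₁ k s := by
    have := ((Equiv.subRight (1 : ℤ)).summable_iff.2 (hs.mul_right (char₁ 1 s)))
    refine this.congr fun k => ?_
    simp only [Function.comp_apply]
    rw [mul_assoc, ← char₁_add]
    simp [sub_div]
  have s2 : Summable fun k : ℤ => (b (k / L + 1 / L) : ℂ) * char₁ k s := by
    have := ((Equiv.addRight (1 : ℤ)).summable_iff.2 (hs.mul_right (char₁ (-1) s)))
    refine this.congr fun k => ?_
    simp only [Function.comp_apply]
    rw [mul_assoc, ← char₁_add]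
    simp [add_div]
  have e : ∀ k : ℤ, ((b (k / L + 1 / L) - 2 * b (k / L) + b (k / L - 1 / L) : ℝ) : ℂ) * char₁ k s =
      ((b (k / L + 1 / L) : ℂ) * char₁ k s - 2 * ((b (k / L) : ℂ) * char₁ k s)) +
      (b (k / L - 1 / L) : ℂ) * char₁ k s := fun k => by push_cast; ring
  simp only [e]
  rw [(s2.sub (hs.mul_left 2)).tsum_add s1, s2.tsum_sub (hs.mul_left 2), ← h1, ← h2, tsum_mul_left]
  simp only [kernel₁]
  ring

theorem norm_char₁_second_difference (s : ℝ) :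
    ‖char₁ 1 s - 2 + char₁ (-1) s‖ = 4 * Real.sin (Real.pi * s) ^ 2 := by
  have h : char₁ 1 s - 2 + char₁ (-1) s = ((-(4 * Real.sin (Real.pi * s) ^ 2) : ℝ) : ℂ) := by
    have h1 : ∀ θ : ℝ, Complex.exp (θ * Complex.I) + Complex.exp (-(θ * Complex.I)) =
        2 * (Real.cos θ : ℂ) := fun θ => by
      rw [← neg_mul, Complex.exp_mul_I, Complex.exp_mul_I, Complex.cos_neg, Complex.sin_neg,
        Complex.ofReal_cos]
      ring
    have h2 := h1 (2 * Real.pi * s)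
    have e1 : char₁ 1 s = Complex.exp (((2 * Real.pi * s : ℝ) : ℂ) * Complex.I) := by
      rw [char₁]; congr 1; push_cast; ring
    have e2 : char₁ (-1) s = Complex.exp (-(((2 * Real.pi * s : ℝ) : ℂ) * Complex.I)) := by
      rw [char₁]; congr 1; push_cast; ring
    have e3 : Real.cos (2 * Real.pi * s) = 1 - 2 * Real.sin (Real.pi * s) ^ 2 := by
      rw [mul_assoc, Real.cos_two_mul, Real.cos_sq']; ring
    rw [sub_add_eq_add_sub, e1, e2, h2, e3]
    push_cast
    ring
  rw [h, Complex.norm_real, norm_neg, Real.norm_of_nonneg (by positivity)]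

theorem four_mul_sq_le_sin {s : ℝ} (hs : |s| ≤ 1 / 2) : 4 * s ^ 2 ≤ Real.sin (Real.pi * s) ^ 2 := by
  have hpi := Real.pi_pos
  have key : ∀ t : ℝ, 0 ≤ t → t ≤ 1 / 2 → 4 * t ^ 2 ≤ Real.sin (Real.pi * t) ^ 2 := fun t h0 h1 => by
    have h := Real.mul_le_sin (x := Real.pi * t) (by positivity) (by nlinarith)
    have e : 2 / Real.pi * (Real.pi * t) = 2 * t := by field_simp
    rw [e] at h
    nlinarith
  rcases le_total 0 s with h | h
  · exact key s h ((le_abs_self s).trans hs)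
  · have := key (-s) (by linarith) ((neg_le_abs s).trans hs)
    rwa [neg_sq, mul_neg, Real.sin_neg, neg_sq] at this

theorem IsBump.norm_kernel₁_mul_sq_le {b : ℝ → ℝ} (hb : IsBump b) {B : ℝ} (hB0 : 0 ≤ B)
    (hB : ∀ t h, 0 ≤ h → |b (t + h) - 2 * b t + b (t - h)| ≤ B * h ^ 2) {L : ℕ} (hL : 0 < L) {s : ℝ}
    (hs : |s| ≤ 1 / 2) : ‖kernel₁ b L s‖ * s ^ 2 ≤ 2 * B / L := by
  have hL' : (0 : ℝ) < L := by exact_mod_cast hL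
  have h2 : (1 : ℝ) ≤ L := by exact_mod_cast hL
  have h := congrArg norm (hb.kernel₁_mul hL s)
  rw [norm_mul, norm_char₁_second_difference] at h
  -- The shifts by one enlarge the range of possibly nonzero coefficients by one on either side,
  -- which leaves `16L + 3` frequencies.
  rw [tsum_eq_sum (s := Finset.Icc (-(8 * L + 1) : ℤ) (8 * L + 1)) (fun k hk => ?_)] at h
  · have h3 := norm_sum_le_card (s := Finset.Icc (-(8 * L + 1) : ℤ) (8 * L + 1)) (F := fun k : ℤ =>
      ((b (k / L + 1 / L) - 2 * b (k / L) + b (k / L - 1 / L) : ℝ) : ℂ) * char₁ k s)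
      (B := B * (1 / L) ^ 2) (fun k _ => by
        rw [norm_mul, norm_char₁, mul_one, Complex.norm_real]
        exact hB _ _ (by positivity))
    rw [← h] at h3
    have h1 : ((Finset.Icc (-(8 * L + 1) : ℤ) (8 * L + 1)).card : ℝ) = 16 * L + 3 := by
      have : (Finset.Icc (-(8 * L + 1) : ℤ) (8 * L + 1)).card = 16 * L + 3 := by
        rw [Int.card_Icc]; omega
      rw [this]; push_cast; ring
    rw [h1] at h3
    have h4 := four_mul_sq_le_sin hs
    have h5 := norm_nonneg (kernel₁ b L s)
    have h6 : ‖kernel₁ b L s‖ * (16 * s ^ 2) ≤ (16 * L + 3) * (B * (1 / L) ^ 2) :=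
      le_trans (mul_le_mul_of_nonneg_left (by linarith) h5) h3
    have h7 : (16 * L + 3) * (B * (1 / L) ^ 2) ≤ 32 * (B / L) := by
      have : (16 * L + 3) * (B * (1 / L) ^ 2) = (16 * L + 3) / L * (B / L) := by field_simp
      rw [this]
      refine mul_le_mul_of_nonneg_right ?_ (by positivity)
      rw [div_le_iff₀ hL']; linarith
    have h8 : 2 * B / L = 2 * (B / L) := by ring
    rw [h8]
    linarith
  · have hz : ∀ j : ℤ, j ∉ freq L → b (j / L) = 0 := fun j hj => hb.eq_zero_of_notMem hL hj
    rw [Finset.mem_Icc, not_and_or] at hk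
    have z0 := hz k (by rw [freq, Finset.mem_Icc]; omega)
    have z1 := hz (k + 1) (by rw [freq, Finset.mem_Icc]; omega)
    have z2 := hz (k - 1) (by rw [freq, Finset.mem_Icc]; omega)
    push_cast at z1 z2
    rw [add_div] at z1
    rw [sub_div] at z2
    rw [z0, z1, z2]; simp

/-- The trivial bound of order `L` controls small `s`, the second difference gives decay like `1/(L
s²)`. Together they yield a profile whose integral does not depend on `L`; the constant is `17 + 2`.
-/
theorem IsBump.exists_kernel₁_bound {b : ℝ → ℝ} (hb : IsBump b) : ∃ C, 0 ≤ C ∧ ∀ L : ℕ, 0 < L →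
    ∀ s : ℝ, |s| ≤ 1 / 2 → ‖kernel₁ b L s‖ ≤ C * (L * (1 + (L * s) ^ 2)⁻¹) := by
  obtain ⟨B, hB0, hB, hB2⟩ := hb.exists_bound
  refine ⟨19 * B, by positivity, fun L hL s hs => ?_⟩
  have hL' : (0 : ℝ) < L := by exact_mod_cast hL
  have h1 := hb.norm_kernel₁_le hB0 hB hL s
  have h2 := hb.norm_kernel₁_mul_sq_le hB0 hB2 hL hs
  rw [le_div_iff₀ hL'] at h2
  rw [← mul_assoc, ← div_eq_mul_inv, le_div_iff₀ (by positivity)]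
  have : ‖kernel₁ b L s‖ * (1 + (L * s) ^ 2) = ‖kernel₁ b L s‖ + ‖kernel₁ b L s‖ * s ^ 2 * L * L := by
    ring
  rw [this]
  nlinarith

theorem integrable_scaled_inv {L : ℕ} (hL : 0 < L) :
    Integrable fun s : ℝ => (L : ℝ) * (1 + (L * s) ^ 2)⁻¹ :=
  (integrable_inv_one_add_sq.comp_mul_left' (R := (L : ℝ)) (by positivity)).const_mul _

theorem integral_scaled_inv {L : ℕ} (hL : 0 < L) :
    ∫ s : ℝ, (L : ℝ) * (1 + (L * s) ^ 2)⁻¹ = Real.pi := by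
  have hL' : (0 : ℝ) < L := by exact_mod_cast hL
  rw [integral_const_mul, Measure.integral_comp_mul_left (fun s : ℝ => (1 + s ^ 2)⁻¹),
    integral_univ_inv_one_add_sq, abs_of_pos (inv_pos.2 hL'), smul_eq_mul,
    mul_inv_cancel_left₀ hL'.ne']

theorem intervalIntegral_scaled_inv_le {L : ℕ} (hL : 0 < L) :
    ∫ s in (-(1 / 2) : ℝ)..(1 / 2), (L : ℝ) * (1 + (L * s) ^ 2)⁻¹ ≤ Real.pi := by
  rw [intervalIntegral.integral_of_le (by norm_num), ← integral_scaled_inv hL]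
  exact setIntegral_le_integral (integrable_scaled_inv hL) (ae_of_all _ fun s => by
    simp only [Pi.zero_apply]; positivity)

theorem IsBump.exists_integral_norm_bound {b : ℝ → ℝ} (hb : IsBump b) : ∃ C, 0 ≤ C ∧
    ∀ L : ℕ, 0 < L → ∀ x : ℝ, ∫ s in (0 : ℝ)..1, ‖kernel₁ b L (x - s)‖ ≤ C := by
  obtain ⟨C, hC0, hC⟩ := hb.exists_kernel₁_bound
  refine ⟨C * Real.pi, by have := Real.pi_pos; positivity, fun L hL x => ?_⟩
  have hc := hb.continuous_kernel₁ hL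
  have hper : Function.Periodic (fun s => ‖kernel₁ b L s‖) 1 := fun s => by
    simp only [kernel₁_periodic b L s]
  rw [intervalIntegral.integral_comp_sub_left (fun s => ‖kernel₁ b L s‖) x]
  have h1 := hper.intervalIntegral_add_eq (x - 1) (-(1 / 2))
  rw [sub_add_cancel, show (-(1 / 2) + 1 : ℝ) = 1 / 2 by norm_num] at h1
  rw [sub_zero, h1]
  refine le_trans (intervalIntegral.integral_mono_on (by norm_num)
    (hc.norm.intervalIntegrable _ _) (((integrable_scaled_inv hL).const_mul C).intervalIntegrable)
    fun s hs => hC L hL s (abs_le.2 ⟨by linarith [hs.1], hs.2⟩)) ?_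
  rw [intervalIntegral.integral_const_mul]
  exact mul_le_mul_of_nonneg_left (intervalIntegral_scaled_inv_le hL) hC0

end AnisotropicHolder

namespace AnisotropicHolder

open MeasureTheory Filter Topology
open scoped ContDiff ENNReal ComplexConjugate

/-! ### Frequency blocks of periodic distributions -/

theorem continuous_conv_heatKernel {T : ℝ} (hT : 0 < T) (f : PeriodicDistribution) :
    Continuous (conv (heatKernel T) f) := by
  have h : Continuous fun x => (conv (heatKernel T) f x : ℂ) := by
    simp only [conv_heatKernel hT]
    exact continuous_tsum (fun k => by fun_prop) (summable_heatSymbol_mul_coef hT f) fun k x => by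
      rw [norm_mul, norm_char, mul_one]
  exact Complex.continuous_re.comp h

theorem integral_char₁ (k : ℤ) : ∫ s in Set.Ico (0 : ℝ) 1, char₁ k s = if k = 0 then 1 else 0 := by
  rw [integral_Ico_eq_integral_Ioc, ← intervalIntegral.integral_of_le zero_le_one]
  split_ifs with h
  · simp [char₁, h]
  · have hc : (2 * Real.pi * Complex.I * k : ℂ) ≠ 0 := by
      simp [Real.pi_ne_zero, h]
    simp only [char₁]
    rw [integral_exp_mul_complex hc]
    rw [Complex.ofReal_one, Complex.ofReal_zero, mul_one, mul_zero, Complex.exp_zero,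
      mul_comm (2 * Real.pi * Complex.I : ℂ) k, Complex.exp_int_mul_two_pi_mul_I, sub_self, zero_div]

theorem integral_cell_char (k : ℤ × ℤ) : ∫ y in cell, char k y = if k = 0 then 1 else 0 := by
  simp only [char_eq_mul]
  rw [cell, Measure.volume_eq_prod, setIntegral_prod_mul (f := char₁ k.1) (g := char₁ k.2),
    integral_char₁, integral_char₁]
  by_cases h1 : k.1 = 0 <;> by_cases h2 : k.2 = 0 <;> simp [h1, h2, Prod.ext_iff]

theorem char_mul_conj_char (k l : ℤ × ℤ) (y : ℝ × ℝ) :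
    char l y * conj (char k y) = char (l - k) y := by
  rw [conj_char, char_eq_mul, char_eq_mul, char_eq_mul, sub_eq_add_neg, Prod.fst_add, Prod.snd_add,
    char₁_add, char₁_add]
  ring

theorem integral_conv_heatKernel_mul_conj_char {T : ℝ} (hT : 0 < T) (f : PeriodicDistribution)
    (k : ℤ × ℤ) : ∫ y in cell, (conv (heatKernel T) f y : ℂ) * conj (char k y) =
      heatSymbol T k * coef f k := by
  have hs := summable_heatSymbol_mul_coef hT f
  have hF : ∀ l, ∫ y in cell, ((heatSymbol T l : ℂ) * coef f l * char l y) * conj (char k y) =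
      if l = k then (heatSymbol T l : ℂ) * coef f l else 0 := fun l => by
    simp only [mul_assoc, char_mul_conj_char]
    rw [integral_const_mul, integral_const_mul, integral_cell_char]
    simp [sub_eq_zero]
  have h := hasSum_integral_of_summable_integral_norm (μ := volume.restrict cell)
    (F := fun l y => ((heatSymbol T l : ℂ) * coef f l * char l y) * conj (char k y)) (fun l => ?_) ?_
  · simp only [hF] at h
    have e : ∀ y, ∑' l, ((heatSymbol T l : ℂ) * coef f l * char l y) * conj (char k y) =
        (conv (heatKernel T) f y : ℂ) * conj (char k y) := fun y => by
      rw [tsum_mul_right, conv_heatKernel hT]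
    simp only [e] at h
    rw [← h.tsum_eq, tsum_ite_eq]
  · have hc : Continuous fun y => ((heatSymbol T l : ℂ) * coef f l * char l y) * conj (char k y) := by
      simp only [conj_char]; fun_prop
    exact (hc.continuousOn.integrableOn_compact ((isCompact_Icc).prod isCompact_Icc)).mono_set
      cell_subset
  · refine hs.congr fun l => ?_
    simp only [norm_mul, norm_char, Complex.norm_conj, mul_one]
    simp

/-- The frequency block `∑ b₁(k₁/L₁) b₂(k₂/L₂) a_k e_k`. -/
noncomputable def block (a : ℤ × ℤ → ℂ) (L₁ L₂ : ℕ) (b₁ b₂ : ℝ → ℝ) (x : ℝ × ℝ) : ℂ :=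
  ∑' k : ℤ × ℤ, ((b₁ (k.1 / L₁) * b₂ (k.2 / L₂) : ℝ) : ℂ) * a k * char k x

/-- The frequencies of a block. -/
noncomputable def box (L₁ L₂ : ℕ) : Finset (ℤ × ℤ) := freq L₁ ×ˢ freq L₂

theorem bump_mul_eq_zero {b₁ b₂ : ℝ → ℝ} (h₁ : IsBump b₁) (h₂ : IsBump b₂) {L₁ L₂ : ℕ}
    (hL₁ : 0 < L₁) (hL₂ : 0 < L₂) {k : ℤ × ℤ} (hk : k ∉ box L₁ L₂) :
    b₁ (k.1 / L₁) * b₂ (k.2 / L₂) = 0 := by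
  rw [box, Finset.mem_product, not_and_or] at hk
  rcases hk with hk | hk
  · rw [h₁.eq_zero_of_notMem hL₁ hk, zero_mul]
  · rw [h₂.eq_zero_of_notMem hL₂ hk, mul_zero]

theorem block_eq_sum {b₁ b₂ : ℝ → ℝ} (h₁ : IsBump b₁) (h₂ : IsBump b₂) {L₁ L₂ : ℕ} (hL₁ : 0 < L₁)
    (hL₂ : 0 < L₂) (a : ℤ × ℤ → ℂ) (x : ℝ × ℝ) : block a L₁ L₂ b₁ b₂ x =
      ∑ k ∈ box L₁ L₂, ((b₁ (k.1 / L₁) * b₂ (k.2 / L₂) : ℝ) : ℂ) * a k * char k x :=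
  tsum_eq_sum fun k hk => by rw [bump_mul_eq_zero h₁ h₂ hL₁ hL₂ hk]; simp

theorem integrableOn_cell_complex {g : ℝ × ℝ → ℂ} (hc : Continuous g) : IntegrableOn g cell :=
  (hc.continuousOn.integrableOn_compact ((isCompact_Icc).prod isCompact_Icc)).mono_set cell_subset

theorem sum_box_char_sub {b₁ b₂ : ℝ → ℝ} (h₁ : IsBump b₁) (h₂ : IsBump b₂) {L₁ L₂ : ℕ} (hL₁ : 0 < L₁)
    (hL₂ : 0 < L₂) (x y : ℝ × ℝ) :
    ∑ k ∈ box L₁ L₂, ((b₁ (k.1 / L₁) * b₂ (k.2 / L₂) : ℝ) : ℂ) * (char k x * conj (char k y)) =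
      kernel₁ b₁ L₁ (x.1 - y.1) * kernel₁ b₂ L₂ (x.2 - y.2) := by
  rw [h₁.kernel₁_eq hL₁, h₂.kernel₁_eq hL₂, Finset.sum_mul_sum, box, Finset.sum_product]
  refine Finset.sum_congr rfl fun i _ => Finset.sum_congr rfl fun j _ => ?_
  rw [← char_sub, char_eq_mul]
  push_cast
  ring

theorem integral_cell_norm_kernel_le {b₁ b₂ : ℝ → ℝ} {L₁ L₂ : ℕ} {C₁ C₂ : ℝ} (hC₁ : 0 ≤ C₁)
    (h₁ : Continuous (kernel₁ b₁ L₁)) (h₂ : Continuous (kernel₁ b₂ L₂)) (x : ℝ × ℝ)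
    (i₁ : ∫ s in (0 : ℝ)..1, ‖kernel₁ b₁ L₁ (x.1 - s)‖ ≤ C₁)
    (i₂ : ∫ s in (0 : ℝ)..1, ‖kernel₁ b₂ L₂ (x.2 - s)‖ ≤ C₂) :
    ∫ y in cell, ‖kernel₁ b₁ L₁ (x.1 - y.1)‖ * ‖kernel₁ b₂ L₂ (x.2 - y.2)‖ ≤ C₁ * C₂ := by
  rw [setIntegral_cell (by fun_prop)]
  simp only [intervalIntegral.integral_const_mul, intervalIntegral.integral_mul_const]
  exact mul_le_mul i₁ i₂ (intervalIntegral.integral_nonneg zero_le_one fun _ _ => norm_nonneg _) hC₁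

/-- The multiplier acts on `f_T` as convolution with a product of one-dimensional kernels, whose
`L¹` norms are bounded uniformly in `L₁` and `L₂`; Young's inequality concludes. -/
theorem exists_block_heat_bound {b₁ b₂ : ℝ → ℝ} (h₁ : IsBump b₁) (h₂ : IsBump b₂) :
    ∃ C, 0 ≤ C ∧ ∀ (f : PeriodicDistribution) (T M : ℝ), 0 < T →
      (∀ x, |conv (heatKernel T) f x| ≤ M) → ∀ L₁ L₂ : ℕ, 0 < L₁ → 0 < L₂ → ∀ x,
        ‖block (fun k => heatSymbol T k * coef f k) L₁ L₂ b₁ b₂ x‖ ≤ C * M := by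
  obtain ⟨C₁, hC₁, i₁⟩ := h₁.exists_integral_norm_bound
  obtain ⟨C₂, hC₂, i₂⟩ := h₂.exists_integral_norm_bound
  refine ⟨C₁ * C₂, by positivity, fun f T M hT hM L₁ L₂ hL₁ hL₂ x => ?_⟩
  have hM0 : 0 ≤ M := (abs_nonneg _).trans (hM 0)
  have hf := continuous_conv_heatKernel hT f
  have k₁ := h₁.continuous_kernel₁ hL₁
  have k₂ := h₂.continuous_kernel₁ hL₂
  have e : block (fun k => heatSymbol T k * coef f k) L₁ L₂ b₁ b₂ x = ∫ y in cell,
      kernel₁ b₁ L₁ (x.1 - y.1) * kernel₁ b₂ L₂ (x.2 - y.2) * (conv (heatKernel T) f y : ℂ) := by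
    simp only [← sum_box_char_sub h₁ h₂ hL₁ hL₂ x, Finset.sum_mul]
    rw [integral_finsetSum _ fun k _ => integrableOn_cell_complex (by
      simp only [conj_char]; fun_prop), block_eq_sum h₁ h₂ hL₁ hL₂]
    refine Finset.sum_congr rfl fun k _ => ?_
    rw [← integral_conv_heatKernel_mul_conj_char hT, ← integral_const_mul, ← integral_mul_const]
    refine integral_congr_ae (ae_of_all _ fun y => ?_)
    simp only; ring
  rw [e]
  have hi : IntegrableOn (fun y : ℝ × ℝ =>
      (‖kernel₁ b₁ L₁ (x.1 - y.1)‖ * ‖kernel₁ b₂ L₂ (x.2 - y.2)‖) * M) cell :=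
    integrableOn_cell (by fun_prop)
  refine (norm_integral_le_of_norm_le hi (ae_of_all _ fun y => ?_)).trans ?_
  · rw [norm_mul, norm_mul, Complex.norm_real]
    gcongr
    exact hM y
  · rw [integral_mul_const]
    exact mul_le_mul_of_nonneg_right (integral_cell_norm_kernel_le hC₁ k₁ k₂ x (i₁ L₁ hL₁ x.1)
      (i₂ L₂ hL₂ x.2)) hM0

/-! ### Inverting the heat symbol at dyadic scales -/

theorem hasDerivAt_mul_abs (t : ℝ) : HasDerivAt (fun t : ℝ => t * |t|) (2 * |t|) t := by
  rcases eq_or_ne t 0 with rfl | ht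
  · rw [hasDerivAt_iff_tendsto_slope_zero]
    have h : Tendsto (fun h : ℝ => |h|) (𝓝[≠] 0) (𝓝 (2 * |(0 : ℝ)|)) := by
      simpa using (continuous_abs.tendsto (0 : ℝ)).mono_left nhdsWithin_le_nhds
    refine h.congr' ?_
    filter_upwards [self_mem_nhdsWithin] with h hh
    have : h ≠ 0 := hh
    simp [this]
  · refine ((hasDerivAt_id t).mul (hasDerivAt_abs ht)).congr_deriv ?_
    rcases lt_or_gt_of_ne ht with h | h
    · simp [sign_neg h, abs_of_neg h]; ring
    · simp [sign_pos h, abs_of_pos h]; ring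

theorem contDiff_mul_abs : ContDiff ℝ 1 fun t : ℝ => t * |t| := by
  rw [contDiff_one_iff_deriv]
  refine ⟨fun t => (hasDerivAt_mul_abs t).differentiableAt, ?_⟩
  have : deriv (fun t : ℝ => t * |t|) = fun t => 2 * |t| := funext fun t => (hasDerivAt_mul_abs t).deriv
  rw [this]; fun_prop

theorem hasDerivAt_abs_pow_three (t : ℝ) : HasDerivAt (fun t : ℝ => |t| ^ 3) (3 * (t * |t|)) t := by
  have e : (fun t : ℝ => |t| ^ 3) = fun t => t * (t * |t|) := by
    funext t; rw [pow_succ, sq_abs]; ring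
  rw [e]
  refine ((hasDerivAt_id t).mul (hasDerivAt_mul_abs t)).congr_deriv ?_
  simp; ring

/-- Although `|t|³` is not smooth, two continuous derivatives are all that the second-difference
estimate for kernels consumes. -/
theorem contDiff_abs_pow_three : ContDiff ℝ 2 fun t : ℝ => |t| ^ 3 := by
  rw [show (2 : ℕ∞ω) = 1 + 1 from rfl, contDiff_succ_iff_deriv]
  refine ⟨fun t => (hasDerivAt_abs_pow_three t).differentiableAt, by simp, ?_⟩
  have : deriv (fun t : ℝ => |t| ^ 3) = fun t => 3 * (t * |t|) :=
    funext fun t => (hasDerivAt_abs_pow_three t).deriv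
  rw [this]
  exact contDiff_const.mul contDiff_mul_abs

theorem contDiff_exp_abs_pow_three : ContDiff ℝ 2 fun t : ℝ => Real.exp (|2 * Real.pi * t| ^ 3) :=
  (contDiff_abs_pow_three.comp (contDiff_const.mul contDiff_id)).exp

theorem contDiff_exp_abs_sq : ContDiff ℝ 2 fun t : ℝ => Real.exp (|2 * Real.pi * t| ^ 2) := by
  simp only [sq_abs]; fun_prop

theorem heatSymbol_level (n : ℕ) (k : ℤ × ℤ) : heatSymbol ((64 : ℝ) ^ n)⁻¹ k =
    (Real.exp (|2 * Real.pi * (k.1 / (4 ^ n : ℕ))| ^ 3))⁻¹ *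
      (Real.exp (|2 * Real.pi * (k.2 / (8 ^ n : ℕ))| ^ 2))⁻¹ := by
  have h1 : |2 * Real.pi * (k.1 / (4 ^ n : ℕ))| ^ 3 = ((64 : ℝ) ^ n)⁻¹ * |2 * Real.pi * k.1| ^ 3 := by
    rw [← mul_div_assoc, abs_div, div_pow, div_eq_inv_mul]
    push_cast
    rw [abs_of_pos (by positivity : (0 : ℝ) < 4 ^ n), ← pow_mul, mul_comm n 3, pow_mul]
    norm_num
  have h2 : |2 * Real.pi * (k.2 / (8 ^ n : ℕ))| ^ 2 = ((64 : ℝ) ^ n)⁻¹ * |2 * Real.pi * k.2| ^ 2 := by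
    rw [← mul_div_assoc, abs_div, div_pow, div_eq_inv_mul]
    push_cast
    rw [abs_of_pos (by positivity : (0 : ℝ) < 8 ^ n), ← pow_mul, mul_comm n 2, pow_mul]
    norm_num
  rw [h1, h2, ← Real.exp_neg, ← Real.exp_neg, heatSymbol]
  ring_nf

/-- The bound `‖f_T‖ ≤ N (T^{1/3})^β` for `T ∈ (0,1]`. -/
def HeatBound (β N : ℝ) (f : PeriodicDistribution) : Prop :=
  ∀ T ∈ Set.Ioc (0 : ℝ) 1, ∀ x, |conv (heatKernel T) f x| ≤ N * (T ^ (1 / 3 : ℝ)) ^ β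

/-- At `T = 64^{-n}` one has `T^{1/3} = 4^{-n}` and `T^{1/2} = 8^{-n}`, so the symbol is a function
of `k₁/4ⁿ` and `k₂/8ⁿ` alone. The inverse symbol is absorbed into the bumps, which remain bumps
independent of `n`; a block of `f` thus becomes a block of `f_T`. -/
theorem exists_block_bound {b₁ b₂ : ℝ → ℝ} (h₁ : IsBump b₁) (h₂ : IsBump b₂) (β : ℝ) :
    ∃ C, 0 ≤ C ∧ ∀ (f : PeriodicDistribution) (N : ℝ), HeatBound β N f → ∀ (n : ℕ) x,
      ‖block (coef f) (4 ^ n) (8 ^ n) b₁ b₂ x‖ ≤ C * N * ((4 : ℝ) ^ n) ^ (-β) := by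
  obtain ⟨C, hC0, hC⟩ := exists_block_heat_bound (h₁.mul contDiff_exp_abs_pow_three)
    (h₂.mul contDiff_exp_abs_sq)
  refine ⟨C, hC0, fun f N hN n x => ?_⟩
  have hT : ((64 : ℝ) ^ n)⁻¹ ∈ Set.Ioc (0 : ℝ) 1 :=
    ⟨by positivity, inv_le_one_of_one_le₀ (one_le_pow₀ (by norm_num))⟩
  have h := hC f _ _ hT.1 (hN _ hT) (4 ^ n) (8 ^ n) (by positivity) (by positivity) x
  have e1 : ((((64 : ℝ) ^ n)⁻¹) ^ (1 / 3 : ℝ)) ^ β = ((4 : ℝ) ^ n) ^ (-β) := by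
    have : (((64 : ℝ) ^ n)⁻¹) ^ (1 / 3 : ℝ) = ((4 : ℝ) ^ n)⁻¹ := by
      rw [Real.inv_rpow (by positivity), show (64 : ℝ) ^ n = (4 ^ n) ^ (3 : ℝ) by
        rw [show (3 : ℝ) = ((3 : ℕ) : ℝ) by norm_num, Real.rpow_natCast, ← pow_mul, mul_comm n 3,
          pow_mul]; norm_num, ← Real.rpow_mul (by positivity)]
      norm_num
    rw [this, Real.inv_rpow (by positivity), Real.rpow_neg (by positivity)]
  rw [e1, ← mul_assoc] at h
  refine le_trans (le_of_eq ?_) h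
  congr 1
  refine tsum_congr fun k => ?_
  have e2 : ∀ A B u v : ℝ, u * v = (u * Real.exp A) * (v * Real.exp B) *
      ((Real.exp A)⁻¹ * (Real.exp B)⁻¹) := fun A B u v => by
    have := (Real.exp_pos A).ne'
    have := (Real.exp_pos B).ne'
    field_simp
  rw [e2 (|2 * Real.pi * (k.1 / (4 ^ n : ℕ))| ^ 3) (|2 * Real.pi * (k.2 / (8 ^ n : ℕ))| ^ 2),
    ← heatSymbol_level, Complex.ofReal_mul]
  ring

end AnisotropicHolder

namespace AnisotropicHolder

open MeasureTheory Filter Topology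
open scoped ContDiff ENNReal ComplexConjugate

/-! ### Hölder regularity of sums of frequency-localized functions -/

/-- Choose `l` with `4^l ≤ d < 4^{l+1}`. The terms then decay like `r^{|n+l|}` with `r =
4^{-min(p,q)}`, and a two-sided geometric series bounds the sum uniformly in `d`. The factor `4^p`
pays for rounding `d`. -/
theorem exists_sum_min_bound {p q : ℝ} (hp : 0 < p) (hq : 0 < q) : ∃ C, 0 ≤ C ∧ ∀ d : ℝ, 0 < d →
    Summable (fun n : ℕ => min (((4 : ℝ) ^ n * d) ^ p) (((4 : ℝ) ^ n * d) ^ (-q))) ∧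
    ∑' n : ℕ, min (((4 : ℝ) ^ n * d) ^ p) (((4 : ℝ) ^ n * d) ^ (-q)) ≤ C := by
  set m := min p q with hm
  have hm0 : 0 < m := lt_min hp hq
  set r : ℝ := (4 : ℝ) ^ (-m) with hr
  have hr0 : 0 < r := Real.rpow_pos_of_pos (by norm_num) _
  have hr1 : r < 1 := Real.rpow_lt_one_of_one_lt_of_neg (by norm_num) (by linarith)
  have hsum : Summable fun j : ℤ => r ^ j.natAbs := by
    rw [summable_int_iff_summable_nat_and_neg]
    simp only [Int.natAbs_natCast, Int.natAbs_neg, and_self]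
    exact summable_geometric_of_lt_one hr0.le hr1
  refine ⟨4 ^ p * ∑' j : ℤ, r ^ j.natAbs, by positivity, fun d hd => ?_⟩
  obtain ⟨l, hl1, hl2⟩ := exists_mem_Ico_zpow (x := d) (y := (4 : ℝ)) hd (by norm_num)
  have key : ∀ n : ℕ, min (((4 : ℝ) ^ n * d) ^ p) (((4 : ℝ) ^ n * d) ^ (-q)) ≤
      4 ^ p * r ^ ((n : ℤ) + l).natAbs := by
    intro n
    have h4 : (0 : ℝ) < 4 := by norm_num
    have e1 : (4 : ℝ) ^ ((n : ℤ) + l) ≤ 4 ^ n * d := by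
      rw [zpow_add₀ h4.ne', zpow_natCast]; gcongr
    have e2 : (4 : ℝ) ^ n * d ≤ 4 * 4 ^ ((n : ℤ) + l) := by
      rw [zpow_add₀ h4.ne', zpow_natCast]
      rw [zpow_add_one₀ h4.ne'] at hl2
      nlinarith [pow_pos h4 n]
    have hpos : (0 : ℝ) < 4 ^ ((n : ℤ) + l) := zpow_pos h4 _
    have h4p : (1 : ℝ) ≤ 4 ^ p := Real.one_le_rpow (by norm_num) hp.le
    rcases le_total 0 ((n : ℤ) + l) with h | h
    · obtain ⟨i, hi⟩ := Int.eq_ofNat_of_zero_le h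
      rw [hi] at e1 hpos ⊢
      refine (min_le_right _ _).trans ?_
      have : ((4 : ℝ) ^ n * d) ^ (-q) ≤ r ^ i := by
        calc ((4 : ℝ) ^ n * d) ^ (-q) ≤ ((4 : ℝ) ^ (i : ℤ)) ^ (-q) :=
              Real.rpow_le_rpow_of_nonpos hpos e1 (by linarith)
          _ ≤ ((4 : ℝ) ^ (i : ℤ)) ^ (-m) := by
              refine Real.rpow_le_rpow_of_exponent_le ?_ (neg_le_neg (min_le_right _ _))
              rw [zpow_natCast]; exact one_le_pow₀ (by norm_num)
          _ = r ^ i := by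
              rw [zpow_natCast, hr, ← Real.rpow_natCast, ← Real.rpow_mul h4.le, ← Real.rpow_natCast,
                ← Real.rpow_mul h4.le, mul_comm]
      simp only [Int.natAbs_natCast]
      exact this.trans (le_mul_of_one_le_left (by positivity) h4p)
    · obtain ⟨i, hi⟩ := Int.eq_ofNat_of_zero_le (neg_nonneg.2 h)
      have hi' : (n : ℤ) + l = -(i : ℤ) := neg_eq_iff_eq_neg.1 hi
      rw [hi'] at e2 ⊢
      refine (min_le_left _ _).trans ?_
      rw [Int.natAbs_neg, Int.natAbs_natCast]
      calc ((4 : ℝ) ^ n * d) ^ p ≤ (4 * (4 : ℝ) ^ (-(i : ℤ))) ^ p :=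
            Real.rpow_le_rpow (by positivity) e2 hp.le
        _ = 4 ^ p * ((4 : ℝ) ^ (-(i : ℤ))) ^ p := Real.mul_rpow h4.le (by positivity)
        _ ≤ 4 ^ p * ((4 : ℝ) ^ (-(i : ℤ))) ^ m := by
            refine mul_le_mul_of_nonneg_left ?_ (by positivity)
            refine Real.rpow_le_rpow_of_exponent_ge (by positivity) ?_ (min_le_left _ _)
            rw [zpow_neg, zpow_natCast]; exact inv_le_one_of_one_le₀ (one_le_pow₀ (by norm_num))
        _ = 4 ^ p * r ^ i := by
            rw [zpow_neg, zpow_natCast, hr, ← Real.rpow_natCast, ← Real.rpow_neg h4.le,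
              ← Real.rpow_mul h4.le, ← Real.rpow_natCast, ← Real.rpow_mul h4.le]
            ring_nf
  have hinj : Function.Injective fun n : ℕ => (n : ℤ) + l := fun a b h => by simpa using h
  have hs2 : Summable fun n : ℕ => 4 ^ p * r ^ ((n : ℤ) + l).natAbs :=
    (hsum.comp_injective hinj).mul_left _
  have hs1 : Summable (fun n : ℕ => min (((4 : ℝ) ^ n * d) ^ p) (((4 : ℝ) ^ n * d) ^ (-q))) :=
    hs2.of_nonneg_of_le (fun n => le_min (by positivity) (by positivity)) key
  refine ⟨hs1, (hs1.tsum_le_tsum key hs2).trans ?_⟩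
  rw [tsum_mul_left]
  refine mul_le_mul_of_nonneg_left ?_ (by positivity)
  exact tsum_comp_le_tsum_of_inj hsum (fun j => by positivity) hinj

/-! ### Increments and Taylor remainders of dyadic pieces -/

theorem abs_fst_sub_le (x y : ℝ × ℝ) : |y.1 - x.1| ≤ aniDist y x :=
  le_add_of_nonneg_right (Real.rpow_nonneg (abs_nonneg _) _)

theorem abs_snd_sub_le (x y : ℝ × ℝ) : |y.2 - x.2| ≤ aniDist y x ^ (3 / 2 : ℝ) := by
  have h : |y.2 - x.2| ^ (2 / 3 : ℝ) ≤ aniDist y x := le_add_of_nonneg_left (abs_nonneg _)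
  have h2 := Real.rpow_le_rpow (Real.rpow_nonneg (abs_nonneg _) _) h (z := 3 / 2) (by norm_num)
  rwa [← Real.rpow_mul (abs_nonneg _), show (2 / 3 * (3 / 2) : ℝ) = 1 by norm_num, Real.rpow_one] at h2

theorem TorusTest.abs_sub_le₁ (u : TorusTest) {M : ℝ} (hM : ∀ x, |(D₁ u) x| ≤ M) (s s' t : ℝ) :
    |u (s', t) - u (s, t)| ≤ M * |s' - s| := by
  have h := convex_univ.norm_image_sub_le_of_norm_hasDerivWithin_le (f := fun r => u (r, t))
    (f' := fun r => (D₁ u) (r, t)) (x := s) (y := s')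
    (fun r _ => (hasDerivAt_partial₁ (x := (r, t)) (u.differentiable _)).hasDerivWithinAt)
    (fun r _ => hM (r, t)) trivial trivial
  simpa only [Real.norm_eq_abs] using h

theorem TorusTest.abs_sub_le₂ (u : TorusTest) {M : ℝ} (hM : ∀ x, |(D₂ u) x| ≤ M) (s t t' : ℝ) :
    |u (s, t') - u (s, t)| ≤ M * |t' - t| := by
  have h := convex_univ.norm_image_sub_le_of_norm_hasDerivWithin_le (f := fun r => u (s, r))
    (f' := fun r => (D₂ u) (s, r)) (x := t) (y := t')
    (fun r _ => (hasDerivAt_partial₂ (x := (s, r)) (u.differentiable _)).hasDerivWithinAt)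
    (fun r _ => hM (s, r)) trivial trivial
  simpa only [Real.norm_eq_abs] using h

theorem TorusTest.abs_sub_le (u : TorusTest) {M₁ M₂ : ℝ} (h₁ : ∀ x, |(D₁ u) x| ≤ M₁)
    (h₂ : ∀ x, |(D₂ u) x| ≤ M₂) (x y : ℝ × ℝ) :
    |u y - u x| ≤ M₁ * |y.1 - x.1| + M₂ * |y.2 - x.2| := by
  have e1 := u.abs_sub_le₁ h₁ x.1 y.1 x.2
  have e2 := u.abs_sub_le₂ h₂ y.1 x.2 y.2
  have := abs_add_le (u (y.1, y.2) - u (y.1, x.2)) (u (y.1, x.2) - u (x.1, x.2))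
  rw [sub_add_sub_cancel] at this
  exact this.trans (by linarith)

theorem TorusTest.abs_taylor_le (u : TorusTest) {M : ℝ} (hM : ∀ x, |(D₁ (D₁ u)) x| ≤ M) (s s' t : ℝ) :
    |u (s', t) - u (s, t) - (D₁ u) (s, t) * (s' - s)| ≤ M * |s' - s| ^ 2 := by
  have hM0 : 0 ≤ M := (abs_nonneg _).trans (hM 0)
  have h := (convex_uIcc s s').norm_image_sub_le_of_norm_hasDerivWithin_le
    (f := fun r => u (r, t) - (D₁ u) (s, t) * r) (f' := fun r => (D₁ u) (r, t) - (D₁ u) (s, t))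
    (C := M * |s' - s|) (x := s) (y := s') (fun r _ => ?_) (fun r hr => ?_) Set.left_mem_uIcc
    Set.right_mem_uIcc
  · simp only [Real.norm_eq_abs] at h
    calc _ = |u (s', t) - (D₁ u) (s, t) * s' - (u (s, t) - (D₁ u) (s, t) * s)| := by ring_nf
      _ ≤ M * |s' - s| * |s' - s| := h
      _ = _ := by ring
  · have h1 : HasDerivAt (fun r => u (r, t)) ((D₁ u) (r, t)) r :=
      hasDerivAt_partial₁ (x := (r, t)) (u.differentiable _)
    have h2 := h1.sub ((hasDerivAt_id r).const_mul ((D₁ u) (s, t)))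
    rw [mul_one] at h2
    exact h2.hasDerivWithinAt
  · refine ((D₁ u).abs_sub_le₁ hM s r t).trans (mul_le_mul_of_nonneg_left ?_ hM0)
    exact Set.abs_sub_left_of_mem_uIcc hr

theorem rpow_scale {d L : ℝ} (hd : 0 < d) (hL : 0 < L) (α γ : ℝ) :
    L ^ (γ - α) * d ^ γ = d ^ α * (L * d) ^ (γ - α) := by
  rw [Real.mul_rpow hL.le hd.le, mul_left_comm, ← Real.rpow_add hd]
  congr 2; ring

theorem two_min_bound {t a b c : ℝ} (ht : 0 < t) (hab : a ≤ b) (hc : c ≤ 0) (ha : 0 ≤ a) :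
    min (2 * t ^ c) (t ^ a + t ^ b) ≤ 2 * min (t ^ a) (t ^ c) := by
  rcases le_total t 1 with h | h
  · have h1 : t ^ b ≤ t ^ a := Real.rpow_le_rpow_of_exponent_ge ht h hab
    have h2 : t ^ a ≤ t ^ c := Real.rpow_le_rpow_of_exponent_ge ht h (hc.trans ha)
    rw [min_eq_left h2]
    exact (min_le_right _ _).trans (by linarith)
  · have h2 : t ^ c ≤ t ^ a := Real.rpow_le_rpow_of_exponent_le h (hc.trans ha)
    rw [min_eq_right h2]
    exact min_le_left _ _

theorem three_min_bound {t a b c e : ℝ} (ht : 0 < t) (hab : a ≤ b) (hec : e ≤ c) (hc : c ≤ 0)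
    (ha : 0 ≤ a) : min (2 * t ^ e + t ^ c) (t ^ a + t ^ b) ≤ 3 * min (t ^ a) (t ^ c) := by
  rcases le_total t 1 with h | h
  · have h1 : t ^ b ≤ t ^ a := Real.rpow_le_rpow_of_exponent_ge ht h hab
    have h2 : t ^ a ≤ t ^ c := Real.rpow_le_rpow_of_exponent_ge ht h (hc.trans ha)
    have h3 : 0 < t ^ a := Real.rpow_pos_of_pos ht a
    rw [min_eq_left h2]
    exact (min_le_right _ _).trans (by linarith)
  · have h1 : t ^ e ≤ t ^ c := Real.rpow_le_rpow_of_exponent_le h hec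
    have h2 : t ^ c ≤ t ^ a := Real.rpow_le_rpow_of_exponent_le h (hc.trans ha)
    rw [min_eq_right h2]
    exact (min_le_left _ _).trans (by linarith)

theorem summable_four_pow_rpow {a : ℝ} (ha : a < 0) : Summable fun n : ℕ => ((4 : ℝ) ^ n) ^ a := by
  have : ∀ n : ℕ, ((4 : ℝ) ^ n) ^ a = ((4 : ℝ) ^ a) ^ n := fun n => by
    rw [← Real.rpow_natCast, ← Real.rpow_mul (by norm_num), ← Real.rpow_natCast,
      ← Real.rpow_mul (by norm_num), mul_comm]
  simp only [this]
  exact summable_geometric_of_lt_one (by positivity)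
    (Real.rpow_lt_one_of_one_lt_of_neg (by norm_num) ha)

/-- The bounds satisfied by the dyadic pieces of a function of regularity `α`. -/
structure DyadicBound (α A : ℝ) (u : ℕ → TorusTest) : Prop where
  zero : ∀ n x, |(u n) x| ≤ A * ((4 : ℝ) ^ n) ^ (-α)
  one : ∀ n x, |(TorusTest.D₁ (u n)) x| ≤ A * ((4 : ℝ) ^ n) ^ (1 - α)
  two : ∀ n x, |(TorusTest.D₁ (TorusTest.D₁ (u n))) x| ≤ A * ((4 : ℝ) ^ n) ^ (2 - α)
  trans : ∀ n x, |(TorusTest.D₂ (u n)) x| ≤ A * ((4 : ℝ) ^ n) ^ (3 / 2 - α)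

theorem DyadicBound.summable {α A : ℝ} {u : ℕ → TorusTest} (h : DyadicBound α A u) (hα : 0 < α)
    (x : ℝ × ℝ) : Summable fun n => (u n) x :=
  Summable.of_norm_bounded ((summable_four_pow_rpow (neg_neg_of_pos hα)).mul_left A) fun n =>
    h.zero n x

theorem DyadicBound.isPeriodic {u : ℕ → TorusTest} : IsPeriodic fun x => ∑' n, (u n) x := fun x => by
  simp only [((u _).isPeriodic x).1, ((u _).isPeriodic x).2, and_self]

theorem DyadicBound.nonneg {α A : ℝ} {u : ℕ → TorusTest} (h : DyadicBound α A u) : 0 ≤ A := by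
  have := (abs_nonneg _).trans (h.zero 0 0)
  simpa using this

theorem DyadicBound.partial₁_tsum {α A : ℝ} {u : ℕ → TorusTest} (h : DyadicBound α A u) (hα : 1 < α)
    (x : ℝ × ℝ) : partial₁ (fun x => ∑' n, (u n) x) x = ∑' n, (TorusTest.D₁ (u n)) x :=
  (hasDerivAt_tsum (g := fun n s => (u n) (s, x.2)) (g' := fun n s => (TorusTest.D₁ (u n)) (s, x.2))
    ((summable_four_pow_rpow (a := 1 - α) (by linarith)).mul_left A)
    (fun n s => hasDerivAt_partial₁ (x := (s, x.2)) ((u n).differentiable _))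
    (fun n s => h.one n _) (h.summable (by linarith) (x.1, x.2)) x.1).deriv

/-- For `4ⁿd ≥ 1` the supremum bound is used, for `4ⁿd ≤ 1` the mean value theorem. In the latter
range the increment in `x₂`, of exponent `3/2 - α`, is dominated by the one in `x₁`, of exponent `1
- α`. -/
theorem DyadicBound.term_le {α A : ℝ} {u : ℕ → TorusTest} (h : DyadicBound α A u) (hα0 : 0 < α)
    (hα1 : α < 1) {x y : ℝ × ℝ} (hxy : x ≠ y) (n : ℕ) : |(u n) y - (u n) x| ≤
      2 * A * aniDist y x ^ α *
        min (((4 : ℝ) ^ n * aniDist y x) ^ (1 - α)) (((4 : ℝ) ^ n * aniDist y x) ^ (-α)) := by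
  have hA := h.nonneg
  have hd := aniDist_pos hxy.symm
  set d := aniDist y x with hd'
  have h4 : (0 : ℝ) < 4 ^ n := by positivity
  have e0 : ((4 : ℝ) ^ n) ^ (-α) = d ^ α * (4 ^ n * d) ^ (-α) := by
    have := rpow_scale hd h4 α 0; simpa using this
  have e1 : ((4 : ℝ) ^ n) ^ (1 - α) * d = d ^ α * (4 ^ n * d) ^ (1 - α) := by
    have := rpow_scale hd h4 α 1; simpa using this
  have e2 := rpow_scale hd h4 α (3 / 2)
  have b1 : |(u n) y - (u n) x| ≤ A * d ^ α * (2 * (4 ^ n * d) ^ (-α)) := by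
    have := abs_sub ((u n) y) ((u n) x)
    have h1 := h.zero n y
    have h2 := h.zero n x
    rw [e0] at h1 h2
    linarith
  have b2 : |(u n) y - (u n) x| ≤ A * d ^ α * ((4 ^ n * d) ^ (1 - α) + (4 ^ n * d) ^ (3 / 2 - α)) := by
    refine ((u n).abs_sub_le (h.one n) (h.trans n) x y).trans ?_
    calc _ ≤ A * ((4 : ℝ) ^ n) ^ (1 - α) * d + A * ((4 : ℝ) ^ n) ^ (3 / 2 - α) * d ^ (3 / 2 : ℝ) := by
          gcongr
          · exact abs_fst_sub_le x y
          · exact abs_snd_sub_le x y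
      _ = A * (((4 : ℝ) ^ n) ^ (1 - α) * d) + A * (((4 : ℝ) ^ n) ^ (3 / 2 - α) * d ^ (3 / 2 : ℝ)) := by ring
      _ = _ := by rw [e1, e2]; ring
  have hAd : 0 ≤ A * d ^ α := by positivity
  have b3 := le_min b1 b2
  rw [← mul_min_of_nonneg _ _ hAd] at b3
  refine b3.trans ((mul_le_mul_of_nonneg_left (two_min_bound (t := 4 ^ n * d) (by positivity) (a := 1 - α)
    (by linarith) (by linarith) (by linarith)) hAd).trans (le_of_eq (by ring)))

/-- For `4ⁿd ≥ 1` the dominant bound is that of the linear term, of exponent `1 - α`. For `4ⁿd ≤ 1`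
it is that of the increment in `x₂`, of exponent `3/2 - α`, while the quadratic remainder in `x₁` is
smaller. Decay at low frequencies thus relies on `α < 3/2`. -/
theorem DyadicBound.taylor_term_le {α A : ℝ} {u : ℕ → TorusTest} (h : DyadicBound α A u)
    (hα1 : 1 < α) (hα2 : α < 3 / 2) {x y : ℝ × ℝ} (hxy : x ≠ y) (n : ℕ) :
    |(u n) y - (u n) x - (TorusTest.D₁ (u n)) x * (y.1 - x.1)| ≤ 3 * A * aniDist y x ^ α *
      min (((4 : ℝ) ^ n * aniDist y x) ^ (3 / 2 - α)) (((4 : ℝ) ^ n * aniDist y x) ^ (-(α - 1))) := by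
  have hA := h.nonneg
  have hd := aniDist_pos hxy.symm
  have hf := abs_fst_sub_le x y
  have hs := abs_snd_sub_le x y
  set d := aniDist y x with hd'
  have h4 : (0 : ℝ) < 4 ^ n := by positivity
  have e0 : ((4 : ℝ) ^ n) ^ (-α) = d ^ α * (4 ^ n * d) ^ (-α) := by
    have := rpow_scale hd h4 α 0; simpa using this
  have e1 : ((4 : ℝ) ^ n) ^ (1 - α) * d = d ^ α * (4 ^ n * d) ^ (1 - α) := by
    have := rpow_scale hd h4 α 1; simpa using this
  have e2 := rpow_scale hd h4 α (3 / 2)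
  have e3 : ((4 : ℝ) ^ n) ^ (2 - α) * d ^ 2 = d ^ α * (4 ^ n * d) ^ (2 - α) := by
    have := rpow_scale hd h4 α 2
    rwa [show d ^ (2 : ℝ) = d ^ 2 by exact_mod_cast Real.rpow_natCast d 2] at this
  have b1 : |(u n) y - (u n) x - (TorusTest.D₁ (u n)) x * (y.1 - x.1)| ≤
      A * d ^ α * (2 * (4 ^ n * d) ^ (-α) + (4 ^ n * d) ^ (1 - α)) := by
    have h1 := h.zero n y
    have h2 := h.zero n x
    rw [e0] at h1 h2
    have h3 : |(TorusTest.D₁ (u n)) x * (y.1 - x.1)| ≤ A * (((4 : ℝ) ^ n) ^ (1 - α) * d) := by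
      rw [abs_mul, ← mul_assoc]
      have := h.one n x
      gcongr
    rw [e1] at h3
    have := abs_sub ((u n) y - (u n) x) ((TorusTest.D₁ (u n)) x * (y.1 - x.1))
    have := abs_sub ((u n) y) ((u n) x)
    linarith
  have b2 : |(u n) y - (u n) x - (TorusTest.D₁ (u n)) x * (y.1 - x.1)| ≤
      A * d ^ α * ((4 ^ n * d) ^ (3 / 2 - α) + (4 ^ n * d) ^ (2 - α)) := by
    have t1 := (u n).abs_taylor_le (h.two n) x.1 y.1 x.2
    have t2 := (u n).abs_sub_le₂ (h.trans n) y.1 x.2 y.2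
    have t3 := abs_add_le ((u n) (y.1, y.2) - (u n) (y.1, x.2))
      ((u n) (y.1, x.2) - (u n) (x.1, x.2) - (TorusTest.D₁ (u n)) (x.1, x.2) * (y.1 - x.1))
    have e : (u n) (y.1, y.2) - (u n) (y.1, x.2) +
      ((u n) (y.1, x.2) - (u n) (x.1, x.2) - (TorusTest.D₁ (u n)) (x.1, x.2) * (y.1 - x.1)) =
      (u n) y - (u n) x - (TorusTest.D₁ (u n)) x * (y.1 - x.1) := by
      simp only [Prod.mk.eta]; ring
    rw [e] at t3
    refine t3.trans ?_
    calc _ ≤ A * ((4 : ℝ) ^ n) ^ (3 / 2 - α) * d ^ (3 / 2 : ℝ) + A * ((4 : ℝ) ^ n) ^ (2 - α) * d ^ 2 := by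
          refine add_le_add (t2.trans ?_) (t1.trans ?_) <;> gcongr
      _ = A * (((4 : ℝ) ^ n) ^ (3 / 2 - α) * d ^ (3 / 2 : ℝ)) + A * (((4 : ℝ) ^ n) ^ (2 - α) * d ^ 2) := by
          ring
      _ = _ := by rw [e2, e3]; ring
  have hAd : 0 ≤ A * d ^ α := by positivity
  have b3 := le_min b1 b2
  rw [← mul_min_of_nonneg _ _ hAd] at b3
  have b4 := three_min_bound (t := 4 ^ n * d) (by positivity) (a := 3 / 2 - α) (b := 2 - α) (c := 1 - α)
    (e := -α) (by linarith) (by linarith) (by linarith) (by linarith)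
  rw [neg_sub]
  exact b3.trans ((mul_le_mul_of_nonneg_left b4 hAd).trans (le_of_eq (by ring)))

theorem enorm_div_le_of_abs_le {r d C : ℝ} (hd : 0 < d) (h : |r| ≤ C * d) :
    ‖r‖ₑ / ENNReal.ofReal d ≤ ENNReal.ofReal C := by
  refine ENNReal.div_le_of_le_mul ?_
  rw [← ofReal_norm, Real.norm_eq_abs, ← ENNReal.ofReal_mul' hd.le]
  exact ENNReal.ofReal_le_ofReal h

/-- The terms at scales away from `4ⁿ ≈ 1/d` decay geometrically with exponents `1 - α` and `α` if
`α < 1`, and `3/2 - α` and `α - 1` if `α > 1`. At `α = 1` one exponent is zero and the bound by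
these series breaks down. -/
theorem exists_holderNorm_tsum_le {α : ℝ} (hα0 : 0 < α) (hα2 : α < 3 / 2) (hα1 : α ≠ 1) :
    ∃ C, 0 ≤ C ∧ ∀ (A : ℝ) (u : ℕ → TorusTest), DyadicBound α A u →
      holderNorm α (fun x => ∑' n, (u n) x) ≤ ENNReal.ofReal (C * A) := by
  rcases lt_or_gt_of_ne hα1 with h1 | h1
  · obtain ⟨C, hC0, hC⟩ := exists_sum_min_bound (p := 1 - α) (q := α) (by linarith) hα0
    refine ⟨2 * C, by positivity, fun A u hu => iSup_le fun x => iSup_le fun y => iSup_le fun hxy => ?_⟩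
    rw [if_pos h1.le]
    have hd := aniDist_pos hxy.symm
    refine enorm_div_le_of_abs_le (Real.rpow_pos_of_pos hd α) ?_
    obtain ⟨hs, hle⟩ := hC _ hd
    have hA := hu.nonneg
    rw [← (hu.summable hα0 y).tsum_sub (hu.summable hα0 x), ← Real.norm_eq_abs]
    refine (tsum_of_norm_bounded (hs.hasSum.mul_left (2 * A * aniDist y x ^ α)) fun n =>
      hu.term_le hα0 h1 hxy n).trans ?_
    refine (mul_le_mul_of_nonneg_left hle (by positivity)).trans (le_of_eq (by ring))
  · obtain ⟨C, hC0, hC⟩ := exists_sum_min_bound (p := 3 / 2 - α) (q := α - 1) (by linarith) (by linarith)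
    refine ⟨3 * C, by positivity, fun A u hu => iSup_le fun x => iSup_le fun y => iSup_le fun hxy => ?_⟩
    rw [if_neg (not_le.2 h1)]
    have hd := aniDist_pos hxy.symm
    refine enorm_div_le_of_abs_le (Real.rpow_pos_of_pos hd α) ?_
    obtain ⟨hs, hle⟩ := hC _ hd
    have hA := hu.nonneg
    have hsD : Summable fun n => (TorusTest.D₁ (u n)) x := Summable.of_norm_bounded
      ((summable_four_pow_rpow (a := 1 - α) (by linarith)).mul_left A) fun n => hu.one n x
    rw [hu.partial₁_tsum h1, ← tsum_mul_right, ← (hu.summable hα0 y).tsum_sub (hu.summable hα0 x),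
      ← ((hu.summable hα0 y).sub (hu.summable hα0 x)).tsum_sub (hsD.mul_right _), ← Real.norm_eq_abs]
    refine (tsum_of_norm_bounded (hs.hasSum.mul_left (3 * A * aniDist y x ^ α)) fun n =>
      hu.taylor_term_le h1 hα2 hxy n).trans ?_
    refine (mul_le_mul_of_nonneg_left hle (by positivity)).trans (le_of_eq (by ring))

end AnisotropicHolder

namespace AnisotropicHolder

open MeasureTheory Filter Topology
open scoped ContDiff ENNReal ComplexConjugate

/-! ### Frequency blocks as test functions -/

/-- The test function `Re (κ ∑ b₁(k₁/4ⁿ) b₂(k₂/8ⁿ) a_k e_k)`, with `a_k` the Fourier coefficients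
of `f`. -/
noncomputable def blockTest (f : PeriodicDistribution) (n : ℕ) (κ : ℂ) (b₁ b₂ : ℝ → ℝ) : TorusTest :=
  ∑ k ∈ box (4 ^ n) (8 ^ n),
    reChar (κ * (((b₁ (k.1 / (4 ^ n : ℕ)) * b₂ (k.2 / (8 ^ n : ℕ)) : ℝ) : ℂ) * coef f k)) k

theorem blockTest_apply {b₁ b₂ : ℝ → ℝ} (h₁ : IsBump b₁) (h₂ : IsBump b₂) (f : PeriodicDistribution)
    (n : ℕ) (κ : ℂ) (x : ℝ × ℝ) :
    (blockTest f n κ b₁ b₂) x = (κ * block (coef f) (4 ^ n) (8 ^ n) b₁ b₂ x).re := by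
  rw [block_eq_sum h₁ h₂ (by positivity) (by positivity), blockTest, TorusTest.sum_apply,
    Finset.mul_sum, Complex.re_sum]
  refine Finset.sum_congr rfl fun k _ => ?_
  rw [reChar_apply, mul_assoc]

theorem D₁_blockTest (f : PeriodicDistribution) (n : ℕ) (κ : ℂ) (b₁ b₂ : ℝ → ℝ) :
    TorusTest.D₁ (blockTest f n κ b₁ b₂) =
      blockTest f n (2 * Real.pi * Complex.I * 4 ^ n * κ) (fun t => b₁ t * t) b₂ := by
  rw [blockTest, map_sum, blockTest]
  refine Finset.sum_congr rfl fun k _ => ?_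
  rw [D₁_reChar, mult₁]
  congr 1
  push_cast
  field_simp

theorem D₂_blockTest (f : PeriodicDistribution) (n : ℕ) (κ : ℂ) (b₁ b₂ : ℝ → ℝ) :
    TorusTest.D₂ (blockTest f n κ b₁ b₂) =
      blockTest f n (2 * Real.pi * Complex.I * 8 ^ n * κ) b₁ (fun t => b₂ t * t) := by
  rw [blockTest, map_sum, blockTest]
  refine Finset.sum_congr rfl fun k _ => ?_
  rw [D₂_reChar, mult₂]
  congr 1
  push_cast
  field_simp

theorem IsBump.mul_id {b : ℝ → ℝ} (hb : IsBump b) : IsBump fun t => b t * t := hb.mul contDiff_id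

theorem exists_abs_blockTest_le {b₁ b₂ : ℝ → ℝ} (h₁ : IsBump b₁) (h₂ : IsBump b₂) (β : ℝ) :
    ∃ C, 0 ≤ C ∧ ∀ (f : PeriodicDistribution) (N : ℝ), HeatBound β N f → ∀ (n : ℕ) (κ : ℂ) x,
      |(blockTest f n κ b₁ b₂) x| ≤ ‖κ‖ * (C * N * ((4 : ℝ) ^ n) ^ (-β)) := by
  obtain ⟨C, hC0, hC⟩ := exists_block_bound h₁ h₂ β
  refine ⟨C, hC0, fun f N hN n κ x => ?_⟩
  rw [blockTest_apply h₁ h₂]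
  refine (Complex.abs_re_le_norm _).trans ?_
  rw [norm_mul]
  exact mul_le_mul_of_nonneg_left (hC f N hN n x) (norm_nonneg _)

theorem HeatBound.nonneg {β N : ℝ} {f : PeriodicDistribution} (h : HeatBound β N f) : 0 ≤ N := by
  simpa using (abs_nonneg _).trans (h 1 ⟨one_pos, le_rfl⟩ 0)

theorem eight_pow_eq (n : ℕ) : (8 : ℝ) ^ n = ((4 : ℝ) ^ n) ^ (3 / 2 : ℝ) := by
  rw [← Real.rpow_natCast 4 n, ← Real.rpow_mul (by norm_num), mul_comm, Real.rpow_mul (by norm_num),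
    Real.rpow_natCast]
  congr 1
  rw [show (4 : ℝ) = 2 ^ (2 : ℝ) by norm_num, ← Real.rpow_mul (by norm_num)]
  norm_num

/-- Differentiation multiplies a bump by its variable, which gives another bump, and produces a
factor `2π4ⁿ` for `∂₁` or `2π8ⁿ = 2π(4ⁿ)^{3/2}` for `∂₂`. The block estimate is applied to four
pairs of bumps, one for each required bound. -/
theorem exists_dyadicBound_blockTest {b₁ b₂ : ℝ → ℝ} (h₁ : IsBump b₁) (h₂ : IsBump b₂) (β σ : ℝ)
    {κ : ℕ → ℂ} (hκ : ∀ n, ‖κ n‖ ≤ ((4 : ℝ) ^ n) ^ (-σ)) :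
    ∃ C, 0 ≤ C ∧ ∀ (f : PeriodicDistribution) (N : ℝ), HeatBound β N f →
      DyadicBound (β + σ) (C * N) fun n => blockTest f n (κ n) b₁ b₂ := by
  obtain ⟨C₀, hC₀, i₀⟩ := exists_abs_blockTest_le h₁ h₂ β
  obtain ⟨C₁, hC₁, i₁⟩ := exists_abs_blockTest_le h₁.mul_id h₂ β
  obtain ⟨C₂, hC₂, i₂⟩ := exists_abs_blockTest_le h₁.mul_id.mul_id h₂ β
  obtain ⟨C₃, hC₃, i₃⟩ := exists_abs_blockTest_le h₁ h₂.mul_id β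
  have hpi := Real.pi_pos
  refine ⟨C₀ + 2 * Real.pi * C₁ + (2 * Real.pi) ^ 2 * C₂ + 2 * Real.pi * C₃, by positivity,
    fun f N hN => ?_⟩
  have hN0 := hN.nonneg
  -- Here `τ` is the scaling order of the derivative, `m` its power of `2π`, and `K` the constant of
  -- the corresponding pair of bumps.
  have key : ∀ (n : ℕ) (τ m K B : ℝ), 0 ≤ K → 0 ≤ m →
      m * K ≤ C₀ + 2 * Real.pi * C₁ + (2 * Real.pi) ^ 2 * C₂ + 2 * Real.pi * C₃ →
      B ≤ (m * ((4 : ℝ) ^ n) ^ τ * ‖κ n‖) * (K * N * ((4 : ℝ) ^ n) ^ (-β)) →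
      B ≤ (C₀ + 2 * Real.pi * C₁ + (2 * Real.pi) ^ 2 * C₂ + 2 * Real.pi * C₃) * N *
        ((4 : ℝ) ^ n) ^ (τ - (β + σ)) := by
    intro n τ m K B hK hm hmK hB
    refine hB.trans ?_
    have h4 : (0 : ℝ) < 4 ^ n := by positivity
    calc _ ≤ (m * ((4 : ℝ) ^ n) ^ τ * ((4 : ℝ) ^ n) ^ (-σ)) * (K * N * ((4 : ℝ) ^ n) ^ (-β)) := by
          gcongr
          exact hκ n
      _ = m * K * N * ((4 : ℝ) ^ n) ^ (τ - (β + σ)) := by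
          rw [show τ - (β + σ) = τ + -σ + -β by ring, Real.rpow_add h4, Real.rpow_add h4]; ring
      _ ≤ _ := by gcongr
  have e4 : ∀ n : ℕ, ‖(2 * Real.pi * Complex.I * 4 ^ n : ℂ)‖ = 2 * Real.pi * (4 : ℝ) ^ n := fun n => by
    simp [abs_of_pos hpi]
  have e8 : ∀ n : ℕ, ‖(2 * Real.pi * Complex.I * 8 ^ n : ℂ)‖ = 2 * Real.pi * (8 : ℝ) ^ n := fun n => by
    simp [abs_of_pos hpi]
  refine ⟨fun n x => ?_, fun n x => ?_, fun n x => ?_, fun n x => ?_⟩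
  · rw [← zero_sub]
    refine key n 0 1 C₀ _ hC₀ zero_le_one ?_ ?_
    · have : 0 ≤ 2 * Real.pi * C₁ + (2 * Real.pi) ^ 2 * C₂ + 2 * Real.pi * C₃ := by positivity
      linarith
    · simpa using i₀ f N hN n (κ n) x
  · refine key n 1 (2 * Real.pi) C₁ _ hC₁ (by positivity) ?_ ?_
    · have : 0 ≤ C₀ + (2 * Real.pi) ^ 2 * C₂ + 2 * Real.pi * C₃ := by positivity
      linarith
    · rw [D₁_blockTest, Real.rpow_one, ← e4, ← norm_mul]
      exact i₁ f N hN n _ x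
  · refine key n 2 ((2 * Real.pi) ^ 2) C₂ _ hC₂ (by positivity) ?_ ?_
    · have : 0 ≤ C₀ + 2 * Real.pi * C₁ + 2 * Real.pi * C₃ := by positivity
      linarith
    · rw [D₁_blockTest, D₁_blockTest]
      have h := i₂ f N hN n (2 * Real.pi * Complex.I * 4 ^ n * (2 * Real.pi * Complex.I * 4 ^ n * κ n)) x
      rw [norm_mul, norm_mul _ (κ n), e4] at h
      refine h.trans (le_of_eq ?_)
      rw [show (2 : ℝ) = ((2 : ℕ) : ℝ) by norm_num, Real.rpow_natCast]
      ring
  · refine key n (3 / 2) (2 * Real.pi) C₃ _ hC₃ (by positivity) ?_ ?_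
    · have : 0 ≤ C₀ + 2 * Real.pi * C₁ + (2 * Real.pi) ^ 2 * C₂ := by positivity
      linarith
    · rw [D₂_blockTest, ← eight_pow_eq, ← e8, ← norm_mul]
      exact i₃ f N hN n _ x

/-! ### The dyadic partition of frequencies -/

/-- A smooth cutoff function that is `1` on `[-1/2,1/2]` and `0` outside of `[-1,1]`. -/
noncomputable def cutoff (t : ℝ) : ℝ := Real.smoothTransition (2 - 4 * t ^ 2)

theorem cutoff_eq_one {t : ℝ} (ht : |t| ≤ 1 / 2) : cutoff t = 1 := by
  refine Real.smoothTransition.one_of_one_le ?_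
  rw [← sq_abs]; nlinarith [abs_nonneg t]

theorem cutoff_eq_zero {t : ℝ} (ht : 1 ≤ |t|) : cutoff t = 0 := by
  refine Real.smoothTransition.zero_of_nonpos ?_
  rw [← sq_abs]; nlinarith

theorem contDiff_cutoff : ContDiff ℝ 2 cutoff :=
  Real.smoothTransition.contDiff.comp (contDiff_const.sub (contDiff_const.mul (contDiff_id.pow 2)))

/-- The cutoff at scale `q`. -/
noncomputable def cutoffAt (q t : ℝ) : ℝ := cutoff (t / q)

/-- The multiplier `(θ(t/q) - θ(t)) / tʲ`. -/
noncomputable def annulus (q : ℝ) (j : ℕ) (t : ℝ) : ℝ := (cutoffAt q t - cutoff t) * (t ^ j)⁻¹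

theorem cutoffAt_sub_cutoff {q t : ℝ} (hq : 1 ≤ q) (ht : |t| ≤ 1 / 2) : cutoffAt q t - cutoff t = 0 := by
  rw [cutoffAt, cutoff_eq_one ht, cutoff_eq_one, sub_self]
  rw [abs_div, abs_of_pos (by linarith : 0 < q)]
  exact (div_le_self (abs_nonneg t) hq).trans ht

theorem cutoffAt_eq_zero {q t : ℝ} (hq : 1 ≤ q) (hq8 : q ≤ 8) (ht : 8 ≤ |t|) : cutoffAt q t = 0 := by
  refine cutoff_eq_zero ?_
  rw [abs_div, abs_of_pos (by linarith : 0 < q), le_div_iff₀ (by linarith)]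
  linarith

theorem isBump_cutoffAt {q : ℝ} (hq : 1 ≤ q) (hq8 : q ≤ 8) : IsBump (cutoffAt q) :=
  ⟨contDiff_cutoff.comp (contDiff_id.div_const q), fun _ ht => cutoffAt_eq_zero hq hq8 ht⟩

theorem isBump_cutoff : IsBump cutoff := ⟨contDiff_cutoff, fun _ ht => cutoff_eq_zero (by linarith)⟩

/-- The two cutoffs agree for `|t| ≤ 1/2`, so the quotient vanishes near 0 and division by `tʲ`
costs no regularity. -/
theorem isBump_annulus {q : ℝ} (hq : 1 ≤ q) (hq8 : q ≤ 8) (j : ℕ) : IsBump (annulus q j) := by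
  refine ⟨contDiff_iff_contDiffAt.2 fun t => ?_, fun t ht => ?_⟩
  · rcases eq_or_ne t 0 with rfl | h
    · have h0 : annulus q j =ᶠ[𝓝 0] fun _ => 0 := by
        filter_upwards [Metric.ball_mem_nhds (0 : ℝ) (by norm_num : (0 : ℝ) < 1 / 2)] with s hs
        rw [annulus, cutoffAt_sub_cutoff hq, zero_mul]
        rw [Metric.mem_ball, dist_zero_right, Real.norm_eq_abs] at hs
        exact hs.le
      exact contDiffAt_const.congr_of_eventuallyEq h0
    · exact ((isBump_cutoffAt hq hq8).contDiff.sub contDiff_cutoff).contDiffAt.mul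
        ((contDiffAt_id.pow j).inv (pow_ne_zero j h))
  · rw [annulus, cutoffAt_eq_zero hq hq8 ht, isBump_cutoff.eq_zero t ht, sub_zero, zero_mul]

theorem annulus_zero (q : ℝ) : annulus q 0 = fun t => cutoffAt q t - cutoff t := by
  funext t; simp [annulus]

theorem annulus_succ_mul {q : ℝ} (hq : 1 ≤ q) (j : ℕ) :
    (fun t => annulus q (j + 1) t * t) = annulus q j := by
  funext t
  -- At `t = 0` the right side vanishes through the difference of cutoffs; for `j = 0` the factor
  -- `(t^j)⁻¹` equals 1 and does not help.
  rcases eq_or_ne t 0 with rfl | h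
  · rw [mul_zero, annulus, cutoffAt_sub_cutoff hq (by simp), zero_mul]
  · simp only [annulus]
    field_simp
    ring

/-! ### Low-frequency parts -/

/-- The low-frequency part of a periodic distribution. -/
noncomputable def lowPart (f : PeriodicDistribution) (n : ℕ) : TorusTest :=
  blockTest f n 1 cutoff cutoff

/-- With `θ` the cutoff and `t₁ = k₁/4ⁿ`, `t₂ = k₂/8ⁿ`, the difference `θ(t₁/4)θ(t₂/8) - θ(t₁)θ(t₂)`
equals `(θ(t₁/4) - θ(t₁))θ(t₂/8) + θ(t₁)(θ(t₂/8) - θ(t₂))`. In each summand one variable stays away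
from zero and can be divided out. -/
theorem lowPart_succ (f : PeriodicDistribution) (n : ℕ) :
    lowPart f (n + 1) = lowPart f n + (blockTest f n 1 (annulus 4 0) (cutoffAt 8) +
      blockTest f n 1 cutoff (annulus 8 0)) := by
  have h4 : IsBump (cutoffAt 4) := isBump_cutoffAt (by norm_num) (by norm_num)
  have h8 : IsBump (cutoffAt 8) := isBump_cutoffAt (by norm_num) (by norm_num)
  have e1 : lowPart f (n + 1) = blockTest f n 1 (cutoffAt 4) (cutoffAt 8) := by
    refine TorusTest.ext fun x => ?_
    rw [lowPart, blockTest_apply isBump_cutoff isBump_cutoff, blockTest_apply h4 h8]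
    congr 2
    refine tsum_congr fun k => ?_
    simp only [cutoffAt, div_div]
    push_cast
    rw [pow_succ, pow_succ]
  rw [e1, lowPart, blockTest, blockTest, blockTest, blockTest, ← Finset.sum_add_distrib,
    ← Finset.sum_add_distrib]
  refine Finset.sum_congr rfl fun k _ => TorusTest.ext fun x => ?_
  simp only [TorusTest.coe_add, Pi.add_apply, reChar_apply, ← Complex.add_re, annulus_zero]
  congr 1
  push_cast
  ring

theorem cutoff_int {k : ℤ} (hk : k ≠ 0) : cutoff (k / (1 : ℕ)) = 0 := by
  refine cutoff_eq_zero ?_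
  rw [Nat.cast_one, div_one]
  exact_mod_cast Int.one_le_abs hk

theorem cutoff_zero : cutoff 0 = 1 := cutoff_eq_one (by simp)

theorem reChar_one_zero : reChar 1 0 = TorusTest.one :=
  TorusTest.ext fun x => by rw [reChar_apply]; simp [char]; rfl

/-- At level 0 the cutoff vanishes at every nonzero integer, so only the zero frequency survives.
The telescoping sum therefore starts at the constant `c` of the decomposition. -/
theorem lowPart_zero (f : PeriodicDistribution) (x : ℝ × ℝ) : (lowPart f 0) x = average f := by
  rw [lowPart, blockTest_apply isBump_cutoff isBump_cutoff, block, tsum_eq_single 0]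
  · have h := apply_reChar f 1 0
    rw [reChar_one_zero] at h
    rw [average, h]
    simp [cutoff_zero, char]
  · intro k hk
    rw [pow_zero, pow_zero]
    by_cases h1 : k.1 = 0
    · have h2 : k.2 ≠ 0 := fun h2 => hk (Prod.ext h1 h2)
      rw [cutoff_int h2]; simp
    · rw [cutoff_int h1]; simp

theorem exists_abs_average_le (β : ℝ) : ∃ C, 0 ≤ C ∧ ∀ (f : PeriodicDistribution) (N : ℝ),
    HeatBound β N f → |average f| ≤ C * N := by
  obtain ⟨C, hC0, hC⟩ := exists_abs_blockTest_le isBump_cutoff isBump_cutoff β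
  refine ⟨C, hC0, fun f N hN => ?_⟩
  have h := hC f N hN 0 1 0
  rw [← lowPart, lowPart_zero] at h
  simpa using h

end AnisotropicHolder

namespace AnisotropicHolder

open MeasureTheory Filter Topology
open scoped ContDiff ENNReal ComplexConjugate

/-! ### Approximation of test functions by trigonometric polynomials -/

theorem abs_sin_pi_add_int (s : ℝ) (m : ℤ) : |Real.sin (Real.pi * (s + m))| = |Real.sin (Real.pi * s)| := by
  rw [mul_add, mul_comm Real.pi (m : ℝ), Real.sin_add_int_mul_pi, abs_mul]
  simp

theorem two_mul_abs_le_abs_sin {s : ℝ} (hs : |s| ≤ 1 / 2) : 2 * |s| ≤ |Real.sin (Real.pi * s)| := by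
  have h := four_mul_sq_le_sin hs
  refine abs_le_of_sq_le_sq' ?_ (abs_nonneg _) |>.2
  rw [sq_abs, mul_pow, sq_abs]
  linarith

/-- `|sin(πs)|` serves as a periodic substitute for `|s|`: the lattice translate of `y` nearest to
`x` is used, and there the two are comparable. -/
theorem TorusTest.exists_abs_sub_le_sin (u : TorusTest) : ∃ M, 0 ≤ M ∧ ∀ x y : ℝ × ℝ, |u y - u x| ≤
    M * (|Real.sin (Real.pi * (x.1 - y.1))| + |Real.sin (Real.pi * (x.2 - y.2))|) := by
  obtain ⟨M₁, hM₁, h₁⟩ := (D₁ u).isPeriodic.exists_bound (D₁ u).continuous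
  obtain ⟨M₂, hM₂, h₂⟩ := (D₂ u).isPeriodic.exists_bound (D₂ u).continuous
  refine ⟨M₁ + M₂, by positivity, fun x y => ?_⟩
  set m₁ := round (x.1 - y.1)
  set m₂ := round (x.2 - y.2)
  have e := u.isPeriodic.add_int y (m₁, m₂)
  have h := u.abs_sub_le h₁ h₂ x (y.1 + m₁, y.2 + m₂)
  rw [e] at h
  have key : ∀ s t : ℝ, |t + round (s - t) - s| ≤ |Real.sin (Real.pi * (s - t))| := fun s t => by
    have r : |(s - t) - round (s - t)| ≤ 1 / 2 := abs_sub_round _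
    have h2 := two_mul_abs_le_abs_sin r
    have h3 := abs_sin_pi_add_int ((s - t) - round (s - t)) (round (s - t))
    rw [sub_add_cancel] at h3
    rw [← h3] at h2
    have h4 : |t + round (s - t) - s| = |(s - t) - round (s - t)| := by
      rw [← abs_neg]; congr 1; ring
    rw [h4]
    linarith [abs_nonneg ((s - t) - round (s - t))]
  have k₁ := key x.1 y.1
  have k₂ := key x.2 y.2
  refine h.trans ?_
  have a1 := mul_le_mul_of_nonneg_left k₁ hM₁
  have a2 := mul_le_mul_of_nonneg_left k₂ hM₂
  have a3 := mul_nonneg hM₁ (abs_nonneg (Real.sin (Real.pi * (x.2 - y.2))))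
  have a4 := mul_nonneg hM₂ (abs_nonneg (Real.sin (Real.pi * (x.1 - y.1))))
  simp only [m₁, m₂]
  linarith

/-- From `|s| ≤ δ + s²/δ`. A free `δ` replaces the exact first moment on a bounded interval, which
carries a logarithm of `L`. -/
theorem abs_mul_scaled_inv_le {L δ : ℝ} (hL : 0 < L) (hδ : 0 < δ) (s : ℝ) :
    |s| * (L * (1 + (L * s) ^ 2)⁻¹) ≤ δ * (L * (1 + (L * s) ^ 2)⁻¹) + (δ * L)⁻¹ := by
  have h1 : |s| ≤ δ + s ^ 2 / δ := by
    rw [← sq_abs s]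
    have h0 := abs_nonneg s
    rcases le_total (|s|) δ with h | h
    · have : 0 ≤ |s| ^ 2 / δ := by positivity
      linarith
    · have : |s| ≤ |s| ^ 2 / δ := by rw [le_div_iff₀ hδ]; nlinarith
      linarith
  have h2 : s ^ 2 / δ * (L * (1 + (L * s) ^ 2)⁻¹) ≤ (δ * L)⁻¹ := by
    have : s ^ 2 / δ * (L * (1 + (L * s) ^ 2)⁻¹) = (δ * L)⁻¹ * ((L * s) ^ 2 / (1 + (L * s) ^ 2)) := by
      field_simp
    rw [this]
    refine mul_le_of_le_one_right (by positivity) ?_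
    rw [div_le_one (by positivity)]; linarith
  have h3 : 0 ≤ L * (1 + (L * s) ^ 2)⁻¹ := by positivity
  nlinarith [mul_le_mul_of_nonneg_right h1 h3]

theorem IsBump.exists_integral_moment_bound {b : ℝ → ℝ} (hb : IsBump b) : ∃ C, 0 ≤ C ∧
    ∀ L : ℕ, 0 < L → ∀ δ : ℝ, 0 < δ → ∀ x : ℝ,
      ∫ s in (0 : ℝ)..1, ‖kernel₁ b L (x - s)‖ * |Real.sin (Real.pi * (x - s))| ≤
        C * (δ + (δ * L)⁻¹) := by
  obtain ⟨C, hC0, hC⟩ := hb.exists_kernel₁_bound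
  have hpi := Real.pi_pos
  refine ⟨C * Real.pi * (Real.pi + 1), by positivity, fun L hL δ hδ x => ?_⟩
  have hL' : (0 : ℝ) < L := by exact_mod_cast hL
  have hc := hb.continuous_kernel₁ hL
  have hper : Function.Periodic (fun s => ‖kernel₁ b L s‖ * |Real.sin (Real.pi * s)|) 1 := fun s => by
    have := abs_sin_pi_add_int s 1
    rw [Int.cast_one] at this
    simp only [kernel₁_periodic b L s, this]
  rw [intervalIntegral.integral_comp_sub_left
    (fun s => ‖kernel₁ b L s‖ * |Real.sin (Real.pi * s)|) x]
  have h1 := hper.intervalIntegral_add_eq (x - 1) (-(1 / 2))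
  rw [sub_add_cancel, show (-(1 / 2) + 1 : ℝ) = 1 / 2 by norm_num] at h1
  rw [sub_zero, h1]
  have hi := (integrable_scaled_inv hL).intervalIntegrable (a := -(1 / 2)) (b := 1 / 2)
  refine le_trans (intervalIntegral.integral_mono_on (g := fun s => C * Real.pi *
    (δ * (L * (1 + (L * s) ^ 2)⁻¹) + (δ * L)⁻¹)) (by norm_num) ?_ ?_ fun s hs => ?_) ?_
  · exact Continuous.intervalIntegrable (by fun_prop) _ _
  · exact ((hi.const_mul δ).add intervalIntegrable_const).const_mul _
  · have hs' : |s| ≤ 1 / 2 := abs_le.2 ⟨by linarith [hs.1], hs.2⟩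
    have h2 := hC L hL s hs'
    have h3 : |Real.sin (Real.pi * s)| ≤ Real.pi * |s| := by
      refine (Real.abs_sin_le_abs).trans ?_
      rw [abs_mul, abs_of_pos hpi]
    have h4 := abs_mul_scaled_inv_le hL' hδ s
    calc _ ≤ C * (L * (1 + (L * s) ^ 2)⁻¹) * (Real.pi * |s|) := by gcongr
      _ = C * Real.pi * (|s| * (L * (1 + (L * s) ^ 2)⁻¹)) := by ring
      _ ≤ _ := by gcongr
  · rw [intervalIntegral.integral_const_mul,
      intervalIntegral.integral_add (hi.const_mul δ) intervalIntegrable_const,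
      intervalIntegral.integral_const_mul, intervalIntegral.integral_const, mul_assoc _ (Real.pi + 1)]
    refine mul_le_mul_of_nonneg_left ?_ (by positivity)
    have h2 := mul_le_mul_of_nonneg_left (intervalIntegral_scaled_inv_le hL) hδ.le
    have h3 : 0 ≤ (δ * L)⁻¹ := by positivity
    rw [show (1 / 2 - -(1 / 2) : ℝ) = 1 by norm_num, one_smul]
    nlinarith [mul_nonneg hpi.le h3]

/-- The Fourier coefficients of a test function. -/
noncomputable def testCoef (u : TorusTest) (k : ℤ × ℤ) : ℂ :=
  ∫ y in cell, (u y : ℂ) * conj (char k y)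

theorem conj_char_eq (k : ℤ × ℤ) (y : ℝ × ℝ) :
    conj (char k y) = ((reChar 1 k) y : ℂ) - Complex.I * ((reChar (-Complex.I) k) y : ℂ) := by
  rw [reChar_apply, reChar_apply]
  apply Complex.ext <;> simp

theorem testCoef_eq (u : TorusTest) (k : ℤ × ℤ) :
    testCoef u k = ((∫ y in cell, (reChar 1 k) y * u y : ℝ) : ℂ) -
      Complex.I * ((∫ y in cell, (reChar (-Complex.I) k) y * u y : ℝ) : ℂ) := by
  have h : ∀ a, IntegrableOn (fun y => (((reChar a k) y * u y : ℝ) : ℂ)) cell := fun a =>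
    integrableOn_cell_complex (by fun_prop)
  rw [← integral_complex_ofReal, ← integral_complex_ofReal, ← integral_const_mul,
    ← integral_sub (h 1) ((h _).const_mul _), testCoef]
  refine integral_congr_ae (ae_of_all _ fun y => ?_)
  simp only [conj_char_eq]
  push_cast
  ring

theorem testCoef_D₁ (u : TorusTest) (k : ℤ × ℤ) : testCoef (TorusTest.D₁ u) k = mult₁ k * testCoef u k := by
  have e1 : reChar (mult₁ k * 1) k = (-(2 * Real.pi * k.1)) • reChar (-Complex.I) k := by
    rw [← reChar_smul, mult₁]; congr 1; push_cast; ring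
  have e2 : reChar (mult₁ k * (-Complex.I)) k = (2 * Real.pi * k.1) • reChar 1 k := by
    rw [← reChar_smul, mult₁]; congr 1; push_cast; linear_combination (-2 * Real.pi * k.1) * Complex.I_sq
  rw [testCoef_eq, testCoef_eq, integral_cell_mul_D₁, integral_cell_mul_D₁, D₁_reChar, D₁_reChar, e1, e2]
  simp only [TorusTest.coe_smul, Pi.smul_apply, smul_eq_mul, mul_assoc, integral_const_mul]
  rw [mult₁]
  push_cast
  linear_combination (2 * Real.pi * k.1 * (∫ y in cell, (reChar (-Complex.I) k) y * u y : ℝ)) *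
    Complex.I_sq

theorem testCoef_D₂ (u : TorusTest) (k : ℤ × ℤ) : testCoef (TorusTest.D₂ u) k = mult₂ k * testCoef u k := by
  have e1 : reChar (mult₂ k * 1) k = (-(2 * Real.pi * k.2)) • reChar (-Complex.I) k := by
    rw [← reChar_smul, mult₂]; congr 1; push_cast; ring
  have e2 : reChar (mult₂ k * (-Complex.I)) k = (2 * Real.pi * k.2) • reChar 1 k := by
    rw [← reChar_smul, mult₂]; congr 1; push_cast; linear_combination (-2 * Real.pi * k.2) * Complex.I_sq
  rw [testCoef_eq, testCoef_eq, integral_cell_mul_D₂, integral_cell_mul_D₂, D₂_reChar, D₂_reChar, e1, e2]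
  simp only [TorusTest.coe_smul, Pi.smul_apply, smul_eq_mul, mul_assoc, integral_const_mul]
  rw [mult₂]
  push_cast
  linear_combination (2 * Real.pi * k.2 * (∫ y in cell, (reChar (-Complex.I) k) y * u y : ℝ)) *
    Complex.I_sq

/-- The multiplier of the low-frequency projection. -/
noncomputable def lowMult (n : ℕ) (k : ℤ × ℤ) : ℝ :=
  cutoff (k.1 / (4 ^ n : ℕ)) * cutoff (k.2 / (8 ^ n : ℕ))

/-- The low-frequency projection of test functions. -/
noncomputable def lowPass (n : ℕ) (u : TorusTest) : TorusTest :=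
  ∑ k ∈ box (4 ^ n) (8 ^ n), reChar ((lowMult n k : ℂ) * testCoef u k) k

theorem commute_D₁_lowPass (n : ℕ) : Function.Commute (lowPass n) TorusTest.D₁ := fun u => by
  rw [lowPass, lowPass, map_sum]
  refine Finset.sum_congr rfl fun k _ => ?_
  rw [D₁_reChar, testCoef_D₁, mul_left_comm]

theorem commute_D₂_lowPass (n : ℕ) : Function.Commute (lowPass n) TorusTest.D₂ := fun u => by
  rw [lowPass, lowPass, map_sum]
  refine Finset.sum_congr rfl fun k _ => ?_
  rw [D₂_reChar, testCoef_D₂, mul_left_comm]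

/-- The low-pass multiplier is real, so projecting the test function and projecting the distribution
amount to the same pairing, frequency by frequency. -/
theorem apply_lowPass (f : PeriodicDistribution) (n : ℕ) (u : TorusTest) :
    f (lowPass n u) = ∫ y in cell, (lowPart f n) y * u y := by
  rw [lowPass, map_sum, lowPart, blockTest]
  simp only [TorusTest.sum_apply, Finset.sum_mul]
  rw [integral_finsetSum _ fun k _ => integrableOn_cell (by fun_prop)]
  refine Finset.sum_congr rfl fun k _ => ?_
  have h : IntegrableOn (fun y => (lowMult n k : ℂ) * coef f k * conj ((u y : ℂ) * conj (char k y))) cell :=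
    integrableOn_cell_complex (by simp only [conj_char]; fun_prop)
  rw [apply_reChar, testCoef, map_mul, Complex.conj_ofReal, ← integral_conj, mul_right_comm,
    ← integral_const_mul, ← RCLike.re_eq_complex_re, ← integral_re h]
  refine integral_congr_ae (ae_of_all _ fun y => ?_)
  simp only [RCLike.re_eq_complex_re, map_mul, Complex.conj_conj, Complex.conj_ofReal, reChar_apply,
    one_mul, lowMult]
  rw [mul_left_comm, Complex.re_ofReal_mul, mul_comm]

theorem lowMult_zero (n : ℕ) : lowMult n 0 = 1 := by simp [lowMult, cutoff_zero]

theorem zero_mem_box (L₁ L₂ : ℕ) : (0 : ℤ × ℤ) ∈ box L₁ L₂ := by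
  simp [box, freq]

theorem integral_cell_lowKernel (n : ℕ) (x : ℝ × ℝ) : ∫ y in cell,
    kernel₁ cutoff (4 ^ n) (x.1 - y.1) * kernel₁ cutoff (8 ^ n) (x.2 - y.2) = 1 := by
  simp only [← sum_box_char_sub isBump_cutoff isBump_cutoff (L₁ := 4 ^ n) (L₂ := 8 ^ n) (by positivity)
    (by positivity) x]
  rw [integral_finsetSum _ fun k _ => integrableOn_cell_complex (by simp only [conj_char]; fun_prop)]
  rw [Finset.sum_eq_single_of_mem 0 (zero_mem_box _ _)]
  · have := lowMult_zero n
    rw [lowMult] at this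
    rw [this]
    simp [char]
  · intro k _ hk
    rw [integral_const_mul, integral_const_mul]
    simp only [conj_char, integral_cell_char, neg_eq_zero, if_neg hk, mul_zero]

/-- The low-pass kernel has integral one, as its multiplier is 1 at frequency 0, so `u x` can be
brought under the integral. -/
theorem lowPass_apply_sub (n : ℕ) (u : TorusTest) (x : ℝ × ℝ) :
    (lowPass n u) x - u x = (∫ y in cell, kernel₁ cutoff (4 ^ n) (x.1 - y.1) *
      kernel₁ cutoff (8 ^ n) (x.2 - y.2) * ((u y - u x : ℝ) : ℂ)).re := by
  have k₁ := isBump_cutoff.continuous_kernel₁ (L := 4 ^ n) (by positivity)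
  have k₂ := isBump_cutoff.continuous_kernel₁ (L := 8 ^ n) (by positivity)
  have e : (lowPass n u) x = (∫ y in cell, kernel₁ cutoff (4 ^ n) (x.1 - y.1) *
      kernel₁ cutoff (8 ^ n) (x.2 - y.2) * (u y : ℂ)).re := by
    simp only [← sum_box_char_sub isBump_cutoff isBump_cutoff (L₁ := 4 ^ n) (L₂ := 8 ^ n) (by positivity)
      (by positivity) x, Finset.sum_mul]
    rw [integral_finsetSum _ fun k _ => integrableOn_cell_complex (by simp only [conj_char]; fun_prop),
      Complex.re_sum, lowPass, TorusTest.sum_apply]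
    refine Finset.sum_congr rfl fun k _ => ?_
    rw [reChar_apply, testCoef, ← integral_const_mul, ← integral_mul_const]
    congr 1
    refine integral_congr_ae (ae_of_all _ fun y => ?_)
    simp only [lowMult]
    ring
  have h1 : IntegrableOn (fun y : ℝ × ℝ => kernel₁ cutoff (4 ^ n) (x.1 - y.1) *
      kernel₁ cutoff (8 ^ n) (x.2 - y.2) * (u y : ℂ)) cell := integrableOn_cell_complex (by fun_prop)
  have h2 : IntegrableOn (fun y : ℝ × ℝ => kernel₁ cutoff (4 ^ n) (x.1 - y.1) *
      kernel₁ cutoff (8 ^ n) (x.2 - y.2) * (u x : ℂ)) cell := integrableOn_cell_complex (by fun_prop)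
  have h3 := integral_sub h1 h2
  rw [integral_mul_const, integral_cell_lowKernel, one_mul] at h3
  rw [e, ← Complex.ofReal_re (u x), ← Complex.sub_re, Complex.ofReal_re, ← h3]
  simp only [Complex.ofReal_sub, mul_sub]

theorem tendstoUniformly_lowPass (u : TorusTest) :
    TendstoUniformly (fun n => (lowPass n u).toFun) u.toFun atTop := by
  obtain ⟨M, hM, hu⟩ := u.exists_abs_sub_le_sin
  obtain ⟨C, hC0, hC⟩ := isBump_cutoff.exists_integral_norm_bound
  obtain ⟨C', hC'0, hC'⟩ := isBump_cutoff.exists_integral_moment_bound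
  have bound : ∀ n x, |(lowPass n u) x - u x| ≤ 4 * M * C * C' * (1 / 2) ^ n := by
    intro n x
    have k₁ := isBump_cutoff.continuous_kernel₁ (L := 4 ^ n) (by positivity)
    have k₂ := isBump_cutoff.continuous_kernel₁ (L := 8 ^ n) (by positivity)
    rw [lowPass_apply_sub]
    refine (Complex.abs_re_le_norm _).trans ?_
    have c₁ : Continuous fun y : ℝ × ℝ => (‖kernel₁ cutoff (4 ^ n) (x.1 - y.1)‖ *
        |Real.sin (Real.pi * (x.1 - y.1))|) * ‖kernel₁ cutoff (8 ^ n) (x.2 - y.2)‖ := by fun_prop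
    have c₂ : Continuous fun y : ℝ × ℝ => ‖kernel₁ cutoff (4 ^ n) (x.1 - y.1)‖ *
        (‖kernel₁ cutoff (8 ^ n) (x.2 - y.2)‖ * |Real.sin (Real.pi * (x.2 - y.2))|) := by fun_prop
    refine (norm_integral_le_of_norm_le
      (((integrableOn_cell c₁).add (integrableOn_cell c₂)).const_mul M) (ae_of_all _ fun y => ?_)).trans ?_
    · rw [norm_mul, norm_mul, Complex.norm_real, Real.norm_eq_abs]
      refine (mul_le_mul_of_nonneg_left (hu x y) (by positivity)).trans (le_of_eq ?_)
      simp only [Pi.add_apply]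
      ring
    · rw [integral_const_mul, integral_add' (integrableOn_cell c₁) (integrableOn_cell c₂),
        setIntegral_cell c₁, setIntegral_cell c₂]
      simp only [intervalIntegral.integral_const_mul, intervalIntegral.integral_mul_const]
      -- The choice `δ = 2^{-n}` makes `δ` and `(δ 4ⁿ)⁻¹` equal, while `(δ 8ⁿ)⁻¹` is no larger.
      have hδ : (0 : ℝ) < (1 / 2) ^ n := by positivity
      have a₁ := hC (4 ^ n) (by positivity) x.1
      have a₂ := hC (8 ^ n) (by positivity) x.2
      have m₁ := hC' (4 ^ n) (by positivity) _ hδ x.1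
      have m₂ := hC' (8 ^ n) (by positivity) _ hδ x.2
      have d₁ : ((1 / 2 : ℝ) ^ n + ((1 / 2 : ℝ) ^ n * ((4 ^ n : ℕ) : ℝ))⁻¹) = 2 * (1 / 2) ^ n := by
        push_cast
        rw [← mul_pow, ← inv_pow]; norm_num; ring
      have d₂ : ((1 / 2 : ℝ) ^ n + ((1 / 2 : ℝ) ^ n * ((8 ^ n : ℕ) : ℝ))⁻¹) ≤ 2 * (1 / 2) ^ n := by
        push_cast
        rw [← mul_pow, ← inv_pow]
        have : (((1 / 2 : ℝ) * 8)⁻¹) ^ n ≤ (1 / 2) ^ n := pow_le_pow_left₀ (by norm_num) (by norm_num) n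
        linarith
      rw [d₁] at m₁
      replace m₂ := m₂.trans (mul_le_mul_of_nonneg_left d₂ hC'0)
      have n₁ : 0 ≤ ∫ s in (0 : ℝ)..1, ‖kernel₁ cutoff (4 ^ n) (x.1 - s)‖ :=
        intervalIntegral.integral_nonneg zero_le_one fun _ _ => norm_nonneg _
      have n₂ : 0 ≤ ∫ s in (0 : ℝ)..1, ‖kernel₁ cutoff (8 ^ n) (x.2 - s)‖ :=
        intervalIntegral.integral_nonneg zero_le_one fun _ _ => norm_nonneg _
      have p₁ := mul_le_mul m₁ a₂ n₂ (by positivity)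
      have p₂ := mul_le_mul a₁ m₂ (intervalIntegral.integral_nonneg zero_le_one fun _ _ => by positivity)
        hC0
      refine (mul_le_mul_of_nonneg_left (add_le_add p₁ p₂) hM).trans (le_of_eq (by ring))
  rw [Metric.tendstoUniformly_iff]
  intro ε hε
  have ht : Tendsto (fun n : ℕ => 4 * M * C * C' * (1 / 2 : ℝ) ^ n) atTop (𝓝 0) := by
    simpa using (tendsto_pow_atTop_nhds_zero_of_lt_one (r := (1 / 2 : ℝ)) (by norm_num)
      (by norm_num)).const_mul (4 * M * C * C')
  filter_upwards [ht.eventually_lt_const hε] with n hn x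
  rw [dist_comm, Real.dist_eq]
  exact (bound n x).trans_lt hn

/-- Low-pass projections commute with derivatives, so uniform convergence for every test function
already gives convergence of all derivatives. -/
theorem tendsto_lowPass (u : TorusTest) : Tendsto (fun n => lowPass n u) atTop (𝓝 u) := by
  rw [TorusTest.tendsto_iff]
  intro j l
  have e : ∀ n, TorusTest.D₁^[j] (TorusTest.D₂^[l] (lowPass n u)) =
      lowPass n (TorusTest.D₁^[j] (TorusTest.D₂^[l] u)) := fun n => by
    rw [← ((commute_D₂_lowPass n).iterate_right l).eq, ← ((commute_D₁_lowPass n).iterate_right j).eq]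
  simp only [e]
  exact tendstoUniformly_lowPass _

theorem tendsto_integral_lowPart (f : PeriodicDistribution) (u : TorusTest) :
    Tendsto (fun n => ∫ y in cell, (lowPart f n) y * u y) atTop (𝓝 (f u)) := by
  have h := (f.continuous.tendsto u).comp (tendsto_lowPass u)
  refine h.congr fun n => ?_
  exact apply_lowPass f n u

end AnisotropicHolder

namespace AnisotropicHolder

open MeasureTheory Filter Topology
open scoped ContDiff ENNReal ComplexConjugate

/-! ### Decomposition of periodic distributions -/

theorem DyadicBound.hasSum_integral {α A : ℝ} {u : ℕ → TorusTest} (h : DyadicBound α A u) (hα : 0 < α)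
    (w : TorusTest) :
    HasSum (fun n => ∫ x in cell, (u n) x * w x) (∫ x in cell, (∑' n, (u n) x) * w x) := by
  obtain ⟨M, hM, hw⟩ := w.isPeriodic.exists_bound w.continuous
  have hs : Summable fun n : ℕ => A * ((4 : ℝ) ^ n) ^ (-α) * M :=
    ((summable_four_pow_rpow (neg_neg_of_pos hα)).mul_left A).mul_right M
  have hi : ∀ n, IntegrableOn (fun x => (u n) x * w x) cell := fun n => integrableOn_cell (by fun_prop)
  have hb : ∀ n x, ‖(u n) x * w x‖ ≤ A * ((4 : ℝ) ^ n) ^ (-α) * M := fun n x => by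
    rw [norm_mul]
    exact mul_le_mul (h.zero n x) (hw x) (norm_nonneg _) ((abs_nonneg _).trans (h.zero n x))
  have key := hasSum_integral_of_summable_integral_norm (μ := volume.restrict cell)
    (F := fun n x => (u n) x * w x) hi (hs.of_nonneg_of_le
      (fun n => integral_nonneg fun x => norm_nonneg _) fun n => ?_)
  · simpa only [tsum_mul_right] using key
  · have h2 := integral_mono (hi n).norm (integrable_const (A * ((4 : ℝ) ^ n) ^ (-α) * M)) (hb n)
    simpa using h2

/-- Dyadic pieces of `f`, divided `j` times by `∂₁`. -/
noncomputable def piece₁ (f : PeriodicDistribution) (j n : ℕ) : TorusTest :=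
  blockTest f n ((2 * Real.pi * Complex.I * 4 ^ n)⁻¹ ^ j) (annulus 4 j) (cutoffAt 8)

/-- Dyadic pieces of `f`, divided by `∂₂`. -/
noncomputable def piece₂ (f : PeriodicDistribution) (n : ℕ) : TorusTest :=
  blockTest f n (2 * Real.pi * Complex.I * 8 ^ n)⁻¹ cutoff (annulus 8 1)

theorem D₁_piece₁ (f : PeriodicDistribution) (j n : ℕ) :
    TorusTest.D₁ (piece₁ f (j + 1) n) = piece₁ f j n := by
  have h0 : (2 * Real.pi * Complex.I * 4 ^ n : ℂ) ≠ 0 := by simp [Real.pi_ne_zero]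
  rw [piece₁, D₁_blockTest, annulus_succ_mul (by norm_num), pow_succ', mul_inv_cancel_left₀ h0, piece₁]

theorem lowPart_succ_eq (f : PeriodicDistribution) (n : ℕ) :
    lowPart f (n + 1) = lowPart f n + (piece₁ f 0 n + TorusTest.D₂ (piece₂ f n)) := by
  have h0 : (2 * Real.pi * Complex.I * 8 ^ n : ℂ) ≠ 0 := by simp [Real.pi_ne_zero]
  rw [lowPart_succ, piece₁, pow_zero, piece₂, D₂_blockTest, annulus_succ_mul (by norm_num),
    mul_inv_cancel₀ h0]

/-- Each division by `∂₁` contributes a factor `(2π4ⁿ)⁻¹`, which raises the regularity by one. -/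
theorem exists_dyadicBound_piece₁ (β : ℝ) (j : ℕ) : ∃ C, 0 ≤ C ∧
    ∀ (f : PeriodicDistribution) (N : ℝ), HeatBound β N f → DyadicBound (β + j) (C * N) (piece₁ f j) := by
  refine exists_dyadicBound_blockTest (isBump_annulus (by norm_num) (by norm_num) j)
    (isBump_cutoffAt (by norm_num) (by norm_num)) β j fun n => ?_
  have hpi := Real.pi_gt_three
  rw [Real.rpow_neg (by positivity), Real.rpow_natCast, norm_pow, ← inv_pow, norm_inv]
  refine pow_le_pow_left₀ (by positivity) (inv_anti₀ (by positivity) ?_) j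
  simp only [norm_mul, norm_pow, Complex.norm_ofNat, Complex.norm_real, Complex.norm_I, Real.norm_eq_abs,
    abs_of_pos Real.pi_pos, mul_one]
  exact le_mul_of_one_le_left (by positivity) (by linarith)

theorem exists_dyadicBound_piece₂ (β : ℝ) : ∃ C, 0 ≤ C ∧
    ∀ (f : PeriodicDistribution) (N : ℝ), HeatBound β N f →
      DyadicBound (β + 3 / 2) (C * N) (piece₂ f) := by
  refine exists_dyadicBound_blockTest isBump_cutoff
    (isBump_annulus (by norm_num) (by norm_num) 1) β (3 / 2) fun n => ?_
  have hpi := Real.pi_gt_three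
  rw [Real.rpow_neg (by positivity), ← eight_pow_eq, norm_inv]
  refine inv_anti₀ (by positivity) ?_
  simp only [norm_mul, norm_pow, Complex.norm_ofNat, Complex.norm_real, Complex.norm_I, Real.norm_eq_abs,
    abs_of_pos Real.pi_pos, mul_one]
  exact le_mul_of_one_le_left (by positivity) (by linarith)

theorem integral_lowPart (f : PeriodicDistribution) (u : TorusTest) (n : ℕ) :
    ∫ x in cell, (lowPart f n) x * u x = (∫ x in cell, average f * u x) +
      ((∑ m ∈ Finset.range n, ∫ x in cell, (piece₁ f 0 m) x * u x) +
        ∑ m ∈ Finset.range n, -∫ x in cell, (piece₂ f m) x * (TorusTest.D₂ u) x) := by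
  induction n with
  | zero => simp [lowPart_zero]
  | succ n ih =>
    have add : ∀ v w : TorusTest, ∫ x in cell, (v + w) x * u x =
        (∫ x in cell, v x * u x) + ∫ x in cell, w x * u x := fun v w => by
      simp only [TorusTest.coe_add, Pi.add_apply, add_mul]
      exact integral_add (integrableOn_cell (by fun_prop)) (integrableOn_cell (by fun_prop))
    rw [lowPart_succ_eq, Finset.sum_range_succ, Finset.sum_range_succ, integral_cell_mul_D₂, neg_neg,
      add, add, ih]
    ring

theorem apply_eq_of_hasSum {f : PeriodicDistribution} {u : TorusTest} {a b : ℝ}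
    (ha : HasSum (fun n => ∫ x in cell, (piece₁ f 0 n) x * u x) a)
    (hb : HasSum (fun n => ∫ x in cell, (piece₂ f n) x * (TorusTest.D₂ u) x) b) :
    f u = (∫ x in cell, average f * u x) + a - b := by
  have h1 := tendsto_integral_lowPart f u
  simp only [integral_lowPart] at h1
  have h2 := (ha.tendsto_sum_nat.add hb.neg.tendsto_sum_nat).const_add (∫ x in cell, average f * u x)
  rw [tendsto_nhds_unique h1 h2]
  ring

/-- Integrating by parts in each piece returns `piece₁ f 0 n`, the increment in the telescoping sum.
Positive regularity makes the series of pieces uniformly summable, so integrals and sums may be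
exchanged. -/
theorem isDecomp₁_tsum {f : PeriodicDistribution} {β A B : ℝ} (hβ : -1 < β)
    (hg : DyadicBound (β + 1) A (piece₁ f 1)) (hh : DyadicBound (β + 3 / 2) B (piece₂ f)) :
    IsDecomp₁ f (average f) (fun x => ∑' n, (piece₁ f 1 n) x) fun x => ∑' n, (piece₂ f n) x := by
  intro u
  refine apply_eq_of_hasSum (a := -∫ x in cell, (∑' n, (piece₁ f 1 n) x) * (TorusTest.D₁ u) x) ?_
    (hh.hasSum_integral (by linarith) (TorusTest.D₂ u))
  refine (hg.hasSum_integral (by linarith) (TorusTest.D₁ u)).neg.congr_fun fun n => ?_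
  rw [integral_cell_mul_D₁, neg_neg, D₁_piece₁]

theorem isDecomp₂_tsum {f : PeriodicDistribution} {β A B : ℝ} (hβ : -3 / 2 < β)
    (hg : DyadicBound (β + 2) A (piece₁ f 2)) (hh : DyadicBound (β + 3 / 2) B (piece₂ f)) :
    IsDecomp₂ f (average f) (fun x => ∑' n, (piece₁ f 2 n) x) fun x => ∑' n, (piece₂ f n) x := by
  intro u
  refine apply_eq_of_hasSum
    (a := ∫ x in cell, (∑' n, (piece₁ f 2 n) x) * (TorusTest.D₁ (TorusTest.D₁ u)) x) ?_
    (hh.hasSum_integral (by linarith) (TorusTest.D₂ u))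
  refine (hg.hasSum_integral (by linarith) (TorusTest.D₁ (TorusTest.D₁ u))).congr_fun fun n => ?_
  rw [integral_cell_mul_D₁, D₁_piece₁, integral_cell_mul_D₁, neg_neg, D₁_piece₁]

theorem add_add_le_ofReal {c A B N : ℝ} {G H : ℝ≥0∞} {C₁ C₂ C₃ : ℝ} (hN : 0 ≤ N) (h₁ : 0 ≤ C₁) (h₂ : 0 ≤ C₂)
    (h₃ : 0 ≤ C₃) (hA : 0 ≤ A) (hB : 0 ≤ B) (hc : |c| ≤ C₁ * N) (hG : G ≤ ENNReal.ofReal (A * (C₂ * N)))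
    (hH : H ≤ ENNReal.ofReal (B * (C₃ * N))) :
    ‖c‖ₑ + G + H ≤ ENNReal.ofReal ((C₁ + A * C₂ + B * C₃) * N) := by
  have h : ‖c‖ₑ ≤ ENNReal.ofReal (C₁ * N) := by
    rw [← ofReal_norm, Real.norm_eq_abs]; exact ENNReal.ofReal_le_ofReal hc
  refine (add_le_add (add_le_add h hG) hH).trans (le_of_eq ?_)
  rw [← ENNReal.ofReal_add (by positivity) (by positivity), ← ENNReal.ofReal_add (by positivity)
    (by positivity)]
  congr 1; ring

/-- The dyadic sums `g` and `h` compete in the infimum, with `c` the average. The assumptions `β ≠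
-1/2` and `β ≠ -1` keep `β + 3/2` and `β + 2` away from the exponent 1; for `β > -1` the exponent `β
+ 1` lies below 1 anyway. -/
theorem exists_negHolderNorm_le {β : ℝ} (hβ : β ∈ Set.Ioo (-3 / 2 : ℝ) 0) (h1 : β ≠ -1)
    (h2 : β ≠ -1 / 2) : ∃ C, 0 ≤ C ∧ ∀ (f : PeriodicDistribution) (N : ℝ), HeatBound β N f →
      negHolderNorm β f ≤ ENNReal.ofReal (C * N) := by
  obtain ⟨hβ0, hβ1⟩ := hβ
  obtain ⟨C₁, hC₁, bc⟩ := exists_abs_average_le β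
  obtain ⟨C₃, hC₃, bh⟩ := exists_dyadicBound_piece₂ β
  obtain ⟨B, hB, hh⟩ := exists_holderNorm_tsum_le (α := β + 3 / 2) (by linarith) (by linarith)
    (fun h => h2 (by linarith))
  rcases lt_or_gt_of_ne h1 with h | h
  · obtain ⟨C₂, hC₂, bg⟩ := exists_dyadicBound_piece₁ β 2
    norm_num at bg
    obtain ⟨A, hA, hg⟩ := exists_holderNorm_tsum_le (α := β + 2) (by linarith) (by linarith)
      (fun h => by linarith)
    refine ⟨C₁ + A * C₂ + B * C₃, by positivity, fun f N hN => ?_⟩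
    rw [negHolderNorm, if_neg (by linarith)]
    refine iInf_le_of_le (average f) (iInf_le_of_le (fun x => ∑' n, (piece₁ f 2 n) x)
      (iInf_le_of_le (fun x => ∑' n, (piece₂ f n) x) (iInf_le_of_le DyadicBound.isPeriodic
        (iInf_le_of_le DyadicBound.isPeriodic (iInf_le_of_le
          (isDecomp₂_tsum hβ0 (bg f N hN) (bh f N hN)) ?_)))))
    exact add_add_le_ofReal hN.nonneg hC₁ hC₂ hC₃ hA hB (bc f N hN) (hg _ _ (bg f N hN))
      (hh _ _ (bh f N hN))
  · obtain ⟨C₂, hC₂, bg⟩ := exists_dyadicBound_piece₁ β 1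
    norm_num at bg
    obtain ⟨A, hA, hg⟩ := exists_holderNorm_tsum_le (α := β + 1) (by linarith) (by linarith)
      (fun h => by linarith)
    refine ⟨C₁ + A * C₂ + B * C₃, by positivity, fun f N hN => ?_⟩
    rw [negHolderNorm, if_pos h]
    refine iInf_le_of_le (average f) (iInf_le_of_le (fun x => ∑' n, (piece₁ f 1 n) x)
      (iInf_le_of_le (fun x => ∑' n, (piece₂ f n) x) (iInf_le_of_le DyadicBound.isPeriodic
        (iInf_le_of_le DyadicBound.isPeriodic (iInf_le_of_le
          (isDecomp₁_tsum h (bg f N hN) (bh f N hN)) ?_)))))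
    exact add_add_le_ofReal hN.nonneg hC₁ hC₂ hC₃ hA hB (bc f N hN) (hg _ _ (bg f N hN))
      (hh _ _ (bh f N hN))

/-! ### Comparison with the heat-kernel supremum -/

theorem heatBound_of_heatSup_ne_top {β : ℝ} {f : PeriodicDistribution}
    (h : heatSup (Set.Ioc 0 1) β f ≠ ⊤) : HeatBound β (heatSup (Set.Ioc 0 1) β f).toReal f := by
  intro T hT x
  have hT3 : 0 < T ^ (1 / 3 : ℝ) := Real.rpow_pos_of_pos hT.1 _
  have h1 : ENNReal.ofReal ((T ^ (1 / 3 : ℝ)) ^ (-β)) * ‖conv (heatKernel T) f x‖ₑ ≤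
      heatSup (Set.Ioc 0 1) β f :=
    (mul_le_mul_right (le_iSup (fun x => ‖conv (heatKernel T) f x‖ₑ) x) _).trans
      (le_iSup₂ (f := fun T (_ : T ∈ Set.Ioc (0 : ℝ) 1) => ENNReal.ofReal ((T ^ (1 / 3 : ℝ)) ^ (-β)) *
        supNorm (conv (heatKernel T) f)) T hT)
  have h2 := ENNReal.toReal_mono h h1
  rw [ENNReal.toReal_mul, ENNReal.toReal_ofReal (by positivity), toReal_enorm, Real.norm_eq_abs,
    Real.rpow_neg hT3.le, inv_mul_le_iff₀ (by positivity)] at h2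
  linarith

theorem exists_negHolderNorm_le_heatSup {β : ℝ} (hβ : β ∈ Set.Ioo (-3 / 2 : ℝ) 0) (h1 : β ≠ -1)
    (h2 : β ≠ -1 / 2) : ∃ C : NNReal, ∀ f : PeriodicDistribution,
      negHolderNorm β f ≤ C * heatSup (Set.Ioc 0 1) β f := by
  obtain ⟨C, hC0, hC⟩ := exists_negHolderNorm_le hβ h1 h2
  -- Adding 1 keeps the right side infinite when the supremum is infinite, even if `C = 0`.
  refine ⟨Real.toNNReal C + 1, fun f => ?_⟩
  by_cases h : heatSup (Set.Ioc 0 1) β f = ⊤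
  · rw [h, ENNReal.mul_top (by simp)]
    exact le_top
  · refine (hC f _ (heatBound_of_heatSup_ne_top h)).trans ?_
    rw [ENNReal.ofReal_mul hC0, ENNReal.ofReal_toReal h]
    gcongr
    exact ENNReal.coe_le_coe.2 le_self_add

theorem heatSup_le_maskSup {I : Set ℝ} (hI : ∀ T ∈ I, 0 < T ∧ T ^ (1 / 3 : ℝ) ∈ I) (β : ℝ)
    (f : PeriodicDistribution) : heatSup I β f ≤ maskSup (heatKernel 1) I β f := by
  refine iSup₂_le fun T hT => ?_
  rw [heatKernel_eq_rescale (hI T hT).1]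
  exact le_iSup₂ (f := fun l (_ : l ∈ I) => ENNReal.ofReal (l ^ (-β)) *
    supNorm (conv (rescale (heatKernel 1) l) f)) _ (hI T hT).2

theorem heatSup_mono {I J : Set ℝ} (h : I ⊆ J) (β : ℝ) (f : PeriodicDistribution) :
    heatSup I β f ≤ heatSup J β f := biSup_mono h

/-- The lower bound uses only `T ≤ 1`, so enlarging the range of `T` preserves it. The upper bound
is the mask estimate for `ψ_1`, which covers all scales once the average vanishes. -/
theorem exists_heatSup_equiv {β : ℝ} (hβ : β ∈ Set.Ioo (-3 / 2 : ℝ) 0) (h1 : β ≠ -1)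
    (h2 : β ≠ -1 / 2) : ∃ C : NNReal,
      (∀ f : PeriodicDistribution,
        negHolderNorm β f ≤ C * heatSup (Set.Ioc 0 1) β f ∧
        heatSup (Set.Ioc 0 1) β f ≤ C * negHolderNorm β f) ∧
      (∀ f : PeriodicDistribution, average f = 0 →
        negHolderNorm β f ≤ C * heatSup (Set.Ioi 0) β f ∧
        heatSup (Set.Ioi 0) β f ≤ C * negHolderNorm β f) := by
  obtain ⟨C₁, h₁⟩ := exists_negHolderNorm_le_heatSup hβ h1 h2
  obtain ⟨C₂, h₂, h₃⟩ := mask_part hβ (rapidKernel_heatKernel one_pos)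
  have i₁ : ∀ a : ℝ≥0∞, C₁ * a ≤ ((C₁ + C₂ : NNReal) : ℝ≥0∞) * a := fun a => by
    gcongr; exact le_self_add
  have i₂ : ∀ a : ℝ≥0∞, C₂ * a ≤ ((C₁ + C₂ : NNReal) : ℝ≥0∞) * a := fun a => by
    gcongr; exact le_add_self
  refine ⟨C₁ + C₂, fun f => ⟨(h₁ f).trans (i₁ _), ?_⟩, fun f hf => ⟨?_, ?_⟩⟩
  · exact ((heatSup_le_maskSup (I := Set.Ioc 0 1) (fun T hT => ⟨hT.1, Real.rpow_pos_of_pos hT.1 _,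
      Real.rpow_le_one hT.1.le hT.2 (by norm_num)⟩) β f).trans (h₂ f)).trans (i₂ _)
  · refine ((h₁ f).trans (i₁ _)).trans ?_
    gcongr
    exact heatSup_mono Set.Ioc_subset_Ioi_self β f
  · exact ((heatSup_le_maskSup (I := Set.Ioi 0) (fun T hT => ⟨hT, Real.rpow_pos_of_pos hT _⟩) β f).trans
      (h₃ f hf)).trans (i₂ _)

end AnisotropicHolder

theorem mainTheorem8 :
    -- equivalence of norms, with a constant that depends on `β` only
    (∀ β ∈ Set.Ioo (-3 / 2 : ℝ) 0, β ≠ -1 → β ≠ -1 / 2 →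
      ∃ C : NNReal,
        (∀ f : PeriodicDistribution,
          negHolderNorm β f ≤ C * heatSup (Set.Ioc 0 1) β f ∧
          heatSup (Set.Ioc 0 1) β f ≤ C * negHolderNorm β f) ∧
        (∀ f : PeriodicDistribution, average f = 0 →
          negHolderNorm β f ≤ C * heatSup (Set.Ioi 0) β f ∧
          heatSup (Set.Ioi 0) β f ≤ C * negHolderNorm β f)) ∧
    -- general masks, with a constant that depends on `β` and the mask only
    (∀ β ∈ Set.Ioo (-3 / 2 : ℝ) 0, ∀ φ : 𝓢(ℝ × ℝ, ℝ),
      ∃ C : NNReal,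
        (∀ f : PeriodicDistribution,
          maskSup φ (Set.Ioc 0 1) β f ≤ C * negHolderNorm β f) ∧
        (∀ f : PeriodicDistribution, average f = 0 →
          maskSup φ (Set.Ioi 0) β f ≤ C * negHolderNorm β f)) :=
  ⟨fun _ hβ h1 h2 => exists_heatSup_equiv hβ h1 h2, fun _ hβ φ => mask_part hβ (rapidKernel_schwartz φ)⟩
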